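/- An instance of the Fault-Tolerant Path problem (FTP) consists of a finite graph $G=(V,E)$ (directed or undirected, parallel edges allowed) with nonnegative rational edge weights $w$, two vertices $s,t\in V$, a set $M\subseteq E$ of faulty edges, and an integer $k\ge 1$. A set $S\subseteq E$ is feasible if $S\setminus F$ contains an $s$-$t$ path for every $F\subseteq M$ with $|F|\le k$; the goal is to find a feasible $S$ of minimum cost $w(S)=\sum_{e\in S}w(e)$. Theorem. There is a polynomial-time $k$-approximation algorithm for FTP, both for directed and for undirected graphs: an algorithm which, given an instance (with $k$ as part of the input), runs in time polynomial in $|V|+|E|$ and the number of binary digits of $k$ and of the edge weights, and which outputs a feasible set $S$ with $w(S)\le k\cdot w(T)$ for every feasible set $T$ if a feasible set exists, and reports infeasibility otherwise. -/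

import Mathlib

namespace FTP

/-! ### The machine model: structured random-access programs with a step count

Memory consists of registers and of arrays of natural numbers. The available operations are
constants, register and (indirectly addressed) array reads, addition, truncated subtraction and
halving, each of unit cost. There is no multiplication: an operation lengthens the longest number
in memory by at most one bit, so that polynomial time in this model is polynomial time on a
Turing machine. -/

/-- A memory state: registers `reg 0, reg 1, …` and arrays `arr 0, arr 1, …`. -/
structure State where
  reg : ℕ → ℕ
  arr : ℕ → ℕ → ℕ

/-- Expressions. -/
inductive Expr where
  | lit (c : ℕ)
  | reg (x : ℕ)
  | arr (a : ℕ) (i : Expr)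
  | add (e₁ e₂ : Expr)
  | sub (e₁ e₂ : Expr)
  | half (e : Expr)

/-- The value of an expression; subtraction is truncated at `0`, `half` rounds down. -/
def Expr.eval (σ : State) : Expr → ℕ
  | .lit c => c
  | .reg x => σ.reg x
  | .arr a i => σ.arr a (i.eval σ)
  | .add e₁ e₂ => e₁.eval σ + e₂.eval σ
  | .sub e₁ e₂ => e₁.eval σ - e₂.eval σ
  | .half e => e.eval σ / 2

/-- The number of elementary operations that the evaluation of an expression takes. -/
def Expr.cost : Expr → ℕ
  | .lit _ => 1
  | .reg _ => 1
  | .arr _ i => i.cost + 1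
  | .add e₁ e₂ => e₁.cost + e₂.cost + 1
  | .sub e₁ e₂ => e₁.cost + e₂.cost + 1
  | .half e => e.cost + 1

/-- Programs. A condition holds if its value is not `0`. -/
inductive Cmd where
  | skip
  | assign (x : ℕ) (e : Expr)
  | store (a : ℕ) (i e : Expr)
  | seq (c₁ c₂ : Cmd)
  | ite (b : Expr) (c₁ c₂ : Cmd)
  | loop (b : Expr) (c : Cmd)

/-- Write `v` into register `x`. -/
def State.setReg (σ : State) (x v : ℕ) : State where
  reg := Function.update σ.reg x v
  arr := σ.arr

/-- Write `v` into position `i` of array `a`. -/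
def State.setArr (σ : State) (a i v : ℕ) : State where
  reg := σ.reg
  arr := Function.update σ.arr a (Function.update (σ.arr a) i v)

/-- `Run c σ n τ`: the program `c`, started in the state `σ`, halts after `n` steps in the
state `τ`. -/
inductive Run : Cmd → State → ℕ → State → Prop
  | skip (σ : State) : Run .skip σ 1 σ
  | assign (x : ℕ) (e : Expr) (σ : State) :
      Run (.assign x e) σ (e.cost + 1) (σ.setReg x (e.eval σ))
  | store (a : ℕ) (i e : Expr) (σ : State) :
      Run (.store a i e) σ (i.cost + e.cost + 1) (σ.setArr a (i.eval σ) (e.eval σ))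
  | seq {c₁ c₂ : Cmd} {σ τ υ : State} {n₁ n₂ : ℕ} :
      Run c₁ σ n₁ τ → Run c₂ τ n₂ υ → Run (.seq c₁ c₂) σ (n₁ + n₂) υ
  | iteTrue {b : Expr} {c₁ c₂ : Cmd} {σ τ : State} {n : ℕ} :
      b.eval σ ≠ 0 → Run c₁ σ n τ → Run (.ite b c₁ c₂) σ (b.cost + 1 + n) τ
  | iteFalse {b : Expr} {c₁ c₂ : Cmd} {σ τ : State} {n : ℕ} :
      b.eval σ = 0 → Run c₂ σ n τ → Run (.ite b c₁ c₂) σ (b.cost + 1 + n) τ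
  | loopDone {b : Expr} {c : Cmd} {σ : State} :
      b.eval σ = 0 → Run (.loop b c) σ (b.cost + 1) σ
  | loopStep {b : Expr} {c : Cmd} {σ τ υ : State} {n₁ n₂ : ℕ} :
      b.eval σ ≠ 0 → Run c σ n₁ τ → Run (.loop b c) τ n₂ υ →
        Run (.loop b c) σ (b.cost + 1 + n₁ + n₂) υ

/-- Programs are deterministic: the running time and the final state are determined by the
program and the initial state. -/
theorem Run.deterministic {c : Cmd} {σ τ τ' : State} {n n' : ℕ}
    (h : Run c σ n τ) (h' : Run c σ n' τ') : n = n' ∧ τ = τ' := by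
  induction h generalizing n' τ' with
  | skip | assign | store => cases h'; exact ⟨rfl, rfl⟩
  | seq _ _ ih₁ ih₂ =>
    cases h' with
    | seq g₁ g₂ =>
      obtain ⟨rfl, rfl⟩ := ih₁ g₁
      obtain ⟨rfl, rfl⟩ := ih₂ g₂
      exact ⟨rfl, rfl⟩
  | iteTrue hb _ ih =>
    cases h' with
    | iteTrue _ g => obtain ⟨rfl, rfl⟩ := ih g; exact ⟨rfl, rfl⟩
    | iteFalse gb _ => exact absurd gb hb
  | iteFalse hb _ ih =>
    cases h' with
    | iteTrue gb _ => exact absurd hb gb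
    | iteFalse _ g => obtain ⟨rfl, rfl⟩ := ih g; exact ⟨rfl, rfl⟩
  | loopDone hb =>
    cases h' with
    | loopDone _ => exact ⟨rfl, rfl⟩
    | loopStep gb _ _ => exact absurd hb gb
  | loopStep hb _ _ ih₁ ih₂ =>
    cases h' with
    | loopDone gb => exact absurd gb hb
    | loopStep _ g₁ g₂ =>
      obtain ⟨rfl, rfl⟩ := ih₁ g₁
      obtain ⟨rfl, rfl⟩ := ih₂ g₂
      exact ⟨rfl, rfl⟩

/-! ### The fault-tolerant path problem -/

/-- Whether edges may be traversed in one direction only or in both. -/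
inductive GraphKind where
  | directed
  | undirected

/-- An instance: a finite graph with `n` vertices and `m` edges (loops and parallel edges are
allowed), nonnegative rational edge weights, a set `faulty` of edges (the set `M`), terminals
`s`, `t`, and a number `k` of possible faults. In the undirected case the order of the two
endpoints `tail e`, `head e` carries no meaning. -/
structure Instance where
  n : ℕ
  m : ℕ
  tail : Fin m → Fin n
  head : Fin m → Fin n
  weight : Fin m → ℚ≥0
  faulty : Finset (Fin m)
  s : Fin n
  t : Fin n
  k : ℕ

namespace Instance

variable (I : Instance)

/-- The edge `e` leads from `u` to `v`. -/
def Joins (κ : GraphKind) (e : Fin I.m) (u v : Fin I.n) : Prop :=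
  match κ with
  | .directed => I.tail e = u ∧ I.head e = v
  | .undirected => (I.tail e = u ∧ I.head e = v) ∨ (I.tail e = v ∧ I.head e = u)

/-- The edge set `X` contains an `s`-`t` path (the empty path if `s = t`). -/
def HasPath (κ : GraphKind) (X : Finset (Fin I.m)) : Prop :=
  Relation.ReflTransGen (fun u v => ∃ e ∈ X, I.Joins κ e u v) I.s I.t

/-- `S` is a feasible solution: it contains an `s`-`t` path after the failure of any at most `k`
faulty edges. -/
def IsFeasible (κ : GraphKind) (S : Finset (Fin I.m)) : Prop :=
  ∀ F : Finset (Fin I.m), F ⊆ I.faulty → F.card ≤ I.k → I.HasPath κ (S \ F)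

/-- The cost of an edge set. -/
def cost (S : Finset (Fin I.m)) : ℚ≥0 := ∑ e ∈ S, I.weight e

/-- `S` is a feasible solution whose cost is at most `ρ` times the cost of every feasible
solution, that is, at most `ρ` times the optimum. -/
def IsApprox (κ : GraphKind) (ρ : ℚ≥0) (S : Finset (Fin I.m)) : Prop :=
  I.IsFeasible κ S ∧ ∀ T : Finset (Fin I.m), I.IsFeasible κ T → I.cost S ≤ ρ * I.cost T

/-- The size of the input: the number of vertices and edges plus the number of binary digits of
`k` and of the numerators and denominators of the weights. -/
def size : ℕ :=
  I.n + I.m + Nat.size I.k + ∑ e, (Nat.size (I.weight e).num + Nat.size (I.weight e).den)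

/-- The initial state of the machine on input `I`: `n, m, s, t, k` are in the registers
`0, …, 4`; the tails, the heads, the indicator of the faulty edges, and the numerators and the
denominators of the weights are in the arrays `0, …, 4`; everything else is `0`. -/
def load : State where
  reg x :=
    match x with
    | 0 => I.n
    | 1 => I.m
    | 2 => I.s
    | 3 => I.t
    | 4 => I.k
    | _ => 0
  arr a i :=
    if h : i < I.m then
      match a with
      | 0 => I.tail ⟨i, h⟩
      | 1 => I.head ⟨i, h⟩
      | 2 => if (⟨i, h⟩ : Fin I.m) ∈ I.faulty then 1 else 0
      | 3 => (I.weight ⟨i, h⟩).num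
      | 4 => (I.weight ⟨i, h⟩).den
      | _ => 0
    else 0

/-- The edge set that a final state describes: the nonzero positions of array `5`. -/
def output (σ : State) : Finset (Fin I.m) :=
  Finset.univ.filter fun e => σ.arr 5 e ≠ 0

end Instance

/-- The answer read off from the final state `σ` is correct with ratio `ρ`: if the instance has a
feasible solution, register `0` holds `1` and the edge set that is output is a `ρ`-approximate
solution; otherwise register `0` holds `0`, which reports infeasibility. -/
def CorrectAnswer (κ : GraphKind) (ρ : ℚ≥0) (I : Instance) (σ : State) : Prop :=
  ((∃ T, I.IsFeasible κ T) → σ.reg 0 = 1 ∧ I.IsApprox κ ρ (I.output σ)) ∧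
  ((¬ ∃ T, I.IsFeasible κ T) → σ.reg 0 = 0)

end FTP

/-! Set `K = min k (m + 1)`; since there are only `m` edges, this leaves the feasible sets
unchanged. Give faulty edges capacity `1` and safe edges capacity `K`. If every cut between `u` and
`v` has capacity at least `K + 1` in an edge set (`CutProp`), call the set a block from `u` to `v`.

Structure of feasible sets. Suppose that no cut meets a feasible set in a single enabled arc. A cut
containing a safe arc then contains a second arc, hence has capacity at least `K + 1`; a cut with
faulty arcs only has more than `K` of them, since otherwise all could fail (`Feasible.lt_cut_cap`).
So the set is a block. If some cut is crossed by a single arc, that arc is safe, and the edges on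
its two sides form disjoint smaller feasible sets (`Feasible.split`). Recursively, a feasible set
contains a chain of safe edges and blocks with pairwise disjoint edge sets. Hence its weight times
`K` is at least the distance from `s` to `t` in the auxiliary graph whose arcs are safe edges and
blocks, with weights multiplied by `K`; this is stated for potentials, the dual solutions of the
shortest path problem (`Feasible.potential_le`).

Blocks and flows. A minimum cost integral flow of value `K + 1` has a feasible support: each failing
edge destroys at most one unit, and at most `K` edges fail (`OptFlow.feasible_support`). Any block
`X` carries such a flow, with at most `K` units on each edge, so the optimal flow costs at most `K`
times the weight of `X`. By integrality the support weighs at most the flow cost.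
`OptFlow.weight_support_le` derives this by linear programming duality, without constructing a flow
inside `X`: the level sets of the dual potential are cuts of `X`.

Algorithm. A Dijkstra-type search from `s` maintains a feasible potential and, for each solved
vertex, a feasible set of weight at most its potential. It adds the cheapest extension by a flow
support or a safe edge and raises the potential of all unsolved vertices by the same amount
(`compareSol_sem`, `extendSol_sem`). At the end the stored set for `t` weighs at most the potential
of `t`, hence at most `K` times any feasible set. If `t` remains unsolved, the decomposition shows
infeasibility (`solve_sem`). The flows come from successive shortest paths, whose trees are grown by
the same raising of potentials.

The program is written with counting loops over unchanging registers, so a polynomial time bound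
follows from its syntax (`exists_run`). Capping `k` bounds the number of augmentations, and clearing
denominators by binary multiplication makes the weights integral. -/

namespace FTP

/-! ### Counting-loop programs: semantics, frame conditions and running time -/

/-- Structured programs whose only loops are counting loops: `count i r p` executes `p` for the
values `0, …, reg r - 1` of the register `i`. -/
inductive Prog where
  | skip
  | assign (x : ℕ) (e : Expr)
  | store (a : ℕ) (i e : Expr)
  | seq (p q : Prog)
  | ite (b : Expr) (p q : Prog)
  | count (i r : ℕ) (p : Prog)

infixr:60 " ;; " => Prog.seq

namespace Prog

/-- The program of the machine model that a structured program stands for. -/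
def compile : Prog → Cmd
  | skip => .skip
  | assign x e => .assign x e
  | store a i e => .store a i e
  | seq p q => .seq p.compile q.compile
  | ite b p q => .ite b p.compile q.compile
  | count i r p =>
    .seq (.assign i (.lit 0))
      (.loop (.sub (.reg r) (.reg i)) (.seq p.compile (.assign i (.add (.reg i) (.lit 1)))))

/-- The state transformation computed by a structured program. -/
def sem : Prog → State → State
  | skip, σ => σ
  | assign x e, σ => σ.setReg x (e.eval σ)
  | store a i e, σ => σ.setArr a (i.eval σ) (e.eval σ)
  | seq p q, σ => q.sem (p.sem σ)
  | ite b p q, σ => if b.eval σ ≠ 0 then p.sem σ else q.sem σ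
  | count i r p, σ =>
    Nat.rec (σ.setReg i 0) (fun j τ => (p.sem τ).setReg i (j + 1)) (σ.reg r)

theorem sem_seq (p q : Prog) (σ : State) : (seq p q).sem σ = q.sem (p.sem σ) := rfl

theorem sem_ite_of_ne {b : Expr} {σ : State} (h : b.eval σ ≠ 0) (p q : Prog) :
    (ite b p q).sem σ = p.sem σ := if_pos h

theorem sem_ite_of_eq {b : Expr} {σ : State} (h : b.eval σ = 0) (p q : Prog) :
    (ite b p q).sem σ = q.sem σ := if_neg (not_not.2 h)

/-- Whether the program may change the register `x`. -/
def writesReg : Prog → ℕ → Bool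
  | skip, _ => false
  | assign y _, x => x == y
  | store _ _ _, _ => false
  | seq p q, x => p.writesReg x || q.writesReg x
  | ite _ p q, x => p.writesReg x || q.writesReg x
  | count i _ p, x => x == i || p.writesReg x

/-- Whether the program may change the array `a`. -/
def writesArr : Prog → ℕ → Bool
  | skip, _ => false
  | assign _ _, _ => false
  | store b _ _, a => a == b
  | seq p q, a => p.writesArr a || q.writesArr a
  | ite _ p q, a => p.writesArr a || q.writesArr a
  | count _ _ p, a => p.writesArr a

/-- The loop bounds are registers in `P`, no register in `P` is ever changed, and no loop body
changes its loop counter. -/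
def wellFormed (P : List ℕ) : Prog → Bool
  | skip => true
  | assign x _ => !P.contains x
  | store _ _ _ => true
  | seq p q => p.wellFormed P && q.wellFormed P
  | ite _ p q => p.wellFormed P && q.wellFormed P
  | count i r p => P.contains r && !P.contains i && !p.writesReg i && p.wellFormed P

/-- A bound on the running time as a polynomial in a bound on the lengths of the loops. -/
noncomputable def timePoly : Prog → Polynomial ℕ
  | skip => 1
  | assign _ e => (e.cost + 1 : ℕ)
  | store _ i e => (i.cost + e.cost + 1 : ℕ)
  | seq p q => p.timePoly + q.timePoly
  | ite b p q => (b.cost + 1 : ℕ) + p.timePoly + q.timePoly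
  | count _ _ p => 2 + (Polynomial.X * (p.timePoly + 8) + 4)

/-- Frame rule: `writesReg` is a computable syntactic check, so for concrete programs and registers
the hypothesis is proved by `rfl`. `sem_arr` does the same for arrays. -/
theorem sem_reg {p : Prog} {x : ℕ} (h : p.writesReg x = false) (σ : State) :
    (p.sem σ).reg x = σ.reg x := by
  induction p generalizing σ with
  | skip => rfl
  | assign y e =>
    have : x ≠ y := by simpa [writesReg] using h
    simp [sem, State.setReg, this]
  | store => rfl
  | seq p q ihp ihq =>
    simp only [writesReg, Bool.or_eq_false_iff] at h
    simp [sem, ihp h.1, ihq h.2]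
  | ite b p q ihp ihq =>
    simp only [writesReg, Bool.or_eq_false_iff] at h
    simp only [sem]
    split_ifs
    · exact ihp h.1 σ
    · exact ihq h.2 σ
  | count i r p ih =>
    simp only [writesReg, Bool.or_eq_false_iff, beq_eq_false_iff_ne] at h
    simp only [sem]
    generalize σ.reg r = N
    induction N with
    | zero => simp [State.setReg, h.1]
    | succ N hN => simpa [State.setReg, h.1, ih h.2] using hN

theorem sem_arr {p : Prog} {a : ℕ} (h : p.writesArr a = false) (σ : State) :
    (p.sem σ).arr a = σ.arr a := by
  induction p generalizing σ with
  | skip => rfl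
  | assign y e => rfl
  | store b i e =>
    have : a ≠ b := by simpa [writesArr] using h
    simp [sem, State.setArr, this]
  | seq p q ihp ihq =>
    simp only [writesArr, Bool.or_eq_false_iff] at h
    simp [sem, ihp h.1, ihq h.2]
  | ite b p q ihp ihq =>
    simp only [writesArr, Bool.or_eq_false_iff] at h
    simp only [sem]
    split_ifs
    · exact ihp h.1 σ
    · exact ihq h.2 σ
  | count i r p ih =>
    simp only [writesArr] at h
    simp only [sem]
    generalize σ.reg r = N
    induction N with
    | zero => rfl
    | succ N hN => simpa [State.setReg, ih h] using hN

/-- The invariant rule for counting loops. -/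
theorem count_induction {i r : ℕ} {p : Prog} (Inv : ℕ → State → Prop) (σ : State)
    (h0 : Inv 0 (σ.setReg i 0))
    (hs : ∀ j τ, j < σ.reg r → Inv j τ → τ.reg i = j →
      (∀ x, (count i r p).writesReg x = false → τ.reg x = σ.reg x) →
      (∀ a, p.writesArr a = false → τ.arr a = σ.arr a) →
      Inv (j + 1) ((p.sem τ).setReg i (j + 1))) :
    Inv (σ.reg r) ((count i r p).sem σ) := by
  simp only [sem]
  have key : ∀ N, N ≤ σ.reg r → ∀ τ : State,
      τ = Nat.rec (motive := fun _ => State) (σ.setReg i 0)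
        (fun j τ => (p.sem τ).setReg i (j + 1)) N →
      Inv N τ ∧ τ.reg i = N ∧ (∀ x, (count i r p).writesReg x = false → τ.reg x = σ.reg x) ∧
        (∀ a, p.writesArr a = false → τ.arr a = σ.arr a) := by
    intro N
    induction N with
    | zero =>
      rintro - τ rfl
      refine ⟨h0, by simp [State.setReg], fun x hx => ?_, fun a _ => rfl⟩
      simp only [writesReg, Bool.or_eq_false_iff, beq_eq_false_iff_ne] at hx
      simp [State.setReg, hx.1]
    | succ N ih =>
      rintro hN τ rfl
      obtain ⟨h1, h2, h3, h4⟩ := ih (by omega) _ rfl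
      refine ⟨hs _ _ (by omega) h1 h2 h3 h4, by simp [State.setReg], fun x hx => ?_,
        fun a ha => ?_⟩
      · have hx' := h3 x hx
        simp only [writesReg, Bool.or_eq_false_iff, beq_eq_false_iff_ne] at hx
        simpa [State.setReg, hx.1, sem_reg hx.2] using hx'
      · simpa [State.setReg, sem_arr ha] using h4 a ha
  exact (key _ le_rfl _ rfl).1

theorem writesReg_of_wellFormed {P : List ℕ} {p : Prog} (h : p.wellFormed P = true)
    {x : ℕ} (hx : x ∈ P) : p.writesReg x = false := by
  induction p with
  | skip => rfl
  | assign y e =>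
    simp only [wellFormed, List.contains_eq_mem, Bool.not_eq_true', decide_eq_false_iff_not] at h
    simp only [writesReg, beq_eq_false_iff_ne]
    rintro rfl
    exact h hx
  | store => rfl
  | seq p q ihp ihq =>
    simp only [wellFormed, Bool.and_eq_true] at h
    simp [writesReg, ihp h.1, ihq h.2]
  | ite b p q ihp ihq =>
    simp only [wellFormed, Bool.and_eq_true] at h
    simp [writesReg, ihp h.1, ihq h.2]
  | count i r p ih =>
    simp only [wellFormed, Bool.and_eq_true, List.contains_eq_mem, Bool.not_eq_true',
      decide_eq_false_iff_not] at h
    simp only [writesReg, ih h.2, Bool.or_false, beq_eq_false_iff_ne]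
    rintro rfl
    exact h.1.1.2 hx

/-- A well-formed program halts with the computed state, within the polynomial time bound. -/
theorem exists_run {P : List ℕ} {p : Prog} (h : p.wellFormed P = true) {B : ℕ} (σ : State)
    (hB : ∀ r ∈ P, σ.reg r ≤ B) :
    ∃ n, Run p.compile σ n (p.sem σ) ∧ n ≤ p.timePoly.eval B := by
  induction p generalizing σ with
  | skip => exact ⟨_, .skip σ, by simp [timePoly]⟩
  | assign x e => exact ⟨_, .assign x e σ, by simp [timePoly, Polynomial.eval_natCast]⟩
  | store a i e => exact ⟨_, .store a i e σ, by simp [timePoly, Polynomial.eval_natCast]⟩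
  | seq p q ihp ihq =>
    simp only [wellFormed, Bool.and_eq_true] at h
    obtain ⟨n₁, r₁, b₁⟩ := ihp h.1 σ hB
    obtain ⟨n₂, r₂, b₂⟩ := ihq h.2 (p.sem σ) fun r hr => by
      rw [sem_reg (writesReg_of_wellFormed h.1 hr)]; exact hB r hr
    exact ⟨_, .seq r₁ r₂, by simp only [timePoly, Polynomial.eval_add]; omega⟩
  | ite b p q ihp ihq =>
    simp only [wellFormed, Bool.and_eq_true] at h
    obtain ⟨n₁, r₁, b₁⟩ := ihp h.1 σ hB
    obtain ⟨n₂, r₂, b₂⟩ := ihq h.2 σ hB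
    simp only [timePoly, Polynomial.eval_add, Polynomial.eval_natCast, Nat.cast_id]
    by_cases hb : b.eval σ = 0
    · have e : (ite b p q).sem σ = q.sem σ := by simp [sem, hb]
      rw [e]
      exact ⟨_, .iteFalse hb r₂, by omega⟩
    · have e : (ite b p q).sem σ = p.sem σ := by simp [sem, hb]
      rw [e]
      exact ⟨_, .iteTrue hb r₁, by omega⟩
  | count i r p ih =>
    simp only [wellFormed, Bool.and_eq_true, List.contains_eq_mem, Bool.not_eq_true',
      decide_eq_false_iff_not, decide_eq_true_eq] at h
    obtain ⟨⟨⟨hr, hi⟩, hpi⟩, hp⟩ := h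
    set S : ℕ → State := fun N => Nat.rec (motive := fun _ => State) (σ.setReg i 0)
        (fun j τ => (p.sem τ).setReg i (j + 1)) N with hS
    have Sreg : ∀ N, (S N).reg i = N ∧ ∀ x ∈ P, (S N).reg x = σ.reg x := by
      intro N
      have hne : ∀ x ∈ P, x ≠ i := by rintro x hx rfl; exact hi hx
      induction N with
      | zero => exact ⟨by simp [S, State.setReg], fun x hx => by simp [S, State.setReg, hne x hx]⟩
      | succ N hN =>
        refine ⟨by simp [S, State.setReg], fun x hx => ?_⟩
        have e : S (N + 1) = (p.sem (S N)).setReg i (N + 1) := rfl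
        rw [e]
        simp only [State.setReg, Function.update_of_ne (hne x hx)]
        rw [sem_reg (writesReg_of_wellFormed hp hx), hN.2 x hx]
    -- `Run.loopStep` peels off the first iteration whereas `S` appends the last one, so the
    -- induction is on the number `d` of iterations still to come. Each iteration costs `4` for the
    -- test and `4` for the increment besides the body; the final test costs `4`.
    have main : ∀ d, d ≤ σ.reg r → ∃ n,
        Run (.loop (.sub (.reg r) (.reg i)) (.seq p.compile (.assign i (.add (.reg i) (.lit 1)))))
          (S (σ.reg r - d)) n (S (σ.reg r)) ∧ n ≤ d * (p.timePoly.eval B + 8) + 4 := by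
      intro d
      induction d with
      | zero =>
        intro _
        refine ⟨_, .loopDone ?_, ?_⟩
        · simp [Expr.eval, (Sreg _).1, (Sreg _).2 r hr]
        · simp [Expr.cost]
      | succ d ihd =>
        intro hd
        obtain ⟨n₂, r₂, b₂⟩ := ihd (by omega)
        obtain ⟨n₁, r₁, b₁⟩ := ih hp (S (σ.reg r - (d + 1)))
          fun x hx => ((Sreg _).2 x hx).trans_le (hB x hx)
        have e : S (σ.reg r - d) = (p.sem (S (σ.reg r - (d + 1)))).setReg i
            ((Expr.add (.reg i) (.lit 1)).eval (p.sem (S (σ.reg r - (d + 1))))) := by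
          have : σ.reg r - d = σ.reg r - (d + 1) + 1 := by omega
          rw [this]
          simp only [Expr.eval, sem_reg hpi, (Sreg _).1]
          rfl
        refine ⟨_, .loopStep ?_ (.seq r₁ (.assign i _ _)) (e ▸ r₂), ?_⟩
        · simp only [Expr.eval, (Sreg _).1, (Sreg _).2 r hr]; omega
        · simp only [Expr.cost]; rw [add_mul]; omega
    obtain ⟨n, rn, bn⟩ := main (σ.reg r) le_rfl
    rw [Nat.sub_self] at rn
    refine ⟨_, .seq (.assign i (.lit 0) σ) rn, ?_⟩
    have := Nat.mul_le_mul_right (p.timePoly.eval B + 8) (hB r hr)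
    simp only [timePoly, Polynomial.eval_add, Polynomial.eval_mul, Polynomial.eval_X, Expr.cost,
      Polynomial.eval_ofNat]
    omega

end Prog
end FTP

namespace FTP

/-! ### Networks, cuts, and the decomposition of feasible sets at one-arc cuts -/

/-- A network: arcs `0, …, N - 1` between the vertices `0, …, n - 1` with capacities. Each arc
belongs to an edge `eid a`; edges carry weights, and those in `flt` are faulty. -/
structure Net where
  n : ℕ
  N : ℕ
  K : ℕ
  tl : ℕ → ℕ
  hd : ℕ → ℕ
  cap : ℕ → ℕ
  eid : ℕ → ℕ
  w : ℕ → ℕ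
  flt : Finset ℕ

namespace Net

/-- The consistency conditions on a network: distinct arcs of the same edge are opposite, arcs of
faulty edges have capacity at most `1`, and arcs of safe edges have capacity `K` or are disabled
by capacity `0`. -/
structure Valid (G : Net) : Prop where
  tl_lt : ∀ a < G.N, G.tl a < G.n
  hd_lt : ∀ a < G.N, G.hd a < G.n
  pair : ∀ a < G.N, ∀ b < G.N, G.eid a = G.eid b → a = b ∨ (G.tl a = G.hd b ∧ G.hd a = G.tl b)
  cap_faulty : ∀ a < G.N, G.eid a ∈ G.flt → G.cap a ≤ 1
  cap_safe : ∀ a < G.N, G.eid a ∉ G.flt → G.cap a ≠ 0 → G.cap a = G.K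
  one_le : 1 ≤ G.K

variable (G : Net)

/-- An enabled arc of an edge in `X` leads from `x` to `y`. -/
def Step (X : Finset ℕ) (x y : ℕ) : Prop :=
  ∃ a < G.N, G.eid a ∈ X ∧ G.cap a ≠ 0 ∧ G.tl a = x ∧ G.hd a = y

/-- `X` contains a path from `u` to `v` after the failure of any `K` faulty edges. -/
def Feasible (u v : ℕ) (X : Finset ℕ) : Prop :=
  ∀ F ⊆ G.flt, F.card ≤ G.K → Relation.ReflTransGen (G.Step (X \ F)) u v

/-- The weight of an edge set. -/
def weight (X : Finset ℕ) : ℕ := ∑ e ∈ X, G.w e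

/-- The arcs of edges in `X` that leave the vertex set `U`. -/
def cut (X U : Finset ℕ) : Finset ℕ :=
  (Finset.range G.N).filter fun a => G.eid a ∈ X ∧ G.tl a ∈ U ∧ G.hd a ∉ U

/-- Every cut between `u` and `v` has capacity more than `K` in `X`. -/
def CutProp (u v : ℕ) (X : Finset ℕ) : Prop :=
  ∀ U : Finset ℕ, u ∈ U → v ∉ U → G.K + 1 ≤ ∑ a ∈ G.cut X U, G.cap a

/-- A feasible solution from `x` to `y` of one of two basic kinds, a safe edge or an edge set
whose cuts have large capacity, has `K`-fold cost `c`. -/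
inductive Aux : ℕ → ℕ → ℕ → Prop
  -- The edge itself costs only `G.w (G.eid a)`; the factor `K` puts safe edges and blocks on the
  -- same scale, so that a chain of them inside `T` costs at most `K` times the weight of `T`.
  | safe (a : ℕ) : a < G.N → G.eid a ∉ G.flt → G.cap a ≠ 0 →
      Aux (G.tl a) (G.hd a) (G.K * G.w (G.eid a))
  | block (u v : ℕ) (X : Finset ℕ) : u < G.n → v < G.n → u ≠ v → G.CutProp u v X →
      Aux u v (G.K * G.weight X)

variable {G}

theorem mem_cut {X U : Finset ℕ} {a : ℕ} :
    a ∈ G.cut X U ↔ a < G.N ∧ G.eid a ∈ X ∧ G.tl a ∈ U ∧ G.hd a ∉ U := by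
  simp [cut]

theorem Valid.cap_le (hG : G.Valid) {a : ℕ} (ha : a < G.N) : G.cap a ≤ G.K := by
  have := hG.one_le
  by_cases h : G.eid a ∈ G.flt
  · exact (hG.cap_faulty a ha h).trans this
  · by_cases h0 : G.cap a = 0
    · omega
    · exact (hG.cap_safe a ha h h0).le

/-- Two distinct arcs of one edge are opposite, so at most one of them leaves `U`. Counting arcs
across a cut is therefore counting edges. -/
theorem Valid.eid_injOn_cut (hG : G.Valid) (X U : Finset ℕ) :
    Set.InjOn G.eid (G.cut X U : Set ℕ) := by
  intro a ha b hb h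
  rw [Finset.mem_coe, mem_cut] at ha hb
  rcases hG.pair a ha.1 b hb.1 h with h | ⟨h1, h2⟩
  · exact h
  · exact absurd (h1 ▸ ha.2.2.1) hb.2.2.2

theorem Step.mono {X Y : Finset ℕ} (h : X ⊆ Y) {x y : ℕ} : G.Step X x y → G.Step Y x y := by
  rintro ⟨a, h1, h2, h3⟩
  exact ⟨a, h1, h h2, h3⟩

theorem Feasible.refl (u : ℕ) (X : Finset ℕ) : G.Feasible u u X := fun _ _ _ => .refl

theorem Feasible.mono {u v : ℕ} {X Y : Finset ℕ} (h : G.Feasible u v X) (hXY : X ⊆ Y) :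
    G.Feasible u v Y := fun F hF hk =>
  Relation.ReflTransGen.mono (fun _ _ => Step.mono (Finset.sdiff_subset_sdiff hXY le_rfl))
    _ _ (h F hF hk)

theorem Feasible.trans {u v x : ℕ} {X : Finset ℕ} (h : G.Feasible u v X)
    (h' : G.Feasible v x X) : G.Feasible u x X := fun F hF hk => (h F hF hk).trans (h' F hF hk)

theorem Feasible.of_safe {a : ℕ} (ha : a < G.N) (hs : G.eid a ∉ G.flt) (hc : G.cap a ≠ 0) :
    G.Feasible (G.tl a) (G.hd a) {G.eid a} := fun F hF _ =>
  .single ⟨a, ha, by simp; exact fun h => hs (hF h), hc, rfl, rfl⟩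

theorem weight_union_le (X Y : Finset ℕ) : G.weight (X ∪ Y) ≤ G.weight X + G.weight Y := by
  unfold weight
  rw [← Finset.sum_union_inter]
  exact Nat.le_add_right _ _

/-- A feasible edge set meets every cut; if it has no small cut with a single arc, then all its
cuts have capacity more than `K`. -/
theorem Feasible.lt_cut_cap (hG : G.Valid) {u v : ℕ} {X U : Finset ℕ} (h : G.Feasible u v X)
    (hu : u ∈ U) (hv : v ∉ U)
    (h1 : ∀ a, (G.cut X U).filter (fun b => G.cap b ≠ 0) ≠ {a}) :
    G.K + 1 ≤ ∑ a ∈ G.cut X U, G.cap a := by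
  classical
  set C := (G.cut X U).filter (fun b => G.cap b ≠ 0) with hC
  have hsum : ∑ a ∈ G.cut X U, G.cap a = ∑ a ∈ C, G.cap a := by
    rw [hC, Finset.sum_filter_ne_zero]
  have hCc : C ⊆ G.cut X U := Finset.filter_subset _ _
  have hlt : ∀ a ∈ C, a < G.N := fun a ha => (mem_cut.1 (hCc ha)).1
  have hpos : ∀ a ∈ C, 1 ≤ G.cap a := fun a ha =>
    Nat.one_le_iff_ne_zero.2 (Finset.mem_filter.1 ha).2
  rw [hsum]
  by_cases hs : ∃ a ∈ C, G.eid a ∉ G.flt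
  · obtain ⟨a, ha, has⟩ := hs
    -- The safe arc `a` contributes `K`, and any second enabled arc supplies the missing unit.
    obtain ⟨b, hb, hba⟩ : ∃ b ∈ C, b ≠ a := by
      by_contra! hcon
      exact h1 a (Finset.eq_singleton_iff_unique_mem.2 ⟨ha, hcon⟩)
    have hca := hG.cap_safe a (hlt a ha) has (Finset.mem_filter.1 ha).2
    have hcb := hpos b hb
    rw [← Finset.add_sum_erase C _ ha]
    have : G.cap b ≤ ∑ x ∈ C.erase a, G.cap x :=
      Finset.single_le_sum (f := G.cap) (fun _ _ => Nat.zero_le _)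
        (Finset.mem_erase.2 ⟨hba, hb⟩)
    omega
  · push Not at hs
    -- With only faulty arcs across the cut, at most `K` of them could all fail at once, and `U`
    -- could not be left.
    have hcard : G.K + 1 ≤ C.card := by
      by_contra hlt'
      have hF := h (C.image G.eid) (by
        intro e he
        obtain ⟨a, ha, rfl⟩ := Finset.mem_image.1 he
        exact hs a ha) (Finset.card_image_le.trans (by omega))
      have : ∀ x, Relation.ReflTransGen (G.Step (X \ C.image G.eid)) u x → x ∈ U := by
        intro x hx
        induction hx with
        | refl => exact hu
        | tail _ hst ih =>
          obtain ⟨a, ha, hX, hc, rfl, rfl⟩ := hst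
          by_contra hout
          rw [Finset.mem_sdiff] at hX
          exact hX.2 (Finset.mem_image_of_mem _
            (Finset.mem_filter.2 ⟨mem_cut.2 ⟨ha, hX.1, ih, hout⟩, hc⟩))
      exact hv (this v hF)
    calc G.K + 1 ≤ C.card := hcard
      _ = ∑ a ∈ C, 1 := by simp
      _ ≤ _ := Finset.sum_le_sum hpos

/-- A feasible edge set with a single arc `a` across a cut splits, at this arc, into two feasible
edge sets. -/
theorem Feasible.split (hG : G.Valid) {u v : ℕ} {T U : Finset ℕ} (h : G.Feasible u v T)
    (hu : u ∈ U) (hv : v ∉ U) {a : ℕ}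
    (ha : (G.cut T U).filter (fun b => G.cap b ≠ 0) = {a}) :
    ∃ T₁ T₂ : Finset ℕ, T₁ ⊂ T ∧ T₂ ⊂ T ∧ G.eid a ∉ G.flt ∧ a < G.N ∧ G.cap a ≠ 0 ∧
      G.Feasible u (G.tl a) T₁ ∧ G.Feasible (G.hd a) v T₂ ∧
      G.weight T₁ + G.w (G.eid a) + G.weight T₂ ≤ G.weight T := by
  classical
  have haC : a ∈ (G.cut T U).filter (fun b => G.cap b ≠ 0) := by rw [ha]; simp
  obtain ⟨haC, hac⟩ := Finset.mem_filter.1 haC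
  obtain ⟨haN, haT, hatl, hahd⟩ := mem_cut.1 haC
  have huniq : ∀ b < G.N, G.eid b ∈ T → G.cap b ≠ 0 → G.tl b ∈ U → G.hd b ∉ U → b = a := by
    intro b h1 h2 h3 h4 h5
    have : b ∈ (G.cut T U).filter (fun b => G.cap b ≠ 0) :=
      Finset.mem_filter.2 ⟨mem_cut.2 ⟨h1, h2, h4, h5⟩, h3⟩
    rwa [ha, Finset.mem_singleton] at this
  -- The edges with an arc inside `U`, and below those with an arc outside `U`. Because the two arcs
  -- of an edge have the same endpoints, these sets are disjoint and omit the edge of `a`, which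
  -- makes the weights additive.
  set T₁ := T.filter fun e => ∃ b < G.N, G.eid b = e ∧ G.tl b ∈ U ∧ G.hd b ∈ U with hT₁
  set T₂ := T.filter fun e => ∃ b < G.N, G.eid b = e ∧ G.tl b ∉ U ∧ G.hd b ∉ U with hT₂
  have ha₁ : G.eid a ∉ T₁ := by
    intro h'
    obtain ⟨-, b, hb, hbe, h1, h2⟩ := Finset.mem_filter.1 h'
    rcases hG.pair b hb a haN hbe with rfl | ⟨h3, h4⟩
    · exact hahd h2
    · exact hahd (h3 ▸ h1)
  have ha₂ : G.eid a ∉ T₂ := by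
    intro h'
    obtain ⟨-, b, hb, hbe, h1, h2⟩ := Finset.mem_filter.1 h'
    rcases hG.pair b hb a haN hbe with rfl | ⟨h3, h4⟩
    · exact h1 hatl
    · exact h2 (h4 ▸ hatl)
  have hdisj : Disjoint T₁ T₂ := by
    rw [Finset.disjoint_left]
    intro e he₁ he₂
    obtain ⟨-, b, hb, hbe, h1, h2⟩ := Finset.mem_filter.1 he₁
    obtain ⟨-, c, hc, hce, h3, h4⟩ := Finset.mem_filter.1 he₂
    rcases hG.pair b hb c hc (hbe.trans hce.symm) with rfl | ⟨h5, h6⟩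
    · exact h3 h1
    · exact h4 (h5 ▸ h1)
  refine ⟨T₁, T₂, ?_, ?_, ?_, haN, hac, ?_, ?_, ?_⟩
  · exact Finset.ssubset_iff_subset_ne.2 ⟨Finset.filter_subset _ _, fun h' => ha₁ (h' ▸ haT)⟩
  · exact Finset.ssubset_iff_subset_ne.2 ⟨Finset.filter_subset _ _, fun h' => ha₂ (h' ▸ haT)⟩
  · intro hf
    -- If the only crossing edge were faulty, its failure alone, permitted since `1 ≤ K`, would
    -- separate `u` from `v`.
    have hp := h {G.eid a} (by simpa using hf) (by simpa using hG.one_le)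
    have : ∀ x, Relation.ReflTransGen (G.Step (T \ {G.eid a})) u x → x ∈ U := by
      intro x hx
      induction hx with
      | refl => exact hu
      | tail _ hst ih =>
        obtain ⟨b, hb, hX, hc, rfl, rfl⟩ := hst
        by_contra hout
        rw [Finset.mem_sdiff, Finset.mem_singleton] at hX
        exact hX.2 (by rw [huniq b hb hX.1 hc ih hout])
    exact hv (this v hp)
  · intro F hF hk
    have hp := h F hF hk
    -- The surviving path is followed up to its first exit from `U`, which must use `a`.
    have key : u ∈ U → Relation.ReflTransGen (G.Step (T₁ \ F)) u (G.tl a) := by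
      clear h
      induction hp using Relation.ReflTransGen.head_induction_on with
      | refl => exact fun h' => absurd h' hv
      | head hst _ ih =>
        intro hx
        obtain ⟨b, hb, hX, hc, rfl, rfl⟩ := hst
        rw [Finset.mem_sdiff] at hX
        by_cases hin : G.hd b ∈ U
        · refine .head ⟨b, hb, ?_, hc, rfl, rfl⟩ (ih hin hin)
          exact Finset.mem_sdiff.2 ⟨Finset.mem_filter.2 ⟨hX.1, b, hb, rfl, hx, hin⟩, hX.2⟩
        · rw [huniq b hb hX.1 hc hx hin]
    exact key hu
  · intro F hF hk
    have hp := h F hF hk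
    -- Symmetrically, the path is read backwards from `v` to its last exit from `U`.
    have key : v ∉ U → Relation.ReflTransGen (G.Step (T₂ \ F)) (G.hd a) v := by
      clear hv h
      induction hp with
      | refl => exact fun h' => absurd hu h'
      | tail _ hst ih =>
        intro hx
        obtain ⟨b, hb, hX, hc, rfl, rfl⟩ := hst
        rw [Finset.mem_sdiff] at hX
        by_cases hin : G.tl b ∈ U
        · rw [huniq b hb hX.1 hc hin hx]
        · refine .tail (ih hin) ⟨b, hb, ?_, hc, rfl, rfl⟩
          exact Finset.mem_sdiff.2 ⟨Finset.mem_filter.2 ⟨hX.1, b, hb, rfl, hin, hx⟩, hX.2⟩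
    exact key hv
  · have hsub : insert (G.eid a) (T₁ ∪ T₂) ⊆ T := by
      intro e he
      rcases Finset.mem_insert.1 he with rfl | he
      · exact haT
      · rcases Finset.mem_union.1 he with he | he <;> exact (Finset.mem_filter.1 he).1
    have hni : G.eid a ∉ T₁ ∪ T₂ := by simp [ha₁, ha₂]
    have := Finset.sum_le_sum_of_subset (f := G.w) hsub
    rw [Finset.sum_insert hni, Finset.sum_union hdisj] at this
    unfold weight
    omega

/-- A potential that is feasible for the basic solutions bounds `K` times the weight of every
feasible solution from below. -/
theorem Feasible.potential_le (hG : G.Valid) {R : ℕ → Prop} {d : ℕ → ℕ}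
    (hd : ∀ x y c, G.Aux x y c → R x → R y ∧ d y ≤ d x + c) {u v : ℕ} (hun : u < G.n)
    (hvn : v < G.n) {T : Finset ℕ} (h : G.Feasible u v T) (hu : R u) :
    R v ∧ d v ≤ d u + G.K * G.weight T := by
  induction T using Finset.strongInduction generalizing u v with
  | H T ih =>
  by_cases huv : u = v
  · subst huv; exact ⟨hu, Nat.le_add_right _ _⟩
  -- At a one-arc cut, the bound is chained through the part before the arc, the safe arc, and the
  -- part after it. Without such a cut, `T` is itself a block.
  by_cases hc : ∃ U : Finset ℕ, u ∈ U ∧ v ∉ U ∧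
      ∃ a, (G.cut T U).filter (fun b => G.cap b ≠ 0) = {a}
  · obtain ⟨U, hu', hv', a, ha⟩ := hc
    obtain ⟨T₁, T₂, h1, h2, has, haN, hac, hf1, hf2, hw⟩ := h.split hG hu' hv' ha
    obtain ⟨r1, d1⟩ := ih T₁ h1 hun (hG.tl_lt a haN) hf1 hu
    obtain ⟨r2, d2⟩ := hd _ _ _ (.safe a haN has hac) r1
    obtain ⟨r3, d3⟩ := ih T₂ h2 (hG.hd_lt a haN) hvn hf2 r2
    refine ⟨r3, ?_⟩
    have := Nat.mul_le_mul_left G.K hw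
    rw [mul_add, mul_add] at this
    omega
  · push Not at hc
    exact hd _ _ _ (.block u v T hun hvn huv fun U hu' hv' =>
      h.lt_cut_cap hG hu' hv' (hc U hu' hv')) hu

/-! ### Flows -/

/-- `f` is a flow of value `c` from `u` to `v` that is optimal, as witnessed by the potential
`p`. -/
structure OptFlow (G : Net) (u v c : ℕ) (f p : ℕ → ℕ) : Prop where
  cap_le : ∀ a < G.N, f a ≤ G.cap a
  balance : ∀ x < G.n,
    (∑ a ∈ Finset.range G.N, if G.tl a = x then f a else 0) + (if x = v then c else 0) =
    (∑ a ∈ Finset.range G.N, if G.hd a = x then f a else 0) + (if x = u then c else 0)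
  le_of_lt : ∀ a < G.N, f a < G.cap a → p (G.hd a) ≤ G.w (G.eid a) + p (G.tl a)
  le_of_pos : ∀ a < G.N, 0 < f a → G.w (G.eid a) + p (G.tl a) ≤ p (G.hd a)

/-- The edges used by a flow. -/
def support (G : Net) (f : ℕ → ℕ) : Finset ℕ :=
  ((Finset.range G.N).filter fun a => f a ≠ 0).image G.eid

/-- Summation of the flow balance against a function on the vertices. -/
theorem OptFlow.sum_balance (hG : G.Valid) {u v c : ℕ} {f p : ℕ → ℕ} (h : G.OptFlow u v c f p)
    (hu : u < G.n) (hv : v < G.n) (q : ℕ → ℤ) :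
    ∑ a ∈ Finset.range G.N, (f a : ℤ) * (q (G.hd a) - q (G.tl a)) = c * (q v - q u) := by
  have key : ∀ g : ℕ → ℕ, (∀ a < G.N, g a < G.n) →
      ∑ x ∈ Finset.range G.n, q x * (∑ a ∈ Finset.range G.N, if g a = x then (f a : ℤ) else 0) =
      ∑ a ∈ Finset.range G.N, (f a : ℤ) * q (g a) := by
    intro g hg
    simp_rw [Finset.mul_sum]
    rw [Finset.sum_comm]
    refine Finset.sum_congr rfl fun a ha => ?_
    rw [Finset.sum_eq_single (g a)]
    · simp [mul_comm]
    · intro b _ hb; simp [hb.symm]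
    · intro h'; exact absurd (Finset.mem_range.2 (hg a (Finset.mem_range.1 ha))) h'
  have key2 : ∀ z < G.n, ∑ x ∈ Finset.range G.n, q x * (if x = z then (c : ℤ) else 0) =
      q z * c := by
    intro z hz
    rw [Finset.sum_eq_single z]
    · simp
    · intro b _ hb; simp [hb]
    · intro h'; exact absurd (Finset.mem_range.2 hz) h'
  have := Finset.sum_congr (rfl : Finset.range G.n = Finset.range G.n) (fun x hx =>
    congrArg (fun z : ℕ => q x * (z : ℤ)) (h.balance x (Finset.mem_range.1 hx)))
  push_cast at this
  simp_rw [mul_add, Finset.sum_add_distrib] at this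
  rw [key _ hG.tl_lt, key _ hG.hd_lt, key2 _ hu, key2 _ hv] at this
  simp_rw [mul_sub, Finset.sum_sub_distrib]
  linarith

/-- The flow across a cut is the value of the flow. -/
theorem OptFlow.value_eq (hG : G.Valid) {u v c : ℕ} {f p : ℕ → ℕ} (h : G.OptFlow u v c f p)
    (hu : u < G.n) (hv : v < G.n) {U : Finset ℕ} (huU : u ∈ U) (hvU : v ∉ U) :
    (c : ℤ) = ∑ a ∈ Finset.range G.N, ((if G.tl a ∈ U ∧ G.hd a ∉ U then (f a : ℤ) else 0) -
      (if G.hd a ∈ U ∧ G.tl a ∉ U then (f a : ℤ) else 0)) := by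
  -- The indicator of the complement of `U` as potential: exactly the crossing arcs contribute, with
  -- sign.
  have := h.sum_balance hG hu hv fun x => if x ∈ U then 0 else 1
  simp only [huU, hvU, if_true, if_false] at this
  rw [← mul_one (c : ℤ)]
  rw [sub_zero] at this
  rw [← this]
  refine Finset.sum_congr rfl fun a _ => ?_
  by_cases h1 : G.tl a ∈ U <;> by_cases h2 : G.hd a ∈ U <;> simp [h1, h2]

/-- Let `U` be the set of vertices still reachable after the failure of `F`. Flow can leave `U` only
on arcs of edges in `F`; each carries at most one unit, and distinct such arcs belong to distinct
edges. So at most `K` of the `K + 1` units would get across. -/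
theorem OptFlow.feasible_support (hG : G.Valid) {u v : ℕ} {f p : ℕ → ℕ}
    (h : G.OptFlow u v (G.K + 1) f p) (hu : u < G.n) (hv : v < G.n) :
    G.Feasible u v (G.support f) := by
  classical
  intro F hF hk
  by_contra hno
  set U := (Finset.range G.n).filter fun x =>
    Relation.ReflTransGen (G.Step (G.support f \ F)) u x with hU
  have huU : u ∈ U := Finset.mem_filter.2 ⟨Finset.mem_range.2 hu, .refl⟩
  have hvU : v ∉ U := fun h' => hno (Finset.mem_filter.1 h').2
  have hc := h.value_eq hG hu hv huU hvU
  have hout : ∀ a < G.N, G.tl a ∈ U → G.hd a ∉ U → f a ≠ 0 → G.eid a ∈ F := by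
    intro a ha h1 h2 h3
    by_contra h4
    refine h2 (Finset.mem_filter.2 ⟨Finset.mem_range.2 (hG.hd_lt a ha),
      (Finset.mem_filter.1 h1).2.tail ⟨a, ha, ?_, ?_, rfl, rfl⟩⟩)
    · exact Finset.mem_sdiff.2 ⟨Finset.mem_image_of_mem _
        (Finset.mem_filter.2 ⟨Finset.mem_range.2 ha, h3⟩), h4⟩
    · have := h.cap_le a ha; omega
  have hle : ((G.K + 1 : ℕ) : ℤ) ≤ ∑ a ∈ G.cut F U, (1 : ℤ) := by
    rw [hc, cut, Finset.sum_filter]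
    refine Finset.sum_le_sum fun a ha => ?_
    have ha' := Finset.mem_range.1 ha
    have h2 : (0 : ℤ) ≤ (if G.hd a ∈ U ∧ G.tl a ∉ U then (f a : ℤ) else 0) := by
      split_ifs <;> simp
    by_cases h1 : G.tl a ∈ U ∧ G.hd a ∉ U
    · by_cases h3 : f a = 0
      · rw [if_pos h1, h3]; split_ifs <;> simp
      · have h4 := hout a ha' h1.1 h1.2 h3
        have h5 := h.cap_le a ha'
        have h6 := hG.cap_faulty a ha' (hF h4)
        rw [if_pos h1, if_pos (show G.eid a ∈ F ∧ G.tl a ∈ U ∧ G.hd a ∉ U from ⟨h4, h1⟩)]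
        omega
    · rw [if_neg h1, if_neg (show ¬ (G.eid a ∈ F ∧ G.tl a ∈ U ∧ G.hd a ∉ U) from
        fun h' => h1 h'.2)]
      omega
  have hcard : (G.cut F U).card ≤ F.card :=
    Finset.card_le_card_of_injOn G.eid (fun a ha => (mem_cut.1 ha).2.1) (hG.eid_injOn_cut F U)
  simp at hle
  omega

/-- The level sets of a potential turn the cut condition into a bound on the potential
difference. -/
theorem CutProp.potential_le (hG : G.Valid) {u v : ℕ} {X : Finset ℕ} (hX : G.CutProp u v X)
    (hu : u < G.n) (p : ℕ → ℕ) :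
    (p v - p u) * (G.K + 1) ≤ ∑ a ∈ (Finset.range G.N).filter (fun a => G.eid a ∈ X),
      G.cap a * (p (G.hd a) - p (G.tl a)) := by
  -- Each integer level between `p u` and `p v` gives a cut of capacity at least `K + 1`. In the sum
  -- over all levels an arc is counted once for each level that it crosses upwards, which the
  -- truncated difference bounds.
  have step : ∀ θ ∈ Finset.Ico (p u) (p v), G.K + 1 ≤
      ∑ a ∈ (Finset.range G.N).filter (fun a => G.eid a ∈ X),
        if p (G.tl a) ≤ θ ∧ θ < p (G.hd a) then G.cap a else 0 := by
    intro θ hθ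
    rw [Finset.mem_Ico] at hθ
    refine (hX ((Finset.range G.n).filter fun x => p x ≤ θ) (by simp [hu, hθ.1])
      (by simp [hθ.2])).trans (le_of_eq ?_)
    rw [← Finset.sum_filter, Finset.filter_filter]
    refine Finset.sum_congr ?_ fun _ _ => rfl
    ext a
    simp only [mem_cut, Finset.mem_filter, Finset.mem_range, not_and, not_le]
    refine and_congr_right fun ha => and_congr_right fun _ => ?_
    simp [hG.tl_lt a ha, hG.hd_lt a ha]
  calc (p v - p u) * (G.K + 1) = ∑ θ ∈ Finset.Ico (p u) (p v), (G.K + 1) := by simp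
    _ ≤ _ := Finset.sum_le_sum step
    _ = _ := Finset.sum_comm
    _ ≤ _ := by
      refine Finset.sum_le_sum fun a _ => ?_
      rw [← Finset.sum_filter, Finset.sum_const, smul_eq_mul, mul_comm]
      refine Nat.mul_le_mul_left _ ?_
      calc _ ≤ (Finset.Ico (p (G.tl a)) (p (G.hd a))).card := by
            refine Finset.card_le_card fun θ hθ => ?_
            simpa using (Finset.mem_filter.1 hθ).2
        _ = _ := by simp

/-- An optimal flow of value `K + 1` uses edges of weight at most `K` times that of any edge set
with large cuts. -/
theorem OptFlow.weight_support_le (hG : G.Valid) {u v : ℕ} {f p : ℕ → ℕ}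
    (h : G.OptFlow u v (G.K + 1) f p) (hu : u < G.n) (hv : v < G.n) {X : Finset ℕ}
    (hX : G.CutProp u v X) : G.weight (G.support f) ≤ G.K * G.weight X := by
  -- Integrality enters here: a used arc carries at least one unit, so its weight is at most its
  -- contribution to the flow cost.
  have h1 : G.weight (G.support f) ≤ ∑ a ∈ Finset.range G.N, f a * G.w (G.eid a) := by
    calc G.weight (G.support f)
        ≤ ∑ a ∈ (Finset.range G.N).filter (fun a => f a ≠ 0), G.w (G.eid a) := by
          unfold weight support
          exact Finset.sum_image_le_of_nonneg (fun _ _ => Nat.zero_le _)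
      _ ≤ ∑ a ∈ (Finset.range G.N).filter (fun a => f a ≠ 0), f a * G.w (G.eid a) := by
          refine Finset.sum_le_sum fun a ha => Nat.le_mul_of_pos_left _ ?_
          exact Nat.pos_of_ne_zero (Finset.mem_filter.1 ha).2
      _ ≤ _ := Finset.sum_le_sum_of_subset (Finset.filter_subset _ _)
  -- The dual variable of the capacity constraint of `a`: the excess of the potential difference
  -- over the weight, cut off at `0`.
  set q : ℕ → ℕ := fun a => p (G.hd a) - (p (G.tl a) + G.w (G.eid a)) with hq
  have h2 : (∑ a ∈ Finset.range G.N, f a * G.w (G.eid a)) +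
      ∑ a ∈ Finset.range G.N, G.cap a * q a ≤ (p v - p u) * (G.K + 1) := by
    have hb := h.sum_balance hG hu hv fun x => (p x : ℤ)
    -- Complementary slackness, arc by arc: the flow vanishes where the potential difference is
    -- below the weight and saturates the arc where it is above.
    have hle : ∑ a ∈ Finset.range G.N, (f a : ℤ) * (p (G.hd a) - p (G.tl a)) =
        ((∑ a ∈ Finset.range G.N, f a * G.w (G.eid a)) +
          ∑ a ∈ Finset.range G.N, G.cap a * q a : ℕ) := by
      push_cast
      rw [← Finset.sum_add_distrib]
      refine Finset.sum_congr rfl fun a ha => ?_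
      have ha' := Finset.mem_range.1 ha
      rcases lt_trichotomy (p (G.hd a)) (p (G.tl a) + G.w (G.eid a)) with hl | hl | hl
      · have h0 : f a = 0 := by
          by_contra h0
          have := h.le_of_pos a ha' (Nat.pos_of_ne_zero h0); omega
        have : q a = 0 := by simp only [hq]; omega
        simp [this, h0]
      · have : q a = 0 := by simp only [hq]; omega
        rw [this, hl]; push_cast; ring
      · have h0 : f a = G.cap a := by
          by_contra h0
          have h3 := h.cap_le a ha'
          have := h.le_of_lt a ha' (by omega); omega
        have : (q a : ℤ) = p (G.hd a) - (p (G.tl a) + G.w (G.eid a)) := by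
          simp only [hq]; omega
        rw [this, h0]; ring
    rw [hb] at hle
    -- The truncated difference is the true one: `p v < p u` would make a sum of nonnegative terms
    -- negative.
    have : (((p v - p u) * (G.K + 1) : ℕ) : ℤ) = ((G.K + 1 : ℕ) : ℤ) * (p v - p u) := by
      by_cases hpv : p u ≤ p v
      · push_cast [hpv]; ring
      · exfalso
        have : ((G.K + 1 : ℕ) : ℤ) * (p v - p u) < 0 := by
          refine mul_neg_of_pos_of_neg (by positivity) (by omega)
        omega
    rw [← this] at hle
    exact_mod_cast hle.ge
  have h3 := hX.potential_le hG hu p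
  have h4 : ∑ a ∈ (Finset.range G.N).filter (fun a => G.eid a ∈ X),
      G.cap a * (p (G.hd a) - p (G.tl a)) ≤
      G.K * G.weight X + ∑ a ∈ Finset.range G.N, G.cap a * q a := by
    -- Only arcs along which the potential rises matter. Of two opposite arcs at most one does so,
    -- hence each edge of `X` is charged once. The approximation factor comes from the bound `cap ≤
    -- K`.
    set A := (Finset.range G.N).filter (fun a => G.eid a ∈ X ∧ p (G.tl a) < p (G.hd a)) with hA
    have hinj : Set.InjOn G.eid (A : Set ℕ) := by
      intro a ha b hb he
      simp only [hA, Finset.coe_filter, Finset.mem_range, Set.mem_ofPred_eq] at ha hb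
      rcases hG.pair a ha.1 b hb.1 he with h | ⟨e1, e2⟩
      · exact h
      · rw [e1, e2] at ha; omega
    calc _ = ∑ a ∈ A, G.cap a * (p (G.hd a) - p (G.tl a)) := by
          symm
          refine Finset.sum_subset_zero_on_sdiff ?_ ?_ fun _ _ => rfl
          · intro a ha
            simp only [hA, Finset.mem_filter] at ha ⊢
            exact ⟨ha.1, ha.2.1⟩
          · intro a ha
            simp only [hA, Finset.mem_sdiff, Finset.mem_filter, not_and, not_lt] at ha
            have := ha.2 ha.1.1 ha.1.2
            rw [Nat.sub_eq_zero_of_le this, mul_zero]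
      _ ≤ ∑ a ∈ A, (G.K * G.w (G.eid a) + G.cap a * q a) := by
          refine Finset.sum_le_sum fun a ha => ?_
          have ha' := Finset.mem_range.1 (Finset.mem_filter.1 ha).1
          have : p (G.hd a) - p (G.tl a) ≤ G.w (G.eid a) + q a := by simp only [hq]; omega
          calc _ ≤ G.cap a * (G.w (G.eid a) + q a) := Nat.mul_le_mul_left _ this
            _ = G.cap a * G.w (G.eid a) + G.cap a * q a := mul_add _ _ _
            _ ≤ _ := Nat.add_le_add_right (Nat.mul_le_mul_right _ (hG.cap_le ha')) _
      _ = G.K * ∑ e ∈ A.image G.eid, G.w e + ∑ a ∈ A, G.cap a * q a := by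
          rw [Finset.sum_add_distrib, Finset.mul_sum, Finset.sum_image hinj]
      _ ≤ _ := by
          refine Nat.add_le_add (Nat.mul_le_mul_left _ (Finset.sum_le_sum_of_subset ?_))
            (Finset.sum_le_sum_of_subset (Finset.filter_subset _ _))
          intro e he
          obtain ⟨a, ha, rfl⟩ := Finset.mem_image.1 he
          exact (Finset.mem_filter.1 ha).2.1
  omega

/-- A set without leaving residual arcs bounds the capacity of the cut by the flow value. -/
theorem OptFlow.not_cutProp (hG : G.Valid) {u v c : ℕ} {f p : ℕ → ℕ} (h : G.OptFlow u v c f p)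
    (hu : u < G.n) (hv : v < G.n) (hc : c ≤ G.K) {U : Finset ℕ} (huU : u ∈ U) (hvU : v ∉ U)
    (hcl : ∀ a < G.N, G.tl a ∈ U → G.hd a ∉ U → G.cap a ≤ f a)
    (hcl' : ∀ a < G.N, G.hd a ∈ U → G.tl a ∉ U → f a = 0) (X : Finset ℕ) :
    ¬ G.CutProp u v X := by
  intro hX
  have h1 := hX U huU hvU
  have h2 := h.value_eq hG hu hv huU hvU
  have h3 : ((∑ a ∈ G.cut X U, G.cap a : ℕ) : ℤ) ≤ c := by
    rw [h2, cut, Finset.sum_filter]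
    push_cast
    refine Finset.sum_le_sum fun a ha => ?_
    have ha' := Finset.mem_range.1 ha
    by_cases hx : G.hd a ∈ U ∧ G.tl a ∉ U
    · rw [if_neg (by tauto), if_neg (by tauto), if_pos hx, hcl' a ha' hx.1 hx.2]; simp
    · rw [if_neg hx, sub_zero]
      by_cases hy : G.tl a ∈ U ∧ G.hd a ∉ U
      · rw [if_pos hy]
        have := hcl a ha' hy.1 hy.2
        split_ifs <;> simp [this]
      · rw [if_neg (by tauto), if_neg hy]
  omega

end Net
end FTP

namespace FTP
namespace Net

/-! ### Residual arcs and augmentation -/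

variable (G : Net)

/-- The source of the residual arc `(a, d)`: the arc `a` in forward direction if `d = 0`, and in
backward direction otherwise. -/
def rsrc (a d : ℕ) : ℕ := if d = 0 then G.tl a else G.hd a

/-- The target of the residual arc `(a, d)`. -/
def rdst (a d : ℕ) : ℕ := if d = 0 then G.hd a else G.tl a

/-- The reduced cost of the residual arc `(a, d)`. -/
def slack (p : ℕ → ℕ) (a d : ℕ) : ℕ :=
  if d = 0 then G.w (G.eid a) + p (G.tl a) - p (G.hd a)
  else p (G.hd a) - (G.w (G.eid a) + p (G.tl a))

/-- The residual arc `(a, d)` is available for the flow `f`. -/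
def Residual (f : ℕ → ℕ) (a d : ℕ) : Prop :=
  a < G.N ∧ d < 2 ∧ if d = 0 then f a < G.cap a else 0 < f a

/-- The residual arc `(a, d)` leaves the set of the vertices of nonzero rank. -/
def Leaves (f R : ℕ → ℕ) (a d : ℕ) : Prop :=
  G.Residual f a d ∧ R (G.rsrc a d) ≠ 0 ∧ R (G.rdst a d) = 0

/-- The result of a search for a residual arc that leaves the vertices of nonzero rank and has
least reduced cost, after the residual arcs with number `2 * a + d < c` have been inspected. -/
structure ScanInv (f p R : ℕ → ℕ) (c found mn arc new dir : ℕ) : Prop where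
  none : found = 0 → ∀ a d, d < 2 → 2 * a + d < c → ¬ G.Leaves f R a d
  leaves : found ≠ 0 → G.Leaves f R arc dir
  new_eq : found ≠ 0 → new = G.rdst arc dir
  min_eq : found ≠ 0 → mn = G.slack p arc dir
  min_le : found ≠ 0 → ∀ a d, d < 2 → 2 * a + d < c → G.Leaves f R a d → mn ≤ G.slack p a d

/-- A search tree in the residual graph, rooted at `u`, that consists of arcs of reduced cost `0`.
The rank `R x` of a vertex of the tree is positive and increases along the tree. -/
structure Tree (u : ℕ) (f p R pred dir : ℕ → ℕ) (g : ℕ) : Prop where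
  root : R u = 1
  eq_root : ∀ x < G.n, R x = 1 → x = u
  rank_le : ∀ x < G.n, R x ≤ g + 1
  residual : ∀ x < G.n, R x ≠ 0 → x ≠ u → G.Residual f (pred x) (dir x)
  dst : ∀ x < G.n, R x ≠ 0 → x ≠ u → G.rdst (pred x) (dir x) = x
  src : ∀ x < G.n, R x ≠ 0 → x ≠ u → R (G.rsrc (pred x) (dir x)) ≠ 0
  rank_lt : ∀ x < G.n, R x ≠ 0 → x ≠ u → R (G.rsrc (pred x) (dir x)) < R x
  tight : ∀ x < G.n, R x ≠ 0 → x ≠ u →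
    G.w (G.eid (pred x)) + p (G.tl (pred x)) = p (G.hd (pred x))
  progress : (∀ a d, ¬ G.Leaves f R a d) ∨
    g + 1 ≤ ((Finset.range G.n).filter fun x => R x ≠ 0).card

/-- `f` arises from the flow `f₀` of value `c` by sending one more unit to `v` along the tree
path from `cur`; `j` steps along the path have been made. -/
structure Augmenting (u v c : ℕ) (f₀ p R f : ℕ → ℕ) (cur j : ℕ) : Prop where
  cur_lt : cur < G.n
  reached : R cur ≠ 0
  cap_le : ∀ a < G.N, f a ≤ G.cap a
  balance : ∀ x < G.n,
    (∑ a ∈ Finset.range G.N, if G.tl a = x then f a else 0) + (if x = v then c + 1 else 0) =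
    (∑ a ∈ Finset.range G.N, if G.hd a = x then f a else 0) + (if x = u then c else 0) +
      (if x = cur then 1 else 0)
  le_of_lt : ∀ a < G.N, f a < G.cap a → p (G.hd a) ≤ G.w (G.eid a) + p (G.tl a)
  le_of_pos : ∀ a < G.N, 0 < f a → G.w (G.eid a) + p (G.tl a) ≤ p (G.hd a)
  keep : ∀ a < G.N, R (G.tl a) ≤ R cur → R (G.hd a) ≤ R cur → f a = f₀ a
  bound : cur = u ∨ R cur + j ≤ G.n + 1

variable {G}

/-- Nonnegativity of the weights makes the zero potential a certificate for the zero flow. -/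
theorem OptFlow.zero (G : Net) (u v : ℕ) {f p : ℕ → ℕ} (hf : ∀ a < G.N, f a = 0)
    (hp : ∀ x < G.n, p x = 0) (hG : G.Valid) : G.OptFlow u v 0 f p where
  cap_le a ha := by simp [hf a ha]
  balance x _ := by
    have : ∀ g : ℕ → ℕ, (∑ a ∈ Finset.range G.N, if g a = x then f a else 0) = 0 := fun g =>
      Finset.sum_eq_zero fun a ha => by simp [hf a (Finset.mem_range.1 ha)]
    simp [this]
  le_of_lt a ha _ := by simp [hp _ (hG.hd_lt a ha)]
  le_of_pos a ha h := by simp [hf a ha] at h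

theorem Valid.rdst_lt (hG : G.Valid) {a d : ℕ} (ha : a < G.N) : G.rdst a d < G.n := by
  unfold rdst; split_ifs
  exacts [hG.hd_lt a ha, hG.tl_lt a ha]

theorem Valid.rsrc_lt (hG : G.Valid) {a d : ℕ} (ha : a < G.N) : G.rsrc a d < G.n := by
  unfold rsrc; split_ifs
  exacts [hG.tl_lt a ha, hG.hd_lt a ha]

theorem Tree.init {u : ℕ} {f p R pred dir : ℕ → ℕ} (hu : u < G.n)
    (hR : ∀ x < G.n, R x = if x = u then 1 else 0) : G.Tree u f p R pred dir 0 := by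
  have h0 : ∀ x < G.n, R x ≠ 0 → x = u := by
    intro x hx h
    rw [hR x hx] at h
    by_contra h'
    simp [h'] at h
  constructor
  · simp [hR u hu]
  · exact fun x hx h => h0 x hx (by omega)
  · intro x hx; rw [hR x hx]; split_ifs <;> omega
  · exact fun x hx h h' => absurd (h0 x hx h) h'
  · exact fun x hx h h' => absurd (h0 x hx h) h'
  · exact fun x hx h h' => absurd (h0 x hx h) h'
  · exact fun x hx h h' => absurd (h0 x hx h) h'
  · exact fun x hx h h' => absurd (h0 x hx h) h'
  · right
    rw [Nat.zero_add, Nat.one_le_iff_ne_zero, Finset.card_ne_zero]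
    exact ⟨u, by simp [hu, hR u hu]⟩

/-- If no residual arc leaves the tree, it is complete. -/
theorem Tree.of_closed {u : ℕ} {f p R pred dir : ℕ → ℕ} {g : ℕ}
    (h : G.Tree u f p R pred dir g) (hc : ∀ a d, ¬ G.Leaves f R a d) :
    G.Tree u f p R pred dir (g + 1) :=
  { h with
    rank_le := fun x hx => (h.rank_le x hx).trans (by omega)
    progress := .inl hc }

/-- The other alternative of `progress` would put `n + 1` tree vertices among `n` vertices. -/
theorem Tree.closed {u : ℕ} {f p R pred dir : ℕ → ℕ} (h : G.Tree u f p R pred dir G.n) (a d : ℕ) :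
    ¬ G.Leaves f R a d := by
  rcases h.progress with h | h
  · exact h a d
  · have := (Finset.card_filter_le (Finset.range G.n) fun x => R x ≠ 0)
    rw [Finset.card_range] at this
    omega

/-- One step of the growth of the search tree. -/
theorem Tree.grow (hG : G.Valid) {u v c : ℕ} {f p R pred dir : ℕ → ℕ} {g : ℕ}
    (hf : G.OptFlow u v c f p) (h : G.Tree u f p R pred dir g) {arc d : ℕ}
    (hl : G.Leaves f R arc d)
    (hmin : ∀ b d', G.Leaves f R b d' → G.slack p arc d ≤ G.slack p b d')
    {p' R' pred' dir' : ℕ → ℕ}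
    (hp' : ∀ x < G.n, p' x = if R x = 0 then p x + G.slack p arc d else p x)
    (hR' : R' = Function.update R (G.rdst arc d) (g + 2))
    (hpred' : pred' = Function.update pred (G.rdst arc d) arc)
    (hdir' : dir' = Function.update dir (G.rdst arc d) d) :
    G.OptFlow u v c f p' ∧ G.Tree u f p' R' pred' dir' (g + 1) := by
  obtain ⟨⟨ha, hd, hres⟩, hsrc, hdst⟩ := hl
  set δ := G.slack p arc d with hδ
  set y := G.rdst arc d with hy
  have hyn : y < G.n := hG.rdst_lt ha
  have hf' : G.OptFlow u v c f p' := by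
    -- Raising the outside potentials by `δ` reduces the slack only of residual arcs leaving the
    -- tree, and `δ` is the least of these slacks. Backward residual arcs give the condition for
    -- positive flow.
    refine ⟨hf.cap_le, hf.balance, fun b hb hlt => ?_, fun b hb hpos => ?_⟩
    · have h1 := hf.le_of_lt b hb hlt
      have h2 : R (G.tl b) ≠ 0 → R (G.hd b) = 0 → δ ≤ G.slack p b 0 := fun h3 h4 =>
        hmin b 0 ⟨⟨hb, by omega, by simpa using hlt⟩, by simpa [rsrc] using h3,
          by simpa [rdst] using h4⟩
      simp only [slack, if_true] at h2
      rw [hp' _ (hG.hd_lt b hb), hp' _ (hG.tl_lt b hb)]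
      split_ifs with h3 h4 h4
      · omega
      · have := h2 h4 h3; omega
      · omega
      · omega
    · have h1 := hf.le_of_pos b hb hpos
      have h2 : R (G.hd b) ≠ 0 → R (G.tl b) = 0 → δ ≤ G.slack p b 1 := fun h3 h4 =>
        hmin b 1 ⟨⟨hb, by omega, by simpa using hpos⟩, by simpa [rsrc] using h3,
          by simpa [rdst] using h4⟩
      simp only [slack, one_ne_zero, if_false] at h2
      rw [hp' _ (hG.hd_lt b hb), hp' _ (hG.tl_lt b hb)]
      split_ifs with h3 h4 h4
      · omega
      · have := h2 h4 h3; omega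
      · omega
      · omega
  have hyu : y ≠ u := by rintro e; rw [e, h.root] at hdst; omega
  have hsy : G.rsrc arc d ≠ y := fun e => hsrc (e ▸ hdst)
  have hsn := hG.rsrc_lt (d := d) ha
  have hR'y : R' y = g + 2 := by simp [hR']
  have hR'n : ∀ x, x ≠ y → R' x = R x := fun x hx => by simp [hR', hx]
  have hpy : pred' y = arc := by simp [hpred']
  have hdy : dir' y = d := by simp [hdir']
  have hpn : ∀ x, x ≠ y → pred' x = pred x := fun x hx => by simp [hpred', hx]
  have hdn : ∀ x, x ≠ y → dir' x = dir x := fun x hx => by simp [hdir', hx]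
  have hold : ∀ x < G.n, x ≠ y → R' x ≠ 0 → x ≠ u → R (G.rsrc (pred x) (dir x)) ≠ 0 ∧
      G.rsrc (pred x) (dir x) ≠ y := by
    intro x hx hxy hx' hxu
    rw [hR'n x hxy] at hx'
    have := h.src x hx hx' hxu
    exact ⟨this, fun e => this (e ▸ hdst)⟩
  refine ⟨hf', ?_⟩
  constructor
  · rw [hR'n u hyu.symm, h.root]
  · intro x hx h1
    by_cases hxy : x = y
    · rw [hxy, hR'y] at h1; omega
    · exact h.eq_root x hx (by rwa [hR'n x hxy] at h1)
  · intro x hx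
    by_cases hxy : x = y
    -- All previous ranks are at most `g + 1`, so `g + 2` exceeds them; this makes ranks increase
    -- along the tree.
    · rw [hxy, hR'y]
    · rw [hR'n x hxy]; exact (h.rank_le x hx).trans (by omega)
  · intro x hx h1 h2
    by_cases hxy : x = y
    · subst hxy; rw [hpy, hdy]; exact ⟨ha, hd, hres⟩
    · rw [hpn x hxy, hdn x hxy]; exact h.residual x hx (by rwa [hR'n x hxy] at h1) h2
  · intro x hx h1 h2
    by_cases hxy : x = y
    · subst hxy; rw [hpy, hdy]
    · rw [hpn x hxy, hdn x hxy]; exact h.dst x hx (by rwa [hR'n x hxy] at h1) h2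
  · intro x hx h1 h2
    by_cases hxy : x = y
    · subst hxy; rw [hpy, hdy, hR'n _ hsy]; exact hsrc
    · have := hold x hx hxy h1 h2
      rw [hpn x hxy, hdn x hxy, hR'n _ this.2]; exact this.1
  · intro x hx h1 h2
    by_cases hxy : x = y
    · subst hxy
      rw [hpy, hdy, hR'n _ hsy, hR'y]
      have := h.rank_le _ hsn
      omega
    · have := hold x hx hxy h1 h2
      rw [hpn x hxy, hdn x hxy, hR'n _ this.2, hR'n x hxy]
      exact h.rank_lt x hx (by rwa [hR'n x hxy] at h1) h2
  · intro x hx h1 h2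
    by_cases hxy : x = y
    · subst hxy
      rw [hpy, hp' _ (hG.hd_lt arc ha), hp' _ (hG.tl_lt arc ha)]
      by_cases hd0 : d = 0
      · have h1 := hf.le_of_lt arc ha (by simpa [hd0] using hres)
        have h3 : R (G.tl arc) ≠ 0 := by simpa [rsrc, hd0] using hsrc
        have h4 : R (G.hd arc) = 0 := by simpa [hy, rdst, hd0] using hdst
        rw [if_neg h3, if_pos h4, hδ, slack, if_pos hd0]
        omega
      · have h1 := hf.le_of_pos arc ha (by simpa [hd0] using hres)
        have h3 : R (G.hd arc) ≠ 0 := by simpa [rsrc, hd0] using hsrc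
        have h4 : R (G.tl arc) = 0 := by simpa [hy, rdst, hd0] using hdst
        rw [if_neg h3, if_pos h4, hδ, slack, if_neg hd0]
        omega
    · have h3 := hold x hx hxy h1 h2
      rw [hR'n x hxy] at h1
      have h4 := h.tight x hx h1 h2
      have h5 := h.dst x hx h1 h2
      have h6 := (h.residual x hx h1 h2).1
      rw [hpn x hxy, hp' _ (hG.hd_lt _ h6), hp' _ (hG.tl_lt _ h6)]
      -- Both ends of an old tree arc lie in the tree, so their potentials do not move and the arc
      -- stays tight.
      have h7 : R (G.hd (pred x)) ≠ 0 ∧ R (G.tl (pred x)) ≠ 0 := by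
        have h3 := h3.1
        rw [← h5] at h1
        unfold rsrc at h3
        unfold rdst at h1
        split_ifs at h1 h3 <;> simp_all
      rw [if_neg h7.1, if_neg h7.2, h4]
  · rcases h.progress with hp | hp
    · exact absurd ⟨⟨ha, hd, hres⟩, hsrc, hdst⟩ (hp arc d)
    · right
      have hsub : insert y ((Finset.range G.n).filter fun x => R x ≠ 0) ⊆
          (Finset.range G.n).filter fun x => R' x ≠ 0 := by
        intro x hx
        rcases Finset.mem_insert.1 hx with rfl | hx
        · simp [hyn, hR'y]
        · rw [Finset.mem_filter] at hx ⊢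
          have : x ≠ y := fun e => hx.2 (e ▸ hdst)
          rwa [hR'n x this]
      have := Finset.card_le_card hsub
      rw [Finset.card_insert_of_notMem (by simp [hdst])] at this
      omega

/-- If the search tree is complete and does not contain `v`, no flow of value `K + 1` exists. -/
theorem Tree.not_cutProp (hG : G.Valid) {u v c : ℕ} {f p R pred dir : ℕ → ℕ}
    (hf : G.OptFlow u v c f p) (h : G.Tree u f p R pred dir G.n) (hu : u < G.n) (hv : v < G.n)
    (hc : c ≤ G.K) (hRv : R v = 0) (X : Finset ℕ) : ¬ G.CutProp u v X := by
  have hmem : ∀ x < G.n, x ∈ (Finset.range G.n).filter (fun x => R x ≠ 0) ↔ R x ≠ 0 := by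
    intro x hx; simp [hx]
  refine hf.not_cutProp hG hu hv hc (U := (Finset.range G.n).filter fun x => R x ≠ 0)
    ((hmem u hu).2 (by rw [h.root]; omega)) (fun h' => (hmem v hv).1 h' hRv) ?_ ?_ X
  · intro a ha h1 h2
    rw [hmem _ (hG.tl_lt a ha)] at h1
    rw [hmem _ (hG.hd_lt a ha), not_not] at h2
    by_contra h3
    exact h.closed a 0 ⟨⟨ha, by omega, by simpa using h3⟩, by simpa [rsrc] using h1,
      by simpa [rdst] using h2⟩
  · intro a ha h1 h2
    rw [hmem _ (hG.hd_lt a ha)] at h1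
    rw [hmem _ (hG.tl_lt a ha), not_not] at h2
    by_contra h3
    exact h.closed a 1 ⟨⟨ha, by omega, by simpa using Nat.pos_of_ne_zero h3⟩,
      by simpa [rsrc] using h1, by simpa [rdst] using h2⟩

/-- The additional unit demanded at `v` is first supplied at `cur = v` itself; every step then moves
this supply one tree arc closer to `u`. -/
theorem Augmenting.init {u v c : ℕ} {f p R pred dir : ℕ → ℕ} (hv : v < G.n)
    (hf : G.OptFlow u v c f p) (h : G.Tree u f p R pred dir G.n) (hRv : R v ≠ 0) :
    G.Augmenting u v c f p R f v 0 where
  cur_lt := hv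
  reached := hRv
  cap_le := hf.cap_le
  balance x hx := by
    have := hf.balance x hx
    split_ifs at this ⊢ <;> omega
  le_of_lt := hf.le_of_lt
  le_of_pos := hf.le_of_pos
  keep _ _ _ _ := rfl
  bound := .inr (h.rank_le v hv)

/-- The effect of changing one summand, written without subtraction so that it can be used in `ℕ`.
-/
theorem sum_ite_update {N q : ℕ} (hq : q < N) (g f : ℕ → ℕ) (b x : ℕ) :
    (∑ a ∈ Finset.range N, if g a = x then Function.update f q b a else 0) +
      (if g q = x then f q else 0) =
    (∑ a ∈ Finset.range N, if g a = x then f a else 0) + (if g q = x then b else 0) := by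
  have hq' := Finset.mem_range.2 hq
  rw [← Finset.add_sum_erase _ _ hq', ← Finset.add_sum_erase _ (fun a => ite _ (f a) _) hq']
  have : ∑ a ∈ (Finset.range N).erase q, (if g a = x then Function.update f q b a else 0) =
      ∑ a ∈ (Finset.range N).erase q, if g a = x then f a else 0 :=
    Finset.sum_congr rfl fun a ha => by
      rw [Function.update_of_ne (Finset.mem_erase.1 ha).1]
  rw [this, Function.update_self]
  omega

/-- One step along the augmenting path. -/
theorem Augmenting.step (hG : G.Valid) {u v c : ℕ} {f₀ p R f pred dir : ℕ → ℕ} {cur j : ℕ}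
    (h : G.Augmenting u v c f₀ p R f cur j) (ht : G.Tree u f₀ p R pred dir G.n) (hcu : cur ≠ u) :
    G.Augmenting u v c f₀ p R
      (Function.update f (pred cur)
        (if dir cur = 0 then f (pred cur) + 1 else f (pred cur) - 1))
      (G.rsrc (pred cur) (dir cur)) (j + 1) := by
  have hn := h.cur_lt
  have h1 := h.reached
  obtain ⟨ha, hd, hres⟩ := ht.residual cur hn h1 hcu
  have hdst := ht.dst cur hn h1 hcu
  have hsrc := ht.src cur hn h1 hcu
  have hlt := ht.rank_lt cur hn h1 hcu
  have htight := ht.tight cur hn h1 hcu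
  set q := pred cur with hq
  set s := G.rsrc q (dir cur) with hs
  have hends : R (G.tl q) ≤ R cur ∧ R (G.hd q) ≤ R cur ∧
      (R (G.tl q) = R cur ∨ R (G.hd q) = R cur) := by
    unfold rsrc at hs
    unfold rdst at hdst
    split_ifs at hs hdst
    · rw [← hs, hdst]; omega
    · rw [← hs, hdst]; omega
  -- The tree certifies residual capacity for `f₀`. It is still there for `f`, since no arc with
  -- both ends of rank at most `R cur` has been touched.
  have hfq : f q = f₀ q := h.keep q ha hends.1 hends.2.1
  constructor
  · exact hG.rsrc_lt ha
  · exact hsrc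
  · intro a ha'
    by_cases haq : a = q
    · subst haq
      rw [Function.update_self]
      have := h.cap_le _ ha
      split_ifs with hd0
      · rw [if_pos hd0] at hres; omega
      · omega
    · rw [Function.update_of_ne haq]; exact h.cap_le a ha'
  · intro x hx
    have hb := h.balance x hx
    have s1 := sum_ite_update ha G.tl f (if dir cur = 0 then f q + 1 else f q - 1) x
    have s2 := sum_ite_update ha G.hd f (if dir cur = 0 then f q + 1 else f q - 1) x
    unfold rsrc at hs
    unfold rdst at hdst
    by_cases hd0 : dir cur = 0
    · simp only [hd0, if_true] at s1 s2 hs hdst ⊢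
      rw [← hs] at s1
      rw [hdst] at s2
      simp only [eq_comm (a := s), eq_comm (a := cur)] at s1 s2
      split_ifs at s1 s2 hb ⊢ <;> omega
    · simp only [hd0, if_false] at s1 s2 hs hdst hres ⊢
      rw [← hs] at s2
      rw [hdst] at s1
      simp only [eq_comm (a := s), eq_comm (a := cur)] at s1 s2
      split_ifs at s1 s2 hb ⊢ <;> omega
  · intro a ha' hlt'
    by_cases haq : a = q
    · subst haq; omega
    · rw [Function.update_of_ne haq] at hlt'; exact h.le_of_lt a ha' hlt'
  · intro a ha' hpos
    by_cases haq : a = q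
    · subst haq; omega
    · rw [Function.update_of_ne haq] at hpos; exact h.le_of_pos a ha' hpos
  · intro a ha' h2 h3
    -- The arc just changed has an end of rank `R cur`, which is larger than the rank of the new
    -- current vertex.
    have haq : a ≠ q := by rintro rfl; omega
    rw [Function.update_of_ne haq]
    exact h.keep a ha' (by omega) (by omega)
  · right
    rcases h.bound with h' | h'
    · exact absurd h' hcu
    · omega

/-- Every step before reaching `u` lowers the rank. After `n` steps the rank bound leaves only rank
`1`, which belongs to the root alone; there the supply becomes the extra unit leaving `u`. -/
theorem Augmenting.finish {u v c : ℕ} {f₀ p R f pred dir : ℕ → ℕ} {cur : ℕ}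
    (h : G.Augmenting u v c f₀ p R f cur G.n) (ht : G.Tree u f₀ p R pred dir G.n) :
    G.OptFlow u v (c + 1) f p := by
  have hcu : cur = u := by
    rcases h.bound with h' | h'
    · exact h'
    · exact ht.eq_root _ h.cur_lt (by have := h.reached; omega)
  refine ⟨h.cap_le, fun x hx => ?_, h.le_of_lt, h.le_of_pos⟩
  have := h.balance x hx
  rw [hcu] at this
  split_ifs at this ⊢ <;> omega

/-- The loop always makes `n` iterations, so it idles once `u` has been reached. -/
theorem Augmenting.stay {u v c : ℕ} {f₀ p R f : ℕ → ℕ} {j : ℕ}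
    (h : G.Augmenting u v c f₀ p R f u j) : G.Augmenting u v c f₀ p R f u (j + 1) :=
  { h with bound := .inl rfl }

end Net
end FTP

namespace FTP

/-! ### Registers and arrays of the program -/

notation "r_n" => (0 : ℕ)
notation "r_m" => (1 : ℕ)
notation "r_s" => (2 : ℕ)
notation "r_t" => (3 : ℕ)
notation "r_k" => (4 : ℕ)
notation "r_arcs" => (5 : ℕ)
notation "r_cap" => (6 : ℕ)
notation "r_value" => (7 : ℕ)
notation "r_bits" => (8 : ℕ)
notation "r_u" => (10 : ℕ)
notation "r_v" => (11 : ℕ)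
notation "r_ok" => (12 : ℕ)
notation "r_iter" => (13 : ℕ)
notation "r_vert" => (14 : ℕ)
notation "r_step" => (15 : ℕ)
notation "r_arc" => (16 : ℕ)
notation "r_found" => (17 : ℕ)
notation "r_min" => (18 : ℕ)
notation "r_best" => (19 : ℕ)
notation "r_new" => (20 : ℕ)
notation "r_dir" => (21 : ℕ)
notation "r_cur" => (22 : ℕ)
notation "r_edge" => (23 : ℕ)
notation "r_cost" => (24 : ℕ)
notation "r_found'" => (25 : ℕ)
notation "r_min'" => (26 : ℕ)
notation "r_new'" => (27 : ℕ)
notation "r_step'" => (28 : ℕ)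
notation "r_acc" => (29 : ℕ)
notation "r_tmp" => (30 : ℕ)
notation "r_tmp'" => (31 : ℕ)
notation "r_edge'" => (32 : ℕ)
notation "r_bit" => (33 : ℕ)

notation "a_tl" => (0 : ℕ)
notation "a_hd" => (1 : ℕ)
notation "a_flt" => (2 : ℕ)
notation "a_num" => (3 : ℕ)
notation "a_den" => (4 : ℕ)
notation "a_out" => (5 : ℕ)
notation "a_w" => (6 : ℕ)
notation "a_cap" => (7 : ℕ)
notation "a_flow" => (8 : ℕ)
notation "a_pot" => (9 : ℕ)
notation "a_rank" => (10 : ℕ)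
notation "a_pred" => (11 : ℕ)
notation "a_dir" => (12 : ℕ)
notation "a_set" => (13 : ℕ)
notation "a_rank'" => (14 : ℕ)
notation "a_pot'" => (15 : ℕ)
notation "a_sol" => (16 : ℕ)
notation "a_best" => (17 : ℕ)
notation "a_base" => (18 : ℕ)

namespace Prog

/-- Conditional execution without an alternative. -/
abbrev when (b : Expr) (p : Prog) : Prog := ite b p skip

/-- Conditional execution if the condition fails. -/
abbrev whenNot (b : Expr) (p : Prog) : Prog := ite b skip p

/-- Whether the program leaves the representation of the network unchanged. -/
def keepsNet (p : Prog) : Bool :=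
  !p.writesReg r_n && !p.writesReg r_m && !p.writesReg r_arcs && !p.writesReg r_value &&
    !p.writesArr a_tl && !p.writesArr a_hd && !p.writesArr a_flt && !p.writesArr a_w &&
    !p.writesArr a_cap

end Prog

/-- The state `σ` represents the network `G`. -/
structure Net.Rep (G : Net) (σ : State) : Prop where
  n : σ.reg r_n = G.n
  arcs : σ.reg r_arcs = G.N
  value : σ.reg r_value = G.K + 1
  tl : σ.arr a_tl = G.tl
  hd : σ.arr a_hd = G.hd
  cap : σ.arr a_cap = G.cap
  w : ∀ a < G.N, σ.arr a_w a = G.w (G.eid a)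
  flt : ∀ a < G.N, σ.arr a_flt a ≠ 0 ↔ G.eid a ∈ G.flt
  eid_lt : ∀ a < G.N, G.eid a < σ.reg r_m
  eid : ∀ a, G.eid a = if a < σ.reg r_m then a else a - σ.reg r_m
  arcs_eq : G.N = 2 * σ.reg r_m

theorem Net.Rep.congr {G : Net} {σ τ : State} (h : G.Rep σ) (h0 : τ.reg r_n = σ.reg r_n)
    (h1 : τ.reg r_m = σ.reg r_m) (h2 : τ.reg r_arcs = σ.reg r_arcs)
    (h3 : τ.reg r_value = σ.reg r_value) (h4 : τ.arr a_tl = σ.arr a_tl)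
    (h5 : τ.arr a_hd = σ.arr a_hd) (h6 : τ.arr a_flt = σ.arr a_flt) (h7 : τ.arr a_w = σ.arr a_w)
    (h8 : τ.arr a_cap = σ.arr a_cap) : G.Rep τ := by
  constructor <;> simp only [h0, h1, h2, h3, h4, h5, h6, h7, h8]
  exacts [h.n, h.arcs, h.value, h.tl, h.hd, h.cap, h.w, h.flt, h.eid_lt, h.eid, h.arcs_eq]

theorem Net.Rep.frame {G : Net} {σ τ : State} {i r : ℕ} {p : Prog} (h : G.Rep σ)
    (hp : (Prog.count i r p).keepsNet = true)
    (hr : ∀ x, (Prog.count i r p).writesReg x = false → τ.reg x = σ.reg x)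
    (ha : ∀ a, p.writesArr a = false → τ.arr a = σ.arr a) : G.Rep τ := by
  simp only [Prog.keepsNet, Bool.and_eq_true, Bool.not_eq_true'] at hp
  obtain ⟨⟨⟨⟨⟨⟨⟨⟨h0, h1⟩, h2⟩, h3⟩, h4⟩, h5⟩, h6⟩, h7⟩, h8⟩ := hp
  exact h.congr (hr _ h0) (hr _ h1) (hr _ h2) (hr _ h3) (ha _ h4) (ha _ h5) (ha _ h6) (ha _ h7)
    (ha _ h8)

theorem Net.Rep.sem {G : Net} {σ : State} {p : Prog} (h : G.Rep σ) (hp : p.keepsNet = true) :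
    G.Rep (p.sem σ) := by
  simp only [Prog.keepsNet, Bool.and_eq_true, Bool.not_eq_true'] at hp
  obtain ⟨⟨⟨⟨⟨⟨⟨⟨h0, h1⟩, h2⟩, h3⟩, h4⟩, h5⟩, h6⟩, h7⟩, h8⟩ := hp
  exact h.congr (Prog.sem_reg h0 _) (Prog.sem_reg h1 _) (Prog.sem_reg h2 _) (Prog.sem_reg h3 _)
    (Prog.sem_arr h4 _) (Prog.sem_arr h5 _) (Prog.sem_arr h6 _) (Prog.sem_arr h7 _)
    (Prog.sem_arr h8 _)

namespace Prog

/-- Fill the first `reg r` entries of array `a` with the constant `c`. -/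
abbrev fill (i r a c : ℕ) : Prog := count i r (store a (.reg i) (.lit c))

theorem fill_sem (i r a c : ℕ) (σ : State) (y : ℕ) :
    ((fill i r a c).sem σ).arr a y = if y < σ.reg r then c else σ.arr a y := by
  refine count_induction (fun j τ => ∀ y, τ.arr a y = if y < j then c else σ.arr a y) σ ?_ ?_ y
  · simp [State.setReg]
  · intro j τ _ hI hj _ _ y
    have := hI y
    simp only [sem, Expr.eval, State.setReg, State.setArr, Function.update_self, hj,
      Function.update_apply]
    split_ifs at this ⊢ <;> omega

/-! ### The minimum cost flow program -/

/-- Compare the residual arc `(reg r_arc, d)` with the best one found so far. -/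
def tryArc (d : ℕ) : Prog :=
  when (if d = 0 then .sub (.arr a_cap (.reg r_arc)) (.arr a_flow (.reg r_arc))
      else .arr a_flow (.reg r_arc))
    (when (.arr a_rank (.arr (if d = 0 then a_tl else a_hd) (.reg r_arc)))
      (whenNot (.arr a_rank (.arr (if d = 0 then a_hd else a_tl) (.reg r_arc)))
        (assign r_tmp (if d = 0 then
            .sub (.add (.arr a_w (.reg r_arc)) (.arr a_pot (.arr a_tl (.reg r_arc))))
              (.arr a_pot (.arr a_hd (.reg r_arc)))
          else
            .sub (.arr a_pot (.arr a_hd (.reg r_arc)))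
              (.add (.arr a_w (.reg r_arc)) (.arr a_pot (.arr a_tl (.reg r_arc))))) ;;
          -- With truncated subtraction, a sum expresses a disjunction: nothing has been found yet,
          -- or the new value is smaller.
          when (.add (.sub (.lit 1) (.reg r_found)) (.sub (.reg r_min) (.reg r_tmp)))
            (assign r_found (.lit 1) ;;
              assign r_min (.reg r_tmp) ;;
              assign r_best (.reg r_arc) ;;
              assign r_new (.arr (if d = 0 then a_hd else a_tl) (.reg r_arc)) ;;
              assign r_dir (.lit d)))))

/-- Search for a residual arc of least reduced cost that leaves the search tree. -/
def scan : Prog := assign r_found (.lit 0) ;; count r_arc r_arcs (tryArc 0 ;; tryArc 1)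

/-- Raise the potential `p` of the vertices `x` with `R x = 0` by `reg mn`. -/
def raise (R p mn : ℕ) : Prog :=
  count r_vert r_n (whenNot (.arr R (.reg r_vert))
    (store p (.reg r_vert) (.add (.arr p (.reg r_vert)) (.reg mn))))

/-- Extend the search tree by the residual arc that has been found, and raise the potentials
outside of the tree. -/
def extend : Prog :=
  when (.reg r_found)
    -- The potentials are raised before the new vertex gets its rank, so that it is raised too and
    -- the arc to it becomes tight.
    (raise a_rank a_pot r_min ;; store a_rank (.reg r_new) (.add (.reg r_step) (.lit 2)) ;;
      store a_pred (.reg r_new) (.reg r_best) ;;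
      store a_dir (.reg r_new) (.reg r_dir))

/-- Build the complete search tree. -/
def growTree : Prog :=
  fill r_vert r_n a_rank 0 ;; store a_rank (.reg r_u) (.lit 1) ;;
    count r_step r_n (scan ;; extend)

/-- Change the flow by one unit on the tree arc that leads to `reg r_cur`, and move to its
source. -/
def augmentStep : Prog :=
  when (.add (.sub (.reg r_cur) (.reg r_u)) (.sub (.reg r_u) (.reg r_cur)))
    (assign r_tmp (.arr a_pred (.reg r_cur)) ;;
      ite (.arr a_dir (.reg r_cur))
        (store a_flow (.reg r_tmp) (.sub (.arr a_flow (.reg r_tmp)) (.lit 1)) ;;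
          assign r_cur (.arr a_hd (.reg r_tmp)))
        (store a_flow (.reg r_tmp) (.add (.arr a_flow (.reg r_tmp)) (.lit 1)) ;;
          assign r_cur (.arr a_tl (.reg r_tmp))))

/-- Augment the flow by one unit along the tree path to `reg r_v`. -/
def augment : Prog := assign r_cur (.reg r_v) ;; count r_step r_n augmentStep

/-- Compute an optimal flow of value `reg r_value` from `reg r_u` to `reg r_v`, or set `reg r_ok`
to `0` if there is none. -/
def flow : Prog :=
  fill r_arc r_arcs a_flow 0 ;; fill r_vert r_n a_pot 0 ;; assign r_ok (.lit 1) ;;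
    count r_iter r_value (when (.reg r_ok)
      (growTree ;; ite (.arr a_rank (.reg r_v)) augment (assign r_ok (.lit 0))))

end Prog

open Prog

/-! ### Correctness of the minimum cost flow program -/

/-- `ScanInv` for the contents of the state. -/
abbrev Net.StateScan (G : Net) (c : ℕ) (σ : State) : Prop :=
  G.ScanInv (σ.arr a_flow) (σ.arr a_pot) (σ.arr a_rank) c (σ.reg r_found) (σ.reg r_min)
    (σ.reg r_best) (σ.reg r_new) (σ.reg r_dir)

theorem Net.ScanInv.skip {G : Net} {f p R : ℕ → ℕ} {c found mn arc new dir a d : ℕ}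
    (h : G.ScanInv f p R c found mn arc new dir) (hd : d < 2) (hc : c = 2 * a + d)
    (hl : ¬ (G.Leaves f R a d ∧ (found = 0 ∨ G.slack p a d < mn))) :
    G.ScanInv f p R (c + 1) found mn arc new dir := by
  have key : ∀ b d', d' < 2 → 2 * b + d' < c + 1 → 2 * b + d' < c ∨ (b = a ∧ d' = d) := by
    intro b d' h1 h2; omega
  refine ⟨fun h0 b d' h1 h2 h3 => ?_, h.leaves, h.new_eq, h.min_eq, fun h0 b d' h1 h2 h3 => ?_⟩
  · rcases key b d' h1 h2 with h4 | ⟨rfl, rfl⟩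
    · exact h.none h0 b d' h1 h4 h3
    · exact hl ⟨h3, .inl h0⟩
  · rcases key b d' h1 h2 with h4 | ⟨rfl, rfl⟩
    · exact h.min_le h0 b d' h1 h4 h3
    · by_contra h5
      exact hl ⟨h3, .inr (by omega)⟩

theorem Net.ScanInv.take {G : Net} {f p R : ℕ → ℕ} {c found mn arc new dir a d : ℕ}
    (h : G.ScanInv f p R c found mn arc new dir) (hd : d < 2) (hc : c = 2 * a + d)
    (hl : G.Leaves f R a d) (hm : found = 0 ∨ G.slack p a d < mn) :
    G.ScanInv f p R (c + 1) 1 (G.slack p a d) a (G.rdst a d) d := by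
  have key : ∀ b d', d' < 2 → 2 * b + d' < c + 1 → 2 * b + d' < c ∨ (b = a ∧ d' = d) := by
    intro b d' h1 h2; omega
  refine ⟨fun h0 => absurd h0 one_ne_zero, fun _ => hl, fun _ => rfl, fun _ => rfl,
    fun _ b d' h1 h2 h3 => ?_⟩
  rcases key b d' h1 h2 with h4 | ⟨rfl, rfl⟩
  · by_cases h0 : found = 0
    · exact absurd h3 (h.none h0 b d' h1 h4)
    · have := h.min_le h0 b d' h1 h4 h3; omega
  · exact le_rfl

theorem tryArc_sem {G : Net} {σ : State} (hσ : G.Rep σ) {d c : ℕ} (hd : d < 2)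
    (ha : σ.reg r_arc < G.N) (hc : c = 2 * σ.reg r_arc + d) (h : G.StateScan c σ) :
    G.StateScan (c + 1) ((tryArc d).sem σ) := by
  have hw := hσ.w _ ha
  have hlv : G.Leaves (σ.arr a_flow) (σ.arr a_rank) (σ.reg r_arc) d ↔
      (if d = 0 then σ.arr a_flow (σ.reg r_arc) < G.cap (σ.reg r_arc)
        else 0 < σ.arr a_flow (σ.reg r_arc)) ∧
      σ.arr a_rank (G.rsrc (σ.reg r_arc) d) ≠ 0 ∧ σ.arr a_rank (G.rdst (σ.reg r_arc) d) = 0 := by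
    simp [Net.Leaves, Net.Residual, ha, hd]
  have skp := h.skip hd hc
  have tk := h.take hd hc
  rw [hlv] at skp tk
  unfold Net.StateScan
  obtain rfl | rfl : d = 0 ∨ d = 1 := by omega
  · simp only [Net.rsrc, Net.rdst, Net.slack, if_true] at skp tk
    simp only [tryArc, sem, Expr.eval, hσ.tl, hσ.hd, hσ.cap, if_true]
    split_ifs with h1 h2 h3 h4
    · exact skp fun h' => h3 h'.1.2.2
    · simp only [State.setReg, Function.update_apply, Nat.reduceEqDiff, if_false, if_true,
        hσ.hd, hw] at h4 ⊢
      simpa using tk ⟨by omega, h2, by simpa using h3⟩ (by omega)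
    · simp only [State.setReg, Function.update_apply, Nat.reduceEqDiff, if_false, if_true,
        hw] at h4 ⊢
      exact skp (by omega)
    · exact skp (by omega)
    · exact skp (by omega)
  · simp only [Net.rsrc, Net.rdst, Net.slack, one_ne_zero, if_false] at skp tk
    simp only [tryArc, sem, Expr.eval, hσ.tl, hσ.hd, one_ne_zero, if_false]
    split_ifs with h1 h2 h3 h4
    · exact skp fun h' => h3 h'.1.2.2
    · simp only [State.setReg, Function.update_apply, Nat.reduceEqDiff, if_false, if_true,
        hσ.tl, hw] at h4 ⊢
      simpa using tk ⟨by omega, h2, by simpa using h3⟩ (by omega)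
    · simp only [State.setReg, Function.update_apply, Nat.reduceEqDiff, if_false, if_true,
        hw] at h4 ⊢
      exact skp (by omega)
    · exact skp (by omega)
    · exact skp (by omega)

theorem scan_sem {G : Net} {σ : State} (hσ : G.Rep σ) : G.StateScan (2 * G.N) (scan.sem σ) := by
  rw [scan, sem, ← hσ.arcs]
  set σ₁ := (assign r_found (.lit 0)).sem σ with hσ₁
  have hσ₁' : G.Rep σ₁ := hσ.sem rfl
  have e : σ.reg r_arcs = σ₁.reg r_arcs := by rw [hσ₁'.arcs, hσ.arcs]
  rw [e]
  refine count_induction (fun j τ => G.StateScan (2 * j) τ) σ₁ ?_ ?_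
  · refine ⟨fun _ a d _ h => by omega, fun h => ?_, fun h => ?_, fun h => ?_, fun h => ?_⟩ <;>
      simp [σ₁, sem, State.setReg, Expr.eval] at h
  · intro j τ hj hI hja hr ha
    have hτ : G.Rep τ := hσ₁'.frame rfl hr ha
    rw [hσ₁'.arcs] at hj
    have s1 := tryArc_sem hτ (d := 0) (by omega) (hja.trans_lt hj) (by rw [hja]; rfl) hI
    have e1 : ((tryArc 0).sem τ).reg r_arc = j := by rw [sem_reg rfl, hja]
    have s2 := tryArc_sem (hτ.sem (p := tryArc 0) rfl) (d := 1) (by omega) (e1.trans_lt hj)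
      (by rw [e1]) s1
    exact s2

/-- The search tree and the flow in the state. -/
abbrev Net.StateTree (G : Net) (u v c g : ℕ) (σ : State) : Prop :=
  G.OptFlow u v c (σ.arr a_flow) (σ.arr a_pot) ∧
    G.Tree u (σ.arr a_flow) (σ.arr a_pot) (σ.arr a_rank) (σ.arr a_pred) (σ.arr a_dir) g

/-- Used twice: for the flow potentials, and for the potentials of the outer search. -/
theorem raise_sem {R p mn : ℕ} (hR : R ≠ p) (hm : mn ≠ r_vert) (σ : State) (y : ℕ) :
    ((raise R p mn).sem σ).arr p y =
      if y < σ.reg r_n ∧ σ.arr R y = 0 then σ.arr p y + σ.reg mn else σ.arr p y := by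
  refine count_induction (fun j τ => ∀ y, τ.arr p y =
    if y < j ∧ σ.arr R y = 0 then σ.arr p y + σ.reg mn else σ.arr p y) σ ?_ ?_ y
  · simp [State.setReg]
  · intro j τ _ hI hj hr ha y
    have hy := hI y
    have hjj := hI j
    rw [if_neg (by omega)] at hjj
    have e1 : τ.arr R = σ.arr R := ha R (by simp [writesArr, hR])
    have e2 : τ.reg mn = σ.reg mn := hr mn (by simp [writesReg, hm])
    by_cases hyj : y = j
    · subst hyj
      by_cases h0 : σ.arr R y = 0 <;>
        simp [sem, Expr.eval, hj, e1, e2, h0, State.setReg, State.setArr, hjj]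
    · have h1 : y < j + 1 ↔ y < j := by omega
      simp only [h1, ← hy]
      by_cases h0 : σ.arr R j = 0 <;>
        simp [sem, Expr.eval, hj, e1, h0, State.setReg, State.setArr, hyj]

theorem extend_sem {G : Net} (hG : G.Valid) {σ : State} (hσ : G.Rep σ) {u v c g : ℕ}
    (hg : σ.reg r_step = g) (hs : G.StateScan (2 * G.N) σ)
    (h : G.StateTree u v c g σ) : G.StateTree u v c (g + 1) (extend.sem σ) := by
  unfold extend
  by_cases h0 : σ.reg r_found = 0
  · rw [sem_ite_of_eq (b := .reg r_found) h0]
    refine ⟨h.1, h.2.of_closed fun a d hl => ?_⟩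
    have := hl.1.1
    have := hl.1.2.1
    exact hs.none h0 a d hl.1.2.1 (by omega) hl
  · rw [sem_ite_of_ne (b := .reg r_found) h0, sem_seq]
    set τ := (raise a_rank a_pot r_min).sem σ with hτ
    have e1 : ∀ a, a ≠ a_pot → τ.arr a = σ.arr a := fun a ha =>
      sem_arr (by simp [raise, writesArr, ha]) σ
    have e2 : ∀ x, x ≠ r_vert → τ.reg x = σ.reg x := fun a ha =>
      sem_reg (by simp [raise, writesReg, ha]) σ
    have hn := hs.new_eq h0
    have hm := hs.min_eq h0
    have := h.2.grow hG h.1 (hs.leaves h0) (fun b d' hb => hm ▸ hs.min_le h0 b d' hb.1.2.1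
      (by have := hb.1.1; have := hb.1.2.1; omega) hb)
      (p' := τ.arr a_pot) (fun x hx => by
        rw [hτ, raise_sem (by omega) (by omega)]; simp [hσ.n, hx, hm]) rfl rfl rfl
    rw [← hn] at this
    simpa [Net.StateTree, sem, Expr.eval, State.setArr, e1, e2, hg] using this

theorem growTree_sem {G : Net} (hG : G.Valid) {σ : State} (hσ : G.Rep σ) {u v c : ℕ}
    (hu : u < G.n) (hu' : σ.reg r_u = u)
    (h : G.OptFlow u v c (σ.arr a_flow) (σ.arr a_pot)) :
    G.StateTree u v c G.n (growTree.sem σ) := by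
  rw [growTree, sem, sem]
  set σ₁ := (fill r_vert r_n a_rank 0).sem σ with hσ₁
  set σ₂ := (store a_rank (.reg r_u) (.lit 1)).sem σ₁ with hσ₂
  have hR : G.Rep σ₂ := (hσ.sem (p := fill r_vert r_n a_rank 0) rfl).sem rfl
  have hu₁ : σ₁.reg r_u = u := by rw [← hu']; exact sem_reg rfl σ
  have hflow : σ₂.arr a_flow = σ.arr a_flow :=
    (sem_arr rfl σ₁).trans (sem_arr rfl σ)
  have hpot : σ₂.arr a_pot = σ.arr a_pot :=
    (sem_arr rfl σ₁).trans (sem_arr rfl σ)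
  rw [← hR.n]
  refine count_induction (fun j τ => G.StateTree u v c j τ) σ₂ ⟨?_, ?_⟩ ?_
  · change G.OptFlow u v c (σ₂.arr a_flow) (σ₂.arr a_pot)
    rwa [hflow, hpot]
  · refine Net.Tree.init hu fun x hx => ?_
    change σ₂.arr a_rank x = _
    simp only [hσ₂, sem, Expr.eval, State.setArr, Function.update_self, Function.update_apply, hu₁]
    split_ifs with hxu
    · rfl
    · rw [hσ₁, fill_sem, hσ.n, if_pos hx]
  · intro j τ hj hI hj' hr ha
    have hτ : G.Rep τ := hR.frame rfl hr ha
    have s1 := scan_sem hτ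
    have t1 : G.StateTree u v c j (scan.sem τ) := by
      unfold Net.StateTree
      rw [sem_arr (a := a_flow) rfl, sem_arr (a := a_pot) rfl, sem_arr (a := a_rank) rfl,
        sem_arr (a := a_pred) rfl, sem_arr (a := a_dir) rfl]
      exact hI
    exact extend_sem hG (hτ.sem (p := scan) rfl) ((sem_reg rfl τ).trans hj') s1 t1

theorem augment_sem {G : Net} (hG : G.Valid) {σ : State} (hσ : G.Rep σ) {u v c : ℕ}
    (hv : v < G.n) (hu' : σ.reg r_u = u) (hv' : σ.reg r_v = v)
    (h : G.StateTree u v c G.n σ) (hR : σ.arr a_rank v ≠ 0) :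
    G.OptFlow u v (c + 1) ((augment.sem σ).arr a_flow) ((augment.sem σ).arr a_pot) := by
  have hp : (augment.sem σ).arr a_pot = σ.arr a_pot := sem_arr rfl σ
  rw [hp, augment, sem]
  set σ₁ := (assign r_cur (.reg r_v)).sem σ with hσ₁
  have hR₁ : G.Rep σ₁ := hσ.sem rfl
  refine Net.Augmenting.finish (f₀ := σ.arr a_flow) (R := σ.arr a_rank) (pred := σ.arr a_pred)
    (dir := σ.arr a_dir) ?_ h.2 (cur := ((count r_step r_n augmentStep).sem σ₁).reg r_cur)
  rw [← hR₁.n]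
  refine count_induction (fun j τ => G.Augmenting u v c (σ.arr a_flow) (σ.arr a_pot)
    (σ.arr a_rank) (τ.arr a_flow) (τ.reg r_cur) j) σ₁ ?_ ?_
  · have := Net.Augmenting.init hv h.1 h.2 hR
    simpa [σ₁, sem, Expr.eval, State.setReg, hv'] using this
  · intro j τ hj hI hj' hr ha
    have hτ : G.Rep τ := hR₁.frame rfl hr ha
    have e1 : τ.arr a_pred = σ.arr a_pred := ha a_pred rfl
    have e2 : τ.arr a_dir = σ.arr a_dir := ha a_dir rfl
    have e3 : τ.reg r_u = u := (hr r_u rfl).trans hu'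
    by_cases hcu : τ.reg r_cur = u
    · have : G.Augmenting u v c (σ.arr a_flow) (σ.arr a_pot) (σ.arr a_rank) (τ.arr a_flow)
          (τ.reg r_cur) (j + 1) := by
        rw [hcu] at hI ⊢; exact hI.stay
      rw [augmentStep, sem_ite_of_eq (by simp [Expr.eval, e3, hcu])]
      simpa [sem, State.setReg] using this
    · have hne : τ.reg r_cur - u + (u - τ.reg r_cur) ≠ 0 := by omega
      have := hI.step hG h.2 hcu
      rw [augmentStep, sem_ite_of_ne (by simpa [Expr.eval, e3] using hne)]
      by_cases hd : σ.arr a_dir (τ.reg r_cur) = 0 <;>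
        simpa [sem, Expr.eval, e1, e2, hd, State.setReg, State.setArr, Net.rsrc, hτ.tl, hτ.hd]
          using this

/-- The invariant says that `j` units have been sent optimally, or that `r_ok` has been cleared. In
the latter case a complete search tree missing `v` gave a cut that rules out every block, and all
later iterations idle. -/
theorem flow_sem {G : Net} (hG : G.Valid) {σ : State} (hσ : G.Rep σ) {u v : ℕ}
    (hu : u < G.n) (hv : v < G.n) (hu' : σ.reg r_u = u) (hv' : σ.reg r_v = v) :
    ((flow.sem σ).reg r_ok ≠ 0 →
      ∃ p, G.OptFlow u v (G.K + 1) ((flow.sem σ).arr a_flow) p) ∧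
    ((flow.sem σ).reg r_ok = 0 → ∀ X, ¬ G.CutProp u v X) := by
  suffices H : ((flow.sem σ).reg r_ok ≠ 0 → G.OptFlow u v (G.K + 1) ((flow.sem σ).arr a_flow)
      ((flow.sem σ).arr a_pot)) ∧ ((flow.sem σ).reg r_ok = 0 → ∀ X, ¬ G.CutProp u v X) from
    ⟨fun h => ⟨_, H.1 h⟩, H.2⟩
  rw [flow, sem, sem, sem]
  set σ₁ := (fill r_arc r_arcs a_flow 0).sem σ with hσ₁
  set σ₂ := (fill r_vert r_n a_pot 0).sem σ₁ with hσ₂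
  set σ₃ := (assign r_ok (.lit 1)).sem σ₂ with hσ₃
  have hR₁ : G.Rep σ₁ := hσ.sem rfl
  have hR₃ : G.Rep σ₃ := (hR₁.sem (p := fill r_vert r_n a_pot 0) rfl).sem rfl
  have eu : σ₃.reg r_u = u := by
    rw [← hu']; exact (sem_reg rfl σ₂).trans ((sem_reg rfl σ₁).trans (sem_reg rfl σ))
  have ev : σ₃.reg r_v = v := by
    rw [← hv']; exact (sem_reg rfl σ₂).trans ((sem_reg rfl σ₁).trans (sem_reg rfl σ))
  rw [← hR₃.value]
  refine count_induction (fun j τ => (τ.reg r_ok ≠ 0 → G.OptFlow u v j (τ.arr a_flow)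
    (τ.arr a_pot)) ∧ (τ.reg r_ok = 0 → ∀ X, ¬ G.CutProp u v X)) σ₃ ⟨fun _ => ?_, ?_⟩ ?_
  · refine Net.OptFlow.zero G u v (fun a ha => ?_) (fun x hx => ?_) hG
    · change σ₃.arr a_flow a = 0
      have : σ₃.arr a_flow = σ₁.arr a_flow := (sem_arr rfl σ₂).trans (sem_arr rfl σ₁)
      rw [this, hσ₁, fill_sem, hσ.arcs, if_pos ha]
    · change σ₃.arr a_pot x = 0
      have : σ₃.arr a_pot = σ₂.arr a_pot := sem_arr rfl σ₂
      rw [this, hσ₂, fill_sem, hR₁.n, if_pos hx]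
  · simp [σ₃, sem, Expr.eval, State.setReg]
  · intro j τ hj hI hj' hr ha
    have hτ : G.Rep τ := hR₃.frame rfl hr ha
    rw [hR₃.value] at hj
    have tu := (hr r_u rfl).trans eu
    have tv := (hr r_v rfl).trans ev
    by_cases hok : τ.reg r_ok = 0
    · simp only [sem, Expr.eval, hok, ne_eq, not_true_eq_false, if_false]
      exact ⟨fun h => absurd hok h, fun _ => hI.2 hok⟩
    · have ht := growTree_sem hG hτ hu tu (hI.1 hok)
      have hτ' : G.Rep (growTree.sem τ) := hτ.sem rfl
      have tu' := (sem_reg (p := growTree) (x := r_u) rfl τ).trans tu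
      have tv' := (sem_reg (p := growTree) (x := r_v) rfl τ).trans tv
      have tok : (growTree.sem τ).reg r_ok = τ.reg r_ok := sem_reg rfl τ
      simp only [sem, Expr.eval, hok, ne_eq, not_false_eq_true, if_true, tv']
      by_cases hRv : (growTree.sem τ).arr a_rank v = 0
      · simp only [hRv, not_true_eq_false, if_false]
        refine ⟨fun h => absurd ?_ h, fun _ => ht.2.not_cutProp hG ht.1 hu hv (by omega) hRv⟩
        simp [State.setReg]
      · simp only [hRv, not_false_eq_true, if_true]
        have hA := augment_sem hG hτ' hv tu' tv' ht hRv
        refine ⟨fun _ => hA, fun h => absurd ?_ hok⟩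
        rw [← tok, ← h]
        exact (sem_reg (p := augment) (x := r_ok) rfl _).symm

end FTP

namespace FTP
namespace Prog

/-! ### The main program -/

/-- Store the support of the flow. -/
def storeSupport : Prog :=
  count r_edge r_m (store a_set (.reg r_edge)
    (.add (.arr a_flow (.reg r_edge)) (.arr a_flow (.add (.reg r_edge) (.reg r_m)))))

/-- Store the edge of the arc `reg r_arc` as a set. -/
def storeEdge : Prog :=
  fill r_edge r_m a_set 0 ;;
    ite (.sub (.reg r_m) (.reg r_arc)) (store a_set (.reg r_arc) (.lit 1))
      (store a_set (.sub (.reg r_arc) (.reg r_m)) (.lit 1))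

/-- Compute the weight of the stored edge set. -/
def sumWeights : Prog :=
  assign r_cost (.lit 0) ;;
    count r_edge r_m (when (.arr a_set (.reg r_edge))
      (assign r_cost (.add (.reg r_cost) (.arr a_w (.reg r_edge)))))

/-- Join the solution for `reg r_u` with the stored edge set. -/
def joinSets : Prog :=
  count r_edge r_m (store a_best (.reg r_edge)
    (.add (.arr a_sol (.add (.arr a_base (.reg r_u)) (.reg r_edge))) (.arr a_set (.reg r_edge))))

/-- Compare the stored edge set, as a solution from `reg r_u` to `reg r_v`, with the best
extension found so far. -/
def compareSol : Prog :=
  sumWeights ;;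
    assign r_tmp' (.sub (.add (.arr a_pot' (.reg r_u)) (.reg r_cost)) (.arr a_pot' (.reg r_v))) ;;
    when (.add (.sub (.lit 1) (.reg r_found')) (.sub (.reg r_min') (.reg r_tmp')))
      (assign r_found' (.lit 1) ;; assign r_min' (.reg r_tmp') ;; assign r_new' (.reg r_v) ;;
        joinSets)

/-- Try the flow from `reg r_u` to `reg r_v` as an extension. -/
def tryPair : Prog :=
  when (.arr a_rank' (.reg r_u)) (whenNot (.arr a_rank' (.reg r_v))
    (flow ;; when (.reg r_ok) (storeSupport ;; compareSol)))

/-- Try the safe edge of the arc `reg r_arc` as an extension. -/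
def trySafe : Prog :=
  whenNot (.arr a_flt (.reg r_arc)) (when (.arr a_cap (.reg r_arc))
    (when (.arr a_rank' (.arr a_tl (.reg r_arc)))
      (whenNot (.arr a_rank' (.arr a_hd (.reg r_arc)))
        (assign r_u (.arr a_tl (.reg r_arc)) ;; assign r_v (.arr a_hd (.reg r_arc)) ;;
          storeEdge ;; compareSol))))

/-- Search for the cheapest extension from a solved vertex to an unsolved one. -/
def search : Prog :=
  assign r_found' (.lit 0) ;; count r_u r_n (count r_v r_n tryPair) ;;
    count r_arc r_arcs trySafe

/-- Store the solution for `reg r_new'`. -/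
def storeSol : Prog :=
  count r_edge r_m (store a_sol (.add (.arr a_base (.reg r_new')) (.reg r_edge))
    (.arr a_best (.reg r_edge)))

/-- Carry out the extension that has been found. -/
def extendSol : Prog :=
  when (.reg r_found')
    (raise a_rank' a_pot' r_min' ;; store a_rank' (.reg r_new') (.lit 1) ;; storeSol)

/-- Solve the problem for all vertices that can be reached, and output the solution for
`reg r_t`. -/
def solve : Prog :=
  store a_rank' (.reg r_s) (.lit 1) ;; count r_step' r_n (search ;; extendSol) ;;
    count r_edge r_m (store a_out (.reg r_edge)
      (.arr a_sol (.add (.arr a_base (.reg r_t)) (.reg r_edge))))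

/-- Whether the program leaves the partial solutions unchanged. -/
def keepsSol (p : Prog) : Bool :=
  p.keepsNet && !p.writesArr a_rank' && !p.writesArr a_pot' && !p.writesArr a_sol &&
    !p.writesArr a_base

end Prog

open Prog

/-! ### Correctness of the search for a cheapest extension -/

/-- The set of the indices `e < m` with `A e ≠ 0`. -/
def edgeSet (m : ℕ) (A : ℕ → ℕ) : Finset ℕ := (Finset.range m).filter fun e => A e ≠ 0

theorem edgeSet_congr {m : ℕ} {A B : ℕ → ℕ} (h : ∀ e < m, A e = B e) :
    edgeSet m A = edgeSet m B :=
  Finset.filter_congr fun e he => by rw [h e (Finset.mem_range.1 he)]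

/-- The partial solutions in the state: the vertices of nonzero rank have been solved, and the
potential is feasible for the basic solutions. -/
structure Net.PartialSol (G : Net) (s : ℕ) (σ : State) : Prop where
  rep : G.Rep σ
  base : ∀ x < G.n, σ.arr a_base x = x * σ.reg r_m
  root : σ.arr a_rank' s ≠ 0
  feasible : ∀ x < G.n, σ.arr a_rank' x ≠ 0 →
    G.Feasible s x (edgeSet (σ.reg r_m) fun e => σ.arr a_sol (x * σ.reg r_m + e))
  weight_le : ∀ x < G.n, σ.arr a_rank' x ≠ 0 →
    G.weight (edgeSet (σ.reg r_m) fun e => σ.arr a_sol (x * σ.reg r_m + e)) ≤ σ.arr a_pot' x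
  pot_le : ∀ x y c, G.Aux x y c → σ.arr a_pot' y ≤ σ.arr a_pot' x + c
  pot_root : σ.arr a_pot' s = 0

theorem Net.PartialSol.congr {G : Net} {s : ℕ} {σ τ : State} (h : G.PartialSol s σ)
    (hτ : G.Rep τ) (h0 : τ.reg r_m = σ.reg r_m) (h1 : τ.arr a_rank' = σ.arr a_rank')
    (h2 : τ.arr a_pot' = σ.arr a_pot') (h3 : τ.arr a_sol = σ.arr a_sol)
    (h4 : τ.arr a_base = σ.arr a_base) : G.PartialSol s τ := by
  refine ⟨hτ, ?_, ?_, ?_, ?_, ?_, ?_⟩ <;> simp only [h0, h1, h2, h3, h4]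
  exacts [h.base, h.root, h.feasible, h.weight_le, h.pot_le, h.pot_root]

theorem Net.PartialSol.frame {G : Net} {s : ℕ} {σ τ : State} {i r : ℕ} {p : Prog}
    (h : G.PartialSol s σ) (hp : (Prog.count i r p).keepsSol = true)
    (hr : ∀ x, (Prog.count i r p).writesReg x = false → τ.reg x = σ.reg x)
    (ha : ∀ a, p.writesArr a = false → τ.arr a = σ.arr a) : G.PartialSol s τ := by
  simp only [Prog.keepsSol, Bool.and_eq_true, Bool.not_eq_true'] at hp
  obtain ⟨⟨⟨⟨h0, h1⟩, h2⟩, h3⟩, h4⟩ := hp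
  refine h.congr (h.rep.frame h0 hr ha) (hr _ ?_) (ha _ h1) (ha _ h2) (ha _ h3) (ha _ h4)
  simp only [Prog.keepsNet, Bool.and_eq_true, Bool.not_eq_true'] at h0
  exact h0.1.1.1.1.1.1.1.2

theorem Net.PartialSol.sem {G : Net} {s : ℕ} {σ : State} {p : Prog}
    (h : G.PartialSol s σ) (hp : p.keepsSol = true) : G.PartialSol s (p.sem σ) := by
  simp only [Prog.keepsSol, Bool.and_eq_true, Bool.not_eq_true'] at hp
  obtain ⟨⟨⟨⟨h0, h1⟩, h2⟩, h3⟩, h4⟩ := hp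
  refine h.congr (h.rep.sem h0) (sem_reg ?_ _) (sem_arr h1 _) (sem_arr h2 _) (sem_arr h3 _)
    (sem_arr h4 _)
  simp only [Prog.keepsNet, Bool.and_eq_true, Bool.not_eq_true'] at h0
  exact h0.1.1.1.1.1.1.1.2

/-- The result of a search for a cheapest extension of the partial solutions after the basic
solutions in `P` have been taken into account. -/
structure Net.SearchInv (G : Net) (s : ℕ) (R p : ℕ → ℕ) (P : ℕ → ℕ → ℕ → Prop)
    (found mn new : ℕ) (B : Finset ℕ) : Prop where
  none : found = 0 → ∀ x y c, P x y c → R x ≠ 0 → R y ≠ 0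
  new_lt : found ≠ 0 → new < G.n
  new_rank : found ≠ 0 → R new = 0
  feasible : found ≠ 0 → G.Feasible s new B
  weight_le : found ≠ 0 → G.weight B ≤ p new + mn
  min_le : found ≠ 0 → ∀ x y c, P x y c → R x ≠ 0 → R y = 0 → p y + mn ≤ p x + c

/-- `SearchInv` for the contents of the state. -/
abbrev Net.StateSearch (G : Net) (s : ℕ) (P : ℕ → ℕ → ℕ → Prop) (σ : State) : Prop :=
  G.SearchInv s (σ.arr a_rank') (σ.arr a_pot') P (σ.reg r_found') (σ.reg r_min') (σ.reg r_new')
    (edgeSet (σ.reg r_m) (σ.arr a_best))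

theorem Net.SearchInv.of_imp {G : Net} {s : ℕ} {R p : ℕ → ℕ} {P P' : ℕ → ℕ → ℕ → Prop}
    {found mn new : ℕ} {B : Finset ℕ} (h : G.SearchInv s R p P found mn new B)
    (hP : ∀ x y c, P' x y c → R x ≠ 0 → R y = 0 → P x y c) :
    G.SearchInv s R p P' found mn new B :=
  { h with
    none := fun h0 x y c h1 h2 h3 => h.none h0 x y c (hP x y c h1 h2 h3) h2 h3
    min_le := fun h0 x y c h1 h2 h3 => h.min_le h0 x y c (hP x y c h1 h2 h3) h2 h3 }

theorem Net.StateSearch.sem {G : Net} {s : ℕ} {P : ℕ → ℕ → ℕ → Prop} {σ : State}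
    (h : G.StateSearch s P σ) (p : Prog) (h1 : p.writesArr a_rank' = false)
    (h2 : p.writesArr a_pot' = false) (h3 : p.writesReg r_found' = false)
    (h4 : p.writesReg r_min' = false) (h5 : p.writesReg r_new' = false)
    (h6 : p.writesReg r_m = false) (h7 : p.writesArr a_best = false) :
    G.StateSearch s P (p.sem σ) := by
  unfold Net.StateSearch
  rwa [sem_arr h1, sem_arr h2, sem_reg h3, sem_reg h4, sem_reg h5, sem_reg h6, sem_arr h7]

/-- An edge is used exactly when one of its two arcs, `e` or `e + m`, carries flow. A sum of natural
numbers serves as the disjunction. -/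
theorem storeSupport_sem {G : Net} {σ : State} (hσ : G.Rep σ) :
    edgeSet (σ.reg r_m) ((storeSupport.sem σ).arr a_set) = G.support (σ.arr a_flow) := by
  have h : ∀ e, e < σ.reg r_m → (storeSupport.sem σ).arr a_set e =
      σ.arr a_flow e + σ.arr a_flow (e + σ.reg r_m) := by
    refine count_induction (fun j τ => ∀ e, e < j → τ.arr a_set e =
      σ.arr a_flow e + σ.arr a_flow (e + σ.reg r_m)) σ (fun e he => absurd he (by omega)) ?_
    intro j τ _ hI hj hr ha e he
    simp only [sem, Expr.eval, hj, hr r_m rfl, ha a_flow rfl, State.setReg, State.setArr,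
      Function.update_self, Function.update_apply]
    split_ifs with hej
    · rw [hej]
    · exact hI e (by omega)
  ext e
  simp only [edgeSet, Net.support, Finset.mem_filter, Finset.mem_range, Finset.mem_image]
  constructor
  · rintro ⟨he, hne⟩
    rw [h e he] at hne
    by_cases h0 : σ.arr a_flow e = 0
    · refine ⟨e + σ.reg r_m, ⟨?_, by omega⟩, ?_⟩
      · rw [hσ.arcs_eq]; omega
      · rw [hσ.eid, if_neg (by omega)]; omega
    · refine ⟨e, ⟨?_, h0⟩, ?_⟩
      · rw [hσ.arcs_eq]; omega
      · rw [hσ.eid, if_pos he]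
  · rintro ⟨a, ⟨ha, hne⟩, rfl⟩
    have hlt := hσ.eid_lt a ha
    refine ⟨hlt, ?_⟩
    rw [h _ hlt, hσ.eid]
    split_ifs with h1
    · omega
    · have : a - σ.reg r_m + σ.reg r_m = a := by omega
      rw [this]; omega

theorem storeEdge_sem {G : Net} {σ : State} (hσ : G.Rep σ) (ha : σ.reg r_arc < G.N) :
    edgeSet (σ.reg r_m) ((storeEdge.sem σ).arr a_set) = {G.eid (σ.reg r_arc)} := by
  rw [storeEdge, sem_seq]
  set τ := (fill r_edge r_m a_set 0).sem σ with hτ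
  have h0 : ∀ e < σ.reg r_m, τ.arr a_set e = 0 := fun e he => by
    rw [hτ, fill_sem, if_pos he]
  have h1 : τ.reg r_m = σ.reg r_m := sem_reg rfl σ
  have h2 : τ.reg r_arc = σ.reg r_arc := sem_reg rfl σ
  have hlt := hσ.eid_lt _ ha
  have key : ∀ e < σ.reg r_m, ((ite (.sub (.reg r_m) (.reg r_arc))
      (store a_set (.reg r_arc) (.lit 1)) (store a_set (.sub (.reg r_arc) (.reg r_m)) (.lit 1))).sem
        τ).arr a_set e = if e = G.eid (σ.reg r_arc) then 1 else 0 := by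
    intro e he
    simp only [sem, Expr.eval, h1, h2, hσ.eid]
    by_cases h3 : σ.reg r_arc < σ.reg r_m
    · rw [if_pos (by omega), if_pos h3]
      simp only [State.setArr, Function.update_self, Function.update_apply, h0 e he]
    · rw [if_neg (by omega), if_neg h3]
      simp only [State.setArr, Function.update_self, Function.update_apply, h0 e he]
  rw [edgeSet_congr key]
  ext e
  simp only [edgeSet, Finset.mem_filter, Finset.mem_range, Finset.mem_singleton]
  constructor
  · rintro ⟨-, h⟩
    by_contra h'
    simp [h'] at h
  · rintro rfl
    exact ⟨hlt, by simp⟩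

theorem sumWeights_sem {G : Net} {σ : State} (hσ : G.Rep σ) :
    (sumWeights.sem σ).reg r_cost = G.weight (edgeSet (σ.reg r_m) (σ.arr a_set)) := by
  rw [sumWeights, sem_seq]
  set σ₁ := (assign r_cost (.lit 0)).sem σ with hσ₁
  have e1 : σ.reg r_m = σ₁.reg r_m := (sem_reg rfl σ).symm
  have e2 : σ.arr a_set = σ₁.arr a_set := rfl
  have e3 : G.Rep σ₁ := hσ.sem rfl
  rw [e1, e2]
  refine count_induction (fun j τ => τ.reg r_cost = G.weight (edgeSet j (σ₁.arr a_set))) σ₁ ?_ ?_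
  · simp [σ₁, sem, Expr.eval, State.setReg, edgeSet, Net.weight]
  · intro j τ hj hI hj' hr ha
    have h1 : τ.arr a_set = σ₁.arr a_set := ha a_set rfl
    have h2 : τ.arr a_w = σ₁.arr a_w := ha a_w rfl
    have h3 : σ₁.arr a_w j = G.w j := by
      have := e3.w j (by rw [e3.arcs_eq]; omega)
      rwa [e3.eid, if_pos hj] at this
    have h4 : edgeSet (j + 1) (σ₁.arr a_set) = if σ₁.arr a_set j ≠ 0 then
        insert j (edgeSet j (σ₁.arr a_set)) else edgeSet j (σ₁.arr a_set) := by
      rw [edgeSet, Finset.range_add_one, Finset.filter_insert]; rfl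
    by_cases h0 : σ₁.arr a_set j = 0
    · rw [sem_ite_of_eq (by simpa [Expr.eval, hj', h1] using h0)]
      rw [h4, if_neg (by simpa using h0), ← hI]
      simp [sem, State.setReg]
    · rw [sem_ite_of_ne (by simpa [Expr.eval, hj', h1] using h0)]
      rw [h4, if_pos h0, Net.weight, Finset.sum_insert (by simp [edgeSet])]
      simp [sem, State.setReg, Expr.eval, hI, hj', h2, h3, Net.weight, add_comm]

theorem joinSets_sem {σ : State} (e : ℕ) (he : e < σ.reg r_m) :
    (joinSets.sem σ).arr a_best e =
      σ.arr a_sol (σ.arr a_base (σ.reg r_u) + e) + σ.arr a_set e := by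
  refine count_induction (fun j τ => ∀ e, e < j → τ.arr a_best e =
      σ.arr a_sol (σ.arr a_base (σ.reg r_u) + e) + σ.arr a_set e) σ
      (fun e he => absurd he (by omega)) ?_ e he
  intro j τ _ hI hj hr ha e he
  simp only [sem, Expr.eval, hj, hr r_u rfl, ha a_sol rfl, ha a_base rfl, ha a_set rfl,
    State.setReg, State.setArr, Function.update_self, Function.update_apply]
  split_ifs with hej
  · rw [hej]
  · exact hI e (by omega)

theorem edgeSet_add (m : ℕ) (A B : ℕ → ℕ) :
    edgeSet m (fun e => A e + B e) = edgeSet m A ∪ edgeSet m B := by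
  ext e
  simp only [edgeSet, Finset.mem_filter, Finset.mem_range, Finset.mem_union]
  constructor
  · rintro ⟨h1, h2⟩
    by_cases h3 : A e = 0
    · exact .inr ⟨h1, by omega⟩
    · exact .inl ⟨h1, h3⟩
  · rintro (⟨h1, h2⟩ | ⟨h1, h2⟩) <;> exact ⟨h1, by omega⟩

/-- The candidate value is the potential at `u` plus the weight of the stored set minus the
potential at `v`. It is at most the slack of every basic solution from `u` to `v`, since each costs
at least that weight. The set joined with the solution for `u` is feasible for `v` and weighs at
most the potential of `v` plus this value. -/
theorem compareSol_sem {G : Net} {s : ℕ} {P P' : ℕ → ℕ → ℕ → Prop} {σ : State}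
    (hσ : G.PartialSol s σ) (h : G.StateSearch s P σ) (hu : σ.reg r_u < G.n)
    (hv : σ.reg r_v < G.n) (hRu : σ.arr a_rank' (σ.reg r_u) ≠ 0)
    (hRv : σ.arr a_rank' (σ.reg r_v) = 0)
    (hX : G.Feasible (σ.reg r_u) (σ.reg r_v) (edgeSet (σ.reg r_m) (σ.arr a_set)))
    (hP' : ∀ x y c, P' x y c → G.Aux x y c)
    (hP : ∀ x y c, P' x y c → P x y c ∨ x = σ.reg r_u ∧ y = σ.reg r_v ∧
      G.weight (edgeSet (σ.reg r_m) (σ.arr a_set)) ≤ c) :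
    G.StateSearch s P' (compareSol.sem σ) := by
  rw [compareSol, sem_seq, sem_seq]
  set σ₁ := sumWeights.sem σ with hσ₁
  have hcost : σ₁.reg r_cost = G.weight (edgeSet (σ.reg r_m) (σ.arr a_set)) :=
    sumWeights_sem hσ.rep
  set σ₂ := (assign r_tmp' (.sub (.add (.arr a_pot' (.reg r_u)) (.reg r_cost))
    (.arr a_pot' (.reg r_v)))).sem σ₁ with hσ₂
  have eA : ∀ a, σ₂.arr a = σ.arr a := fun a => by
    rw [hσ₂]; exact sem_arr (p := sumWeights) (by rfl) σ
  have eR : ∀ x, x ≠ r_tmp' → sumWeights.writesReg x = false → σ₂.reg x = σ.reg x := by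
    intro x hx hx'
    rw [← sem_reg hx' σ, hσ₂]
    exact sem_reg (by simp [writesReg, hx]) _
  have e1 := eR r_u (by omega) rfl
  have e2 := eR r_v (by omega) rfl
  have e3 := eR r_found' (by omega) rfl
  have e4 := eR r_min' (by omega) rfl
  have e5 := eR r_new' (by omega) rfl
  have e6 := eR r_m (by omega) rfl
  set u := σ.reg r_u
  set v := σ.reg r_v
  set X := edgeSet (σ.reg r_m) (σ.arr a_set)
  have etmp : σ₂.reg r_tmp' = σ.arr a_pot' u + G.weight X - σ.arr a_pot' v := by
    have h1 : σ₁.reg r_u = u := sem_reg rfl σ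
    have h2 : σ₁.reg r_v = v := sem_reg rfl σ
    have h3 : σ₁.arr a_pot' = σ.arr a_pot' := sem_arr rfl σ
    simp [hσ₂, sem, Expr.eval, State.setReg, h1, h2, h3, hcost]
  have hS₂ : G.StateSearch s P σ₂ := by
    unfold Net.StateSearch
    rwa [eA, eA, eA, e3, e4, e5, e6]
  by_cases hb : σ₂.reg r_found' = 0 ∨ σ₂.reg r_tmp' < σ₂.reg r_min'
  · rw [sem_ite_of_ne (by simp only [Expr.eval]; omega), sem_seq, sem_seq, sem_seq]
    set σ₃ := (assign r_new' (.reg r_v)).sem ((assign r_min' (.reg r_tmp')).sem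
      ((assign r_found' (.lit 1)).sem σ₂)) with hσ₃
    have f1 : σ₃.reg r_found' = 1 := by simp [hσ₃, sem, State.setReg, Expr.eval]
    have f2 : σ₃.reg r_min' = σ₂.reg r_tmp' := by simp [hσ₃, sem, State.setReg, Expr.eval]
    have f3 : σ₃.reg r_new' = v := by simp [hσ₃, sem, State.setReg, Expr.eval, e2]
    have f4 : σ₃.reg r_m = σ.reg r_m := by simp [hσ₃, sem, State.setReg, e6]
    have f5 : σ₃.reg r_u = u := by simp [hσ₃, sem, State.setReg, e1]
    have f6 : ∀ a, σ₃.arr a = σ.arr a := fun a => by rw [← eA a]; rfl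
    have hB : edgeSet (σ.reg r_m) ((joinSets.sem σ₃).arr a_best) =
        edgeSet (σ.reg r_m) (fun e => σ.arr a_sol (u * σ.reg r_m + e)) ∪ X := by
      rw [← edgeSet_add]
      refine edgeSet_congr fun e he => ?_
      rw [joinSets_sem e (by rwa [f4]), f6, f6, f6, f5, hσ.base u hu]
    unfold Net.StateSearch
    rw [sem_arr (a := a_rank') rfl, sem_arr (a := a_pot') rfl, sem_reg (x := r_found') rfl,
      sem_reg (x := r_min') rfl, sem_reg (x := r_new') rfl, sem_reg (x := r_m) rfl,
      f1, f2, f3, f4, f6, f6, hB, etmp]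
    refine ⟨fun h0 => absurd h0 one_ne_zero, fun _ => hv, fun _ => hRv, fun _ => ?_, fun _ => ?_,
      fun _ x y c h1 h2 h3 => ?_⟩
    · exact ((hσ.feasible u hu hRu).mono Finset.subset_union_left).trans
        (hX.mono Finset.subset_union_right)
    · have h1 := Net.weight_union_le (G := G)
        (edgeSet (σ.reg r_m) (fun e => σ.arr a_sol (u * σ.reg r_m + e))) X
      have h2 := hσ.weight_le u hu hRu
      omega
    -- Feasibility of the potential covers the case where the subtraction in the candidate value is
    -- truncated to `0`.
    · have h4 := hσ.pot_le x y c (hP' x y c h1)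
      rcases hP x y c h1 with h5 | ⟨rfl, rfl, h5⟩
      · rw [e3, e4, etmp] at hb
        rcases hb with hb | hb
        · exact absurd h3 (h.none hb x y c h5 h2)
        · by_cases h0 : σ.reg r_found' = 0
          · exact absurd h3 (h.none h0 x y c h5 h2)
          · have := h.min_le h0 x y c h5 h2 h3; omega
      · omega
  · rw [sem_ite_of_eq (by simp only [Expr.eval]; omega)]
    have h0 : σ.reg r_found' ≠ 0 := by rw [← e3]; exact fun h0 => hb (.inl h0)
    change G.StateSearch s P' σ₂
    refine ⟨fun h' => absurd (.inl h') hb, hS₂.new_lt, hS₂.new_rank, hS₂.feasible,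
      hS₂.weight_le, fun h' x y c h1 h2 h3 => ?_⟩
    rcases hP x y c h1 with h5 | ⟨rfl, rfl, h5⟩
    · exact hS₂.min_le h' x y c h5 h2 h3
    · have h4 := hσ.pot_le _ _ c (hP' _ _ c h1)
      rw [etmp] at hb
      rw [eA]
      omega

/-- The basic solutions of block type between the pairs of vertices before `(j, l)`. -/
def Net.BlockBefore (G : Net) (j l x y c : ℕ) : Prop :=
  (∃ X, x < G.n ∧ y < G.n ∧ x ≠ y ∧ G.CutProp x y X ∧ c = G.K * G.weight X) ∧
    (x < j ∨ x = j ∧ y < l)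

/-- The basic solutions of block type and the safe arcs before `j`. -/
def Net.SafeBefore (G : Net) (j x y c : ℕ) : Prop :=
  G.BlockBefore G.n 0 x y c ∨ ∃ a < j, a < G.N ∧ G.eid a ∉ G.flt ∧ G.cap a ≠ 0 ∧
    x = G.tl a ∧ y = G.hd a ∧ c = G.K * G.w (G.eid a)

theorem Net.BlockBefore.aux {G : Net} {j l x y c : ℕ} (h : G.BlockBefore j l x y c) :
    G.Aux x y c := by
  obtain ⟨⟨X, h1, h2, h3, h4, rfl⟩, -⟩ := h
  exact .block x y X h1 h2 h3 h4

theorem Net.SafeBefore.aux {G : Net} {j x y c : ℕ} (h : G.SafeBefore j x y c) :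
    G.Aux x y c := by
  rcases h with h | ⟨a, -, h1, h2, h3, rfl, rfl, rfl⟩
  · exact h.aux
  · exact .safe a h1 h2 h3

/-- If the flow fails, there is no block from `j` to `l`; if it succeeds, its support is no heavier
than the `K`-fold cost of any such block. Hence a single flow deals with all blocks between the two
vertices. -/
theorem tryPair_sem {G : Net} (hG : G.Valid) {s j l : ℕ} {σ : State} (hσ : G.PartialSol s σ)
    (h : G.StateSearch s (G.BlockBefore j l) σ) (hu : σ.reg r_u = j) (hv : σ.reg r_v = l)
    (hj : j < G.n) (hl : l < G.n) :
    G.StateSearch s (G.BlockBefore j (l + 1)) (tryPair.sem σ) := by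
  have key : ∀ x y c, G.BlockBefore j (l + 1) x y c → G.BlockBefore j l x y c ∨
      x = j ∧ y = l ∧ ∃ X, G.CutProp j l X ∧ c = G.K * G.weight X := by
    rintro x y c ⟨⟨X, h1, h2, h3, h4, h5⟩, h6⟩
    by_cases h7 : x < j ∨ x = j ∧ y < l
    · exact .inl ⟨⟨X, h1, h2, h3, h4, h5⟩, h7⟩
    · have h8 : x = j ∧ y = l := by omega
      obtain ⟨rfl, rfl⟩ := h8
      exact .inr ⟨rfl, rfl, X, h4, h5⟩
  rw [tryPair]
  by_cases hRu : σ.arr a_rank' j = 0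
  · rw [sem_ite_of_eq (by simpa [Expr.eval, hu] using hRu)]
    refine h.of_imp fun x y c h1 h2 h3 => (key x y c h1).resolve_right ?_
    rintro ⟨rfl, -⟩
    exact h2 hRu
  rw [sem_ite_of_ne (by simpa [Expr.eval, hu] using hRu)]
  by_cases hRv : σ.arr a_rank' l = 0
  swap
  · rw [sem_ite_of_ne (by simpa [Expr.eval, hv] using hRv)]
    refine h.of_imp fun x y c h1 h2 h3 => (key x y c h1).resolve_right ?_
    rintro ⟨-, rfl, -⟩
    exact hRv h3
  rw [sem_ite_of_eq (by simpa [Expr.eval, hv] using hRv), sem_seq]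
  have hf := flow_sem hG hσ.rep hj hl hu hv
  have hS : G.StateSearch s (G.BlockBefore j l) (flow.sem σ) :=
    Net.StateSearch.sem h flow rfl rfl rfl rfl rfl rfl rfl
  have hσ₁ : G.PartialSol s (flow.sem σ) := hσ.sem rfl
  have hRf : (flow.sem σ).arr a_rank' = σ.arr a_rank' := sem_arr rfl σ
  have huf : (flow.sem σ).reg r_u = j := (sem_reg rfl σ).trans hu
  have hvf : (flow.sem σ).reg r_v = l := (sem_reg rfl σ).trans hv
  generalize flow.sem σ = σ₁ at *
  by_cases hok : σ₁.reg r_ok = 0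
  · rw [sem_ite_of_eq (by simpa [Expr.eval] using hok)]
    refine hS.of_imp fun x y c h1 h2 h3 => (key x y c h1).resolve_right ?_
    rintro ⟨-, -, X, hX, -⟩
    exact hf.2 hok X hX
  rw [sem_ite_of_ne (by simpa [Expr.eval] using hok), sem_seq]
  obtain ⟨p, hp⟩ := hf.1 hok
  have hset := storeSupport_sem hσ₁.rep
  have hS₂ : G.StateSearch s (G.BlockBefore j l) (storeSupport.sem σ₁) :=
    Net.StateSearch.sem hS storeSupport rfl rfl rfl rfl rfl rfl rfl
  have hσ₂ : G.PartialSol s (storeSupport.sem σ₁) := hσ₁.sem rfl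
  have hR2 : (storeSupport.sem σ₁).arr a_rank' = σ₁.arr a_rank' := sem_arr rfl σ₁
  have hu2 : (storeSupport.sem σ₁).reg r_u = j := (sem_reg rfl σ₁).trans huf
  have hv2 : (storeSupport.sem σ₁).reg r_v = l := (sem_reg rfl σ₁).trans hvf
  have hm2 : (storeSupport.sem σ₁).reg r_m = σ₁.reg r_m := sem_reg rfl σ₁
  rw [← hm2] at hset
  refine compareSol_sem hσ₂ hS₂ (by rwa [hu2]) (by rwa [hv2]) (by rwa [hR2, hRf, hu2])
    (by rwa [hR2, hRf, hv2]) ?_ (fun x y c h => h.aux) fun x y c h1 => ?_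
  · rw [hset, hu2, hv2]
    exact hp.feasible_support hG hj hl
  · rw [hset, hu2, hv2]
    rcases key x y c h1 with h1 | ⟨rfl, rfl, X, hX, rfl⟩
    · exact .inl h1
    · exact .inr ⟨rfl, rfl, hp.weight_support_le hG hj hl hX⟩

theorem trySafe_sem {G : Net} (hG : G.Valid) {s j : ℕ} {σ : State} (hσ : G.PartialSol s σ)
    (h : G.StateSearch s (G.SafeBefore j) σ) (ha : σ.reg r_arc = j) (hj : j < G.N) :
    G.StateSearch s (G.SafeBefore (j + 1)) (trySafe.sem σ) := by
  have key : ∀ x y c, G.SafeBefore (j + 1) x y c → G.SafeBefore j x y c ∨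
      G.eid j ∉ G.flt ∧ G.cap j ≠ 0 ∧ x = G.tl j ∧ y = G.hd j ∧ c = G.K * G.w (G.eid j) := by
    rintro x y c (h1 | ⟨a, h1, h2, h3⟩)
    · exact .inl (.inl h1)
    · by_cases h4 : a < j
      · exact .inl (.inr ⟨a, h4, h2, h3⟩)
      · obtain rfl : a = j := by omega
        exact .inr h3
  have hflt := hσ.rep.flt j hj
  rw [trySafe]
  by_cases h1 : σ.arr a_flt j = 0
  swap
  · rw [sem_ite_of_ne (by simpa [Expr.eval, ha] using h1)]
    exact h.of_imp fun x y c h2 h3 h4 => (key x y c h2).resolve_right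
      fun h5 => h5.1 (hflt.1 h1)
  have hs : G.eid j ∉ G.flt := fun h' => (hflt.2 h') h1
  rw [sem_ite_of_eq (by simpa [Expr.eval, ha] using h1)]
  by_cases h2 : G.cap j = 0
  · rw [sem_ite_of_eq (by simpa [Expr.eval, ha, hσ.rep.cap] using h2)]
    exact h.of_imp fun x y c h2 h3 h4 => (key x y c h2).resolve_right
      fun h5 => h5.2.1 (by assumption)
  rw [sem_ite_of_ne (by simpa [Expr.eval, ha, hσ.rep.cap] using h2)]
  by_cases h3 : σ.arr a_rank' (G.tl j) = 0
  · rw [sem_ite_of_eq (by simpa [Expr.eval, ha, hσ.rep.tl] using h3)]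
    refine h.of_imp fun x y c h4 h5 h6 => (key x y c h4).resolve_right ?_
    rintro ⟨-, -, rfl, -⟩
    exact h5 h3
  rw [sem_ite_of_ne (by simpa [Expr.eval, ha, hσ.rep.tl] using h3)]
  by_cases h4 : σ.arr a_rank' (G.hd j) = 0
  swap
  · rw [sem_ite_of_ne (by simpa [Expr.eval, ha, hσ.rep.hd] using h4)]
    refine h.of_imp fun x y c h5 h6 h7 => (key x y c h5).resolve_right ?_
    rintro ⟨-, -, -, rfl, -⟩
    exact h4 h7
  rw [sem_ite_of_eq (by simpa [Expr.eval, ha, hσ.rep.hd] using h4), sem_seq, sem_seq, sem_seq]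
  set σ₁ := (assign r_v (.arr a_hd (.reg r_arc))).sem
    ((assign r_u (.arr a_tl (.reg r_arc))).sem σ) with hσ₁
  have k1 : σ₁.reg r_u = G.tl j := by
    simp [hσ₁, sem, Expr.eval, State.setReg, ha, hσ.rep.tl]
  have k2 : σ₁.reg r_v = G.hd j := by
    simp [hσ₁, sem, Expr.eval, State.setReg, ha, hσ.rep.hd]
  have k3 : σ₁.reg r_arc = j := by simp [hσ₁, sem, State.setReg, ha]
  have k4 : σ₁.arr a_rank' = σ.arr a_rank' := rfl
  have hσ₁' : G.PartialSol s σ₁ := (hσ.sem (p := assign r_u (.arr a_tl (.reg r_arc))) rfl).sem rfl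
  have hS₁ : G.StateSearch s (G.SafeBefore j) σ₁ := by
    simpa [hσ₁, Net.StateSearch, sem, State.setReg] using h
  have hset := storeEdge_sem hσ₁'.rep (by rwa [k3])
  have hS₂ : G.StateSearch s (G.SafeBefore j) (storeEdge.sem σ₁) :=
    Net.StateSearch.sem hS₁ storeEdge rfl rfl rfl rfl rfl rfl rfl
  have hσ₂ : G.PartialSol s (storeEdge.sem σ₁) := hσ₁'.sem rfl
  have hR2 : (storeEdge.sem σ₁).arr a_rank' = σ₁.arr a_rank' := sem_arr rfl σ₁
  have hu2 : (storeEdge.sem σ₁).reg r_u = G.tl j := (sem_reg rfl σ₁).trans k1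
  have hv2 : (storeEdge.sem σ₁).reg r_v = G.hd j := (sem_reg rfl σ₁).trans k2
  have hm2 : (storeEdge.sem σ₁).reg r_m = σ₁.reg r_m := sem_reg rfl σ₁
  rw [← hm2, k3] at hset
  refine compareSol_sem hσ₂ hS₂ (by rw [hu2]; exact hG.tl_lt j hj)
    (by rw [hv2]; exact hG.hd_lt j hj)
    (by rwa [hR2, k4, hu2]) (by rwa [hR2, k4, hv2]) ?_ (fun x y c h => h.aux)
    fun x y c h1 => ?_
  · rw [hset, hu2, hv2]
    exact .of_safe hj hs h2
  · rw [hset, hu2, hv2]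
    rcases key x y c h1 with h1 | ⟨-, -, rfl, rfl, rfl⟩
    · exact .inl h1
    -- The search uses the plain weight of the safe edge, which is at most its `K`-fold cost because
    -- `1 ≤ K`.
    · refine .inr ⟨rfl, rfl, ?_⟩
      simpa [Net.weight] using Nat.le_mul_of_pos_left _ hG.one_le

theorem search_sem {G : Net} (hG : G.Valid) {s : ℕ} {σ : State} (hσ : G.PartialSol s σ) :
    G.StateSearch s G.Aux (search.sem σ) := by
  rw [search, sem_seq, sem_seq]
  set σ₁ := (assign r_found' (.lit 0)).sem σ with hσ₁
  have hσ₁' : G.PartialSol s σ₁ := hσ.sem rfl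
  set σ₂ := (count r_u r_n (count r_v r_n tryPair)).sem σ₁ with hσ₂
  have hσ₂' : G.PartialSol s σ₂ := hσ₁'.sem rfl
  have H₂ : G.StateSearch s (G.BlockBefore G.n 0) σ₂ := by
    rw [← hσ₁'.rep.n]
    refine count_induction (fun j τ => G.StateSearch s (G.BlockBefore j 0) τ) σ₁ ?_ ?_
    · have h0 : (σ₁.setReg r_u 0).reg r_found' = 0 := by
        simp [hσ₁, sem, Expr.eval, State.setReg]
      refine ⟨fun _ x y c h => ?_, fun h => absurd h0 h, fun h => absurd h0 h,
        fun h => absurd h0 h, fun h => absurd h0 h, fun h => absurd h0 h⟩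
      have := h.2
      omega
    · intro j τ hj hI hj' hr ha
      have hτ : G.PartialSol s τ := hσ₁'.frame rfl hr ha
      rw [hσ₁'.rep.n] at hj
      have H : G.StateSearch s (G.BlockBefore j G.n) ((count r_v r_n tryPair).sem τ) := by
        rw [← hτ.rep.n]
        refine count_induction (fun l υ => G.StateSearch s (G.BlockBefore j l) υ) τ ?_ ?_
        · exact hI
        · intro l υ hl hI' hl' hr' ha'
          rw [hτ.rep.n] at hl
          exact tryPair_sem hG (hτ.frame rfl hr' ha') hI' ((hr' r_u rfl).trans hj') hl' hj hl
      refine Net.SearchInv.of_imp (P := G.BlockBefore j G.n) H fun x y c h _ _ => ?_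
      refine ⟨h.1, ?_⟩
      obtain ⟨⟨X, h1, h2, -⟩, h3⟩ := h
      omega
  have H₃ : G.StateSearch s (G.SafeBefore G.N) ((count r_arc r_arcs trySafe).sem σ₂) := by
    rw [← hσ₂'.rep.arcs]
    refine count_induction (fun j τ => G.StateSearch s (G.SafeBefore j) τ) σ₂ ?_ ?_
    · refine Net.SearchInv.of_imp (P := G.BlockBefore G.n 0) H₂ fun x y c h _ _ => ?_
      rcases h with h | ⟨a, h, -⟩
      · exact h
      · omega
    · intro j τ hj hI hj' hr ha
      rw [hσ₂'.rep.arcs] at hj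
      exact trySafe_sem hG (hσ₂'.frame rfl hr ha) hI hj' hj
  refine Net.SearchInv.of_imp (P := G.SafeBefore G.N) H₃ fun x y c h _ _ => ?_
  cases h with
  | safe a h1 h2 h3 => exact .inr ⟨a, h1, h1, h2, h3, rfl, rfl, rfl⟩
  | block u v X h1 h2 h3 h4 => exact .inl ⟨⟨X, h1, h2, h3, h4, rfl⟩, .inl h1⟩

end FTP

namespace FTP
open Prog

/-! ### Extension of the set of solved vertices, and correctness of the main program -/

theorem storeSol_sem (σ : State) (i : ℕ) : (storeSol.sem σ).arr a_sol i =
    if σ.arr a_base (σ.reg r_new') ≤ i ∧ i < σ.arr a_base (σ.reg r_new') + σ.reg r_m then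
      σ.arr a_best (i - σ.arr a_base (σ.reg r_new')) else σ.arr a_sol i := by
  set b := σ.arr a_base (σ.reg r_new') with hb
  refine count_induction (fun j τ => ∀ i, τ.arr a_sol i =
    if b ≤ i ∧ i < b + j then σ.arr a_best (i - b) else σ.arr a_sol i) σ ?_ ?_ i
  · intro i
    rw [if_neg (by omega)]
    rfl
  · intro j τ _ hI hj hr ha i
    simp only [sem, Expr.eval, hj, hr r_new' rfl, ha a_base rfl, ha a_best rfl, ← hb,
      State.setReg, State.setArr, Function.update_self]
    by_cases hi : i = b + j
    · subst hi
      rw [Function.update_self, if_pos (by omega), Nat.add_sub_cancel_left]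
    · rw [Function.update_of_ne hi, hI i]
      have : i < b + (j + 1) ∧ b ≤ i ↔ i < b + j ∧ b ≤ i := by omega
      simp only [and_comm (a := b ≤ i), this]

/-- All basic solutions from solved vertices lead to solved vertices, or more than `g` vertices
have been solved. -/
def Net.SolProgress (G : Net) (R : ℕ → ℕ) (g : ℕ) : Prop :=
  (∀ x y c, G.Aux x y c → R x ≠ 0 → R y ≠ 0) ∨
    g + 1 ≤ ((Finset.range G.n).filter fun x => R x ≠ 0).card

theorem Net.Aux.lt {G : Net} (hG : G.Valid) {x y c : ℕ} (h : G.Aux x y c) :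
    x < G.n ∧ y < G.n := by
  cases h with
  | safe a h => exact ⟨hG.tl_lt a h, hG.hd_lt a h⟩
  | block u v X h1 h2 => exact ⟨h1, h2⟩

theorem extendSol_sem {G : Net} (hG : G.Valid) {s g : ℕ} {σ : State} (hs : s < G.n)
    (hσ : G.PartialSol s σ)
    (h : G.StateSearch s G.Aux σ) (hp : G.SolProgress (σ.arr a_rank') g) :
    G.PartialSol s (extendSol.sem σ) ∧
      G.SolProgress ((extendSol.sem σ).arr a_rank') (g + 1) := by
  unfold extendSol
  by_cases h0 : σ.reg r_found' = 0
  · rw [sem_ite_of_eq (by simpa [Expr.eval] using h0)]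
    exact ⟨hσ, .inl (h.none h0)⟩
  rw [sem_ite_of_ne (by simpa [Expr.eval] using h0), sem_seq, sem_seq]
  set z := σ.reg r_new' with hz
  have hzn := h.new_lt h0
  have hzR := h.new_rank h0
  have hzs : z ≠ s := fun e => hσ.root (e ▸ hzR)
  set σ₁ := (raise a_rank' a_pot' r_min').sem σ with hσ₁
  set σ₂ := (store a_rank' (.reg r_new') (.lit 1)).sem σ₁ with hσ₂
  set σ₃ := storeSol.sem σ₂ with hσ₃
  have hrep : G.Rep σ₃ := ((hσ.rep.sem (p := raise a_rank' a_pot' r_min') rfl).sem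
    (p := store a_rank' (.reg r_new') (.lit 1)) rfl).sem rfl
  have z₁ : σ₁.reg r_new' = z := sem_reg rfl σ
  have z₂ : σ₂.reg r_new' = z := z₁
  have m₂ : σ₂.reg r_m = σ.reg r_m := sem_reg (p := raise a_rank' a_pot' r_min') rfl σ
  have m₃ : σ₃.reg r_m = σ.reg r_m := (sem_reg rfl σ₂).trans m₂
  have hR : σ₃.arr a_rank' = Function.update (σ.arr a_rank') z 1 := by
    have e1 : σ₃.arr a_rank' = σ₂.arr a_rank' := sem_arr rfl σ₂
    have e2 : σ₁.arr a_rank' = σ.arr a_rank' := sem_arr rfl σ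
    rw [e1]
    simp [hσ₂, sem, Expr.eval, State.setArr, e2, z₁]
  have hpot : ∀ y < G.n, σ₃.arr a_pot' y =
      if σ.arr a_rank' y = 0 then σ.arr a_pot' y + σ.reg r_min' else σ.arr a_pot' y := by
    intro y hy
    have e1 : σ₃.arr a_pot' = σ₁.arr a_pot' := (sem_arr rfl σ₂).trans (sem_arr rfl σ₁)
    rw [e1, hσ₁, raise_sem (by omega) (by omega), hσ.rep.n]
    simp [hy]
  have hbase : σ₃.arr a_base = σ.arr a_base :=
    (sem_arr rfl σ₂).trans ((sem_arr rfl σ₁).trans (sem_arr rfl σ))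
  have hbase₂ : σ₂.arr a_base = σ.arr a_base :=
    (sem_arr rfl σ₁).trans (sem_arr rfl σ)
  have hbest : σ₂.arr a_best = σ.arr a_best := (sem_arr rfl σ₁).trans (sem_arr rfl σ)
  have hsol₂ : σ₂.arr a_sol = σ.arr a_sol := (sem_arr rfl σ₁).trans (sem_arr rfl σ)
  have hsol : ∀ i, σ₃.arr a_sol i =
      if z * σ.reg r_m ≤ i ∧ i < z * σ.reg r_m + σ.reg r_m then
        σ.arr a_best (i - z * σ.reg r_m) else σ.arr a_sol i := by
    intro i
    rw [hσ₃, storeSol_sem, z₂, hbase₂, hbest, hsol₂, m₂, hσ.base z hzn]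
  have hsz : (edgeSet (σ.reg r_m) fun e => σ₃.arr a_sol (z * σ.reg r_m + e)) =
      edgeSet (σ.reg r_m) (σ.arr a_best) := by
    refine edgeSet_congr fun e he => ?_
    rw [hsol, if_pos (by omega), Nat.add_sub_cancel_left]
  have hsx : ∀ x, x ≠ z → (edgeSet (σ.reg r_m) fun e => σ₃.arr a_sol (x * σ.reg r_m + e)) =
      edgeSet (σ.reg r_m) fun e => σ.arr a_sol (x * σ.reg r_m + e) := by
    intro x hx
    refine edgeSet_congr fun e he => ?_
    -- The solutions of different vertices occupy disjoint segments of length `m`, so storing one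
    -- leaves the others intact.
    rw [hsol, if_neg]
    rintro ⟨h1, h2⟩
    rcases Nat.lt_or_gt_of_ne hx with h3 | h3
    · have := Nat.mul_le_mul_right (σ.reg r_m) (Nat.succ_le_of_lt h3)
      rw [Nat.succ_mul] at this
      omega
    · have := Nat.mul_le_mul_right (σ.reg r_m) (Nat.succ_le_of_lt h3)
      rw [Nat.succ_mul] at this
      omega
  refine ⟨⟨hrep, ?_, ?_, ?_, ?_, ?_, ?_⟩, ?_⟩
  · rw [hbase, m₃]; exact hσ.base
  · rw [hR, Function.update_of_ne hzs.symm]; exact hσ.root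
  · intro x hx hRx
    rw [m₃]
    by_cases hxz : x = z
    · subst hxz; rw [hsz]; exact h.feasible h0
    · rw [hR, Function.update_of_ne hxz] at hRx
      rw [hsx x hxz]; exact hσ.feasible x hx hRx
  · intro x hx hRx
    rw [m₃, hpot x hx]
    by_cases hxz : x = z
    · rw [hxz, hsz, if_pos hzR]; exact h.weight_le h0
    · rw [hR, Function.update_of_ne hxz] at hRx
      rw [hsx x hxz, if_neg hRx]; exact hσ.weight_le x hx hRx
  · intro x y c hA
    have h1 := hσ.pot_le x y c hA
    have h2 := h.min_le h0 x y c hA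
    rw [hpot x (hA.lt hG).1, hpot y (hA.lt hG).2]
    -- Only a basic solution from a solved to an unsolved vertex loses slack, and the raise is at
    -- most that slack.
    split_ifs with h3 h4 h4
    · omega
    · exact h2 h4 h3
    · omega
    · omega
  · rw [hpot s hs, if_neg hσ.root]; exact hσ.pot_root
  · rcases hp with hp | hp
    -- If the solved vertices were already closed under basic solutions, the decomposition of the
    -- set just found would make its endpoint solved.
    · exact absurd hzR ((h.feasible h0).potential_le hG (R := fun x => σ.arr a_rank' x ≠ 0)
        (fun x y c hA hx => ⟨hp x y c hA hx, hσ.pot_le x y c hA⟩) hs hzn hσ.root).1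
    · right
      have hsub : insert z ((Finset.range G.n).filter fun x => σ.arr a_rank' x ≠ 0) ⊆
          (Finset.range G.n).filter fun x => σ₃.arr a_rank' x ≠ 0 := by
        intro x hx
        rw [hR]
        rcases Finset.mem_insert.1 hx with rfl | hx
        · simpa using hzn
        · rw [Finset.mem_filter] at hx ⊢
          have : x ≠ z := fun e => hx.2 (e ▸ hzR)
          rwa [Function.update_of_ne this]
      have := Finset.card_le_card hsub
      rw [Finset.card_insert_of_notMem (show z ∉ (Finset.range G.n).filter
        (fun x => σ.arr a_rank' x ≠ 0) from fun hz' => (Finset.mem_filter.1 hz').2 hzR)] at this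
      omega

/-- The main program solves the problem. -/
theorem solve_sem {G : Net} (hG : G.Valid) {σ : State} (hσ : G.Rep σ)
    (hbase : ∀ x < G.n, σ.arr a_base x = x * σ.reg r_m) (hs : σ.reg r_s < G.n)
    (ht : σ.reg r_t < G.n) (hR : ∀ x, σ.arr a_rank' x = 0) (hp : ∀ x, σ.arr a_pot' x = 0)
    (hsol : ∀ i, σ.arr a_sol i = 0) :
    ((solve.sem σ).arr a_rank' (σ.reg r_t) ≠ 0 →
      G.Feasible (σ.reg r_s) (σ.reg r_t) (edgeSet (σ.reg r_m) ((solve.sem σ).arr a_out)) ∧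
      ∀ T, G.Feasible (σ.reg r_s) (σ.reg r_t) T →
        G.weight (edgeSet (σ.reg r_m) ((solve.sem σ).arr a_out)) ≤ G.K * G.weight T) ∧
    ((solve.sem σ).arr a_rank' (σ.reg r_t) = 0 →
      ∀ T, ¬ G.Feasible (σ.reg r_s) (σ.reg r_t) T) := by
  set s := σ.reg r_s with hs'
  set t := σ.reg r_t with ht'
  rw [solve, sem_seq, sem_seq]
  set σ₁ := (store a_rank' (.reg r_s) (.lit 1)).sem σ with hσ₁
  have hrank : σ₁.arr a_rank' = Function.update (σ.arr a_rank') s 1 := by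
    simp [hσ₁, sem, Expr.eval, State.setArr, ← hs']
  have hempty : edgeSet (σ.reg r_m) (fun _ => 0) = ∅ := by simp [edgeSet]
  have h₁ : G.PartialSol s σ₁ := by
    have hxs : ∀ x, σ₁.arr a_rank' x ≠ 0 → x = s := by
      intro x hx
      by_contra h
      rw [hrank, Function.update_of_ne h] at hx
      exact hx (hR x)
    have hm : σ₁.reg r_m = σ.reg r_m := rfl
    have e1 : σ₁.arr a_sol = fun _ => 0 := funext hsol
    have e2 : σ₁.arr a_pot' = fun _ => 0 := funext hp
    refine ⟨hσ.sem rfl, hbase, ?_, ?_, ?_, ?_, ?_⟩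
    · rw [hrank, Function.update_self]; exact one_ne_zero
    · intro x _ hx
      rw [hxs x hx]
      exact .refl _ _
    · intro x _ _
      simp only [e1, hm, hempty]
      simp [Net.weight]
    · intro x y c _; simp [e2]
    · simp [e2]
  set σ₂ := (count r_step' r_n (search ;; extendSol)).sem σ₁ with hσ₂
  have h₂ : G.PartialSol s σ₂ ∧ G.SolProgress (σ₂.arr a_rank') G.n := by
    rw [← h₁.rep.n]
    refine count_induction (fun j τ => G.PartialSol s τ ∧ G.SolProgress (τ.arr a_rank') j) σ₁
      ⟨?_, ?_⟩ ?_
    · exact h₁.congr (h₁.rep.congr rfl rfl rfl rfl rfl rfl rfl rfl rfl) rfl rfl rfl rfl rfl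
    · right
      rw [Nat.zero_add, Nat.one_le_iff_ne_zero, Finset.card_ne_zero]
      exact ⟨s, Finset.mem_filter.2 ⟨Finset.mem_range.2 hs, h₁.root⟩⟩
    · intro j τ hj hI hj' hr ha
      have H := search_sem hG hI.1
      have hR' : (search.sem τ).arr a_rank' = τ.arr a_rank' := sem_arr rfl τ
      have H' := extendSol_sem hG hs (hI.1.sem (p := search) rfl) H (hR' ▸ hI.2)
      refine ⟨H'.1.congr (H'.1.rep.congr rfl rfl rfl rfl rfl rfl rfl rfl rfl) rfl rfl rfl rfl rfl,
        H'.2⟩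
  have hclosed : ∀ x y c, G.Aux x y c → σ₂.arr a_rank' x ≠ 0 → σ₂.arr a_rank' y ≠ 0 := by
    rcases h₂.2 with h | h
    · exact h
    · have := Finset.card_filter_le (Finset.range G.n) fun x => σ₂.arr a_rank' x ≠ 0
      rw [Finset.card_range] at this
      omega
  have hlow : ∀ T, G.Feasible s t T →
      -- The final potential is feasible and zero at `s`, so the decomposition yields the lower
      -- bound and at the same time that `t` is solved whenever a feasible set exists.
      σ₂.arr a_rank' t ≠ 0 ∧ σ₂.arr a_pot' t ≤ G.K * G.weight T := by
    intro T hT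
    have := hT.potential_le hG (R := fun x => σ₂.arr a_rank' x ≠ 0) (d := σ₂.arr a_pot')
      (fun x y c hA hx => ⟨hclosed x y c hA hx, h₂.1.pot_le x y c hA⟩) hs ht h₂.1.root
    rwa [h₂.1.pot_root, Nat.zero_add] at this
  have m₂ : σ₂.reg r_m = σ.reg r_m := (sem_reg rfl σ₁).trans rfl
  have t₂ : σ₂.reg r_t = t := (sem_reg rfl σ₁).trans rfl
  set σ₃ := (count r_edge r_m (store a_out (.reg r_edge)
      (.arr a_sol (.add (.arr a_base (.reg r_t)) (.reg r_edge))))).sem σ₂ with hσ₃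
  have hR₃ : σ₃.arr a_rank' = σ₂.arr a_rank' := sem_arr rfl σ₂
  have hout : ∀ e, e < σ₂.reg r_m → σ₃.arr a_out e = σ₂.arr a_sol (t * σ.reg r_m + e) := by
    refine count_induction (fun j τ => ∀ e, e < j → τ.arr a_out e =
      σ₂.arr a_sol (t * σ.reg r_m + e)) σ₂ (fun e he => absurd he (by omega)) ?_
    intro j τ _ hI hj hr ha e he
    simp only [sem, Expr.eval, hj, hr r_t rfl, ha a_sol rfl, ha a_base rfl, t₂,
      h₂.1.base t ht, m₂, State.setReg, State.setArr, Function.update_self, Function.update_apply]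
    split_ifs with hej
    · rw [hej]
    · exact hI e (by omega)
  rw [m₂] at hout
  rw [edgeSet_congr hout, hR₃]
  refine ⟨fun h => ⟨?_, fun T hT => ?_⟩, fun h T hT => (hlow T hT).1 h⟩
  · have := h₂.1.feasible t ht h
    rwa [m₂] at this
  · have := h₂.1.weight_le t ht h
    rw [m₂] at this
    exact this.trans (hlow T hT).2

end FTP

namespace FTP
namespace Prog

/-! ### Preparation of the network -/

/-- Compute the number of arcs and the capacities, and the sum of the denominators. -/
def setup : Prog :=
  assign r_arcs (.add (.reg r_m) (.reg r_m)) ;;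
    -- The nested truncated subtraction computes `min k (m + 1)`. Since `k` is given in binary, a
    -- loop of length `k` would not be polynomial.
    assign r_cap (.sub (.reg r_k) (.sub (.reg r_k) (.add (.reg r_m) (.lit 1)))) ;;
    assign r_value (.add (.reg r_cap) (.lit 1)) ;;
    count r_edge r_m (assign r_acc (.add (.reg r_acc) (.arr a_den (.reg r_edge))))

/-- Add a reverse arc for each edge, and compute the capacities of the arcs. -/
def storeArcs (κ : GraphKind) : Prog :=
  count r_edge r_m
    (store a_tl (.add (.reg r_edge) (.reg r_m)) (.arr a_hd (.reg r_edge)) ;;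
      store a_hd (.add (.reg r_edge) (.reg r_m)) (.arr a_tl (.reg r_edge)) ;;
      store a_flt (.add (.reg r_edge) (.reg r_m)) (.arr a_flt (.reg r_edge)) ;;
      ite (.arr a_flt (.reg r_edge)) (assign r_tmp (.lit 1)) (assign r_tmp (.reg r_cap)) ;;
      store a_cap (.reg r_edge) (.reg r_tmp) ;;
      store a_cap (.add (.reg r_edge) (.reg r_m))
        (match κ with
          | .directed => .lit 0
          | .undirected => .reg r_tmp))

/-- One step of binary multiplication. -/
def mulStep : Prog :=
  when (.sub (.reg r_tmp') (.add (.half (.reg r_tmp')) (.half (.reg r_tmp'))))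
      (assign r_acc (.add (.reg r_acc) (.reg r_tmp))) ;;
    assign r_tmp (.add (.reg r_tmp) (.reg r_tmp)) ;;
    assign r_tmp' (.half (.reg r_tmp'))

/-- Multiply `reg r_acc` by the denominator of the weight of `reg r_edge'`. -/
def mulDen : Prog :=
  assign r_tmp (.reg r_acc) ;; assign r_tmp' (.arr a_den (.reg r_edge')) ;;
    assign r_acc (.lit 0) ;; count r_bit r_bits mulStep

/-- Multiply the numerator of the weight of `reg r_edge` by the denominators of the weights of the
other edges. -/
def mulDens : Prog :=
  assign r_acc (.arr a_num (.reg r_edge)) ;;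
    count r_edge' r_m (when (.add (.sub (.reg r_edge') (.reg r_edge))
      (.sub (.reg r_edge) (.reg r_edge'))) mulDen)

/-- Store weights without denominators. -/
def storeWeights : Prog :=
  count r_edge r_m
    (mulDens ;; store a_w (.reg r_edge) (.reg r_acc) ;;
      store a_w (.add (.reg r_edge) (.reg r_m)) (.reg r_acc))

/-- Store the multiples of the number of edges. -/
def storeBase : Prog :=
  assign r_acc (.lit 0) ;;
    count r_vert r_n
      (store a_base (.reg r_vert) (.reg r_acc) ;;
        assign r_acc (.add (.reg r_acc) (.reg r_m)))

/-- Compute the network and solve the problem. -/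
def main (κ : GraphKind) : Prog := storeArcs κ ;; storeWeights ;; storeBase ;; solve

/-- Report whether `reg r_t` has been solved. -/
def report : Prog :=
  ite (.arr a_rank' (.reg r_t)) (assign r_n (.lit 1)) (assign r_n (.lit 0))

end Prog

open Prog

/-! ### Correctness of the preparation -/

/-- Add the number of binary digits of `reg r_acc` to `reg r_bits`. -/
def bitLength : Cmd :=
  .loop (.reg r_acc) (.seq (.assign r_bits (.add (.reg r_bits) (.lit 1)))
    (.assign r_acc (.half (.reg r_acc))))

/-- This is the only loop that is not a counting loop: it runs until the number is `0`. Halving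
lowers `Nat.size` by one; an iteration costs `2` for the test and `7` for the body. -/
theorem bitLength_run (σ : State) : ∃ n τ, Run bitLength σ n τ ∧
    n ≤ 9 * Nat.size (σ.reg r_acc) + 2 ∧ τ.arr = σ.arr ∧
    τ.reg r_bits = σ.reg r_bits + Nat.size (σ.reg r_acc) ∧
    ∀ x, x ≠ r_acc → x ≠ r_bits → τ.reg x = σ.reg x := by
  generalize hN : Nat.size (σ.reg r_acc) = N
  induction N generalizing σ with
  | zero =>
    refine ⟨_, σ, .loopDone (by simpa [Expr.eval, Nat.size_eq_zero] using hN),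
      by simp [Expr.cost], rfl, rfl,
      fun _ _ _ => rfl⟩
  | succ N ih =>
    have h0 : σ.reg r_acc ≠ 0 := fun h => by simp [h] at hN
    set τ := (σ.setReg r_bits (σ.reg r_bits + 1)).setReg r_acc (σ.reg r_acc / 2) with hτ
    have hacc : τ.reg r_acc = σ.reg r_acc / 2 := by simp [hτ, State.setReg]
    have hbits : τ.reg r_bits = σ.reg r_bits + 1 := by simp [hτ, State.setReg]
    have hsize : Nat.size (τ.reg r_acc) = N := by
      rw [hacc]
      have : ∀ a : ℕ, Nat.size (a / 2) = N ↔ Nat.size (a / 2) + 1 = N + 1 := by intro a; omega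
      rw [this, ← hN]
      have hb := Nat.size_bit (b := Nat.bodd (σ.reg r_acc)) (n := Nat.div2 (σ.reg r_acc))
        (by rw [Nat.bit_bodd_div2]; exact h0)
      rw [Nat.bit_bodd_div2, Nat.div2_val] at hb
      omega
    obtain ⟨n, υ, hr, hn, h1, h2, h3⟩ := ih τ hsize
    have hstep : Run (.seq (.assign r_bits (.add (.reg r_bits) (.lit 1)))
        (.assign r_acc (.half (.reg r_acc)))) σ (4 + 3) τ := by
      have := (Run.assign r_bits (.add (.reg r_bits) (.lit 1)) σ).seq
        (.assign r_acc (.half (.reg r_acc)) _)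
      simpa [Expr.eval, Expr.cost, State.setReg, hτ] using this
    refine ⟨_, υ, .loopStep (by simpa [Expr.eval] using h0) hstep hr, ?_, h1, ?_, ?_⟩
    · simp only [Expr.cost]; omega
    · rw [h2, hbits]; omega
    · intro x hx hx'
      rw [h3 x hx hx', hτ]
      simp [State.setReg, hx, hx']

theorem storeArcs_sem (κ : GraphKind) (σ : State) :
    let τ := (storeArcs κ).sem σ
    ∀ e < σ.reg r_m, τ.arr a_tl e = σ.arr a_tl e ∧ τ.arr a_hd e = σ.arr a_hd e ∧
      τ.arr a_flt e = σ.arr a_flt e ∧ τ.arr a_tl (e + σ.reg r_m) = σ.arr a_hd e ∧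
      τ.arr a_hd (e + σ.reg r_m) = σ.arr a_tl e ∧
      τ.arr a_flt (e + σ.reg r_m) = σ.arr a_flt e ∧
      τ.arr a_cap e = (if σ.arr a_flt e ≠ 0 then 1 else σ.reg r_cap) ∧
      τ.arr a_cap (e + σ.reg r_m) = match κ with
        | .directed => 0
        | .undirected => if σ.arr a_flt e ≠ 0 then 1 else σ.reg r_cap := by
  intro τ
  -- The loop reads entries below `m` and writes the reversed arcs at `m` and above. The invariant
  -- therefore preserves all the original entries throughout and describes only the processed edges
  -- on the second half.
  have key : (∀ e < σ.reg r_m, τ.arr a_tl e = σ.arr a_tl e ∧ τ.arr a_hd e = σ.arr a_hd e ∧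
      τ.arr a_flt e = σ.arr a_flt e) ∧ ∀ e < σ.reg r_m,
      τ.arr a_tl (e + σ.reg r_m) = σ.arr a_hd e ∧
      τ.arr a_hd (e + σ.reg r_m) = σ.arr a_tl e ∧
      τ.arr a_flt (e + σ.reg r_m) = σ.arr a_flt e ∧
      τ.arr a_cap e = (if σ.arr a_flt e ≠ 0 then 1 else σ.reg r_cap) ∧
      τ.arr a_cap (e + σ.reg r_m) = match κ with
        | .directed => 0
        | .undirected => if σ.arr a_flt e ≠ 0 then 1 else σ.reg r_cap := by
    refine count_induction (fun j τ => (∀ e < σ.reg r_m, τ.arr a_tl e = σ.arr a_tl e ∧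
      τ.arr a_hd e = σ.arr a_hd e ∧
      τ.arr a_flt e = σ.arr a_flt e) ∧ ∀ e < j,
      τ.arr a_tl (e + σ.reg r_m) = σ.arr a_hd e ∧
      τ.arr a_hd (e + σ.reg r_m) = σ.arr a_tl e ∧
      τ.arr a_flt (e + σ.reg r_m) = σ.arr a_flt e ∧
      τ.arr a_cap e = (if σ.arr a_flt e ≠ 0 then 1 else σ.reg r_cap) ∧
      τ.arr a_cap (e + σ.reg r_m) = match κ with
        | .directed => 0
        | .undirected => if σ.arr a_flt e ≠ 0 then 1 else σ.reg r_cap) σ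
      ⟨fun _ _ => ⟨rfl, rfl, rfl⟩, fun e he => absurd he (by omega)⟩ ?_
    intro j τ hj hI hj' hr _
    have hm : τ.reg r_m = σ.reg r_m := hr r_m (by cases κ <;> rfl)
    have hc : τ.reg r_cap = σ.reg r_cap := hr r_cap (by cases κ <;> rfl)
    obtain ⟨t1, t2, t3⟩ := hI.1 j hj
    have hm0 : σ.reg r_m ≠ 0 := by omega
    have hne : ∀ e < σ.reg r_m, e ≠ j + σ.reg r_m := fun e he => by omega
    refine ⟨fun e he => ?_, fun e he => ?_⟩
    · have := hI.1 e he
      cases κ <;> by_cases h0 : σ.arr a_flt j = 0 <;>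
        simpa [sem, Expr.eval, State.setReg, State.setArr, Function.update_apply, hj', hm, hc, t1,
          t2, t3, h0, hne e he, hm0] using this
    · by_cases hej : e = j
      · subst hej
        cases κ <;> by_cases h0 : σ.arr a_flt e = 0 <;>
          simp [sem, Expr.eval, State.setReg, State.setArr, hj', hm, hc, t1,
            t2, t3, h0, hm0]
      · have := hI.2 e (by omega)
        have h1 := hne e (by omega)
        have h2 := hne j hj
        have h3 : e + σ.reg r_m ≠ j := by omega
        cases κ <;> by_cases h0 : σ.arr a_flt j = 0 <;>
          simpa [sem, Expr.eval, State.setReg, State.setArr, Function.update_apply, hj', hm, hc,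
            t1, t2, t3, h0, h1, h2, h3, hej, hm0] using this
  exact fun e he => ⟨(key.1 e he).1, (key.1 e he).2.1, (key.1 e he).2.2, key.2 e he⟩

/-- Binary multiplication: `acc + tmp * tmp'` is invariant, and `tmp'` is the denominator shifted
right by `j` bits, hence `0` at the end. -/
theorem mulDen_sem {σ : State} (h : σ.arr a_den (σ.reg r_edge') < 2 ^ σ.reg r_bits) :
    (mulDen.sem σ).reg r_acc = σ.reg r_acc * σ.arr a_den (σ.reg r_edge') := by
  set A := σ.reg r_acc with hA
  set D := σ.arr a_den (σ.reg r_edge') with hD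
  rw [mulDen, sem_seq, sem_seq, sem_seq]
  set σ₁ := (assign r_acc (.lit 0)).sem ((assign r_tmp' (.arr a_den (.reg r_edge'))).sem
    ((assign r_tmp (.reg r_acc)).sem σ)) with hσ₁
  have e1 : σ₁.reg r_bits = σ.reg r_bits := rfl
  have key : ∀ τ : State, τ = (count r_bit r_bits mulStep).sem σ₁ →
      τ.reg r_acc + τ.reg r_tmp * τ.reg r_tmp' = A * D ∧
        τ.reg r_tmp' = D / 2 ^ (σ.reg r_bits) := by
    rintro τ rfl
    rw [← e1]
    refine count_induction (fun j τ => τ.reg r_acc + τ.reg r_tmp * τ.reg r_tmp' = A * D ∧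
        τ.reg r_tmp' = D / 2 ^ j) σ₁ ?_ ?_
    · simp [hσ₁, sem, Expr.eval, State.setReg, ← hD, ← hA]
    · intro j τ _ hI hj hr ha
      obtain ⟨h1, h2⟩ := hI
      have h3 : D / 2 ^ (j + 1) = τ.reg r_tmp' / 2 := by
        rw [h2, Nat.div_div_eq_div_mul, pow_succ]
      rw [h3, ← h1, mulStep, sem_seq, sem_seq]
      have h4 : (τ.reg r_tmp + τ.reg r_tmp) * (τ.reg r_tmp' / 2) +
          τ.reg r_tmp * (τ.reg r_tmp' % 2) = τ.reg r_tmp * τ.reg r_tmp' := by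
        conv_rhs => rw [← Nat.div_add_mod (τ.reg r_tmp') 2]
        ring
      by_cases h5 : τ.reg r_tmp' % 2 = 0
      · rw [sem_ite_of_eq (by simp only [Expr.eval]; omega)]
        rw [h5, mul_zero, add_zero] at h4
        simp [sem, Expr.eval, State.setReg, h4]
      · rw [sem_ite_of_ne (by simp only [Expr.eval]; omega)]
        have h6 : τ.reg r_tmp' % 2 = 1 := by omega
        rw [h6, mul_one] at h4
        simp only [sem, Expr.eval, State.setReg, Function.update_apply, Nat.reduceEqDiff, if_false,
          if_true, and_true]
        omega
  obtain ⟨h1, h2⟩ := key _ rfl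
  rw [Nat.div_eq_of_lt h] at h2
  rw [← h1, h2, mul_zero, add_zero]

theorem mulDens_sem {σ : State} (h : ∀ e < σ.reg r_m, σ.arr a_den e < 2 ^ σ.reg r_bits) :
    (mulDens.sem σ).reg r_acc = σ.arr a_num (σ.reg r_edge) *
      ∏ e ∈ (Finset.range (σ.reg r_m)).erase (σ.reg r_edge), σ.arr a_den e := by
  rw [mulDens, sem_seq]
  set σ₁ := (assign r_acc (.arr a_num (.reg r_edge))).sem σ with hσ₁
  have e1 : σ₁.reg r_m = σ.reg r_m := rfl
  have e2 : σ₁.reg r_edge = σ.reg r_edge := rfl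
  rw [← e1]
  refine count_induction (fun j τ => τ.reg r_acc = σ.arr a_num (σ.reg r_edge) *
      ∏ e ∈ (Finset.range j).erase (σ.reg r_edge), σ.arr a_den e) σ₁ ?_ ?_
  · simp [hσ₁, sem, Expr.eval, State.setReg]
  · intro j τ hj hI hj' hr ha
    have t1 : τ.reg r_edge = σ.reg r_edge := hr r_edge rfl
    have t2 : τ.arr a_den = σ.arr a_den := ha a_den rfl
    have t3 : τ.reg r_bits = σ.reg r_bits := hr r_bits rfl
    by_cases hje : j = σ.reg r_edge
    · rw [sem_ite_of_eq (by simp [Expr.eval, hj', t1, hje])]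
      have : (Finset.range (j + 1)).erase (σ.reg r_edge) =
          (Finset.range j).erase (σ.reg r_edge) := by
        ext x; simp only [Finset.mem_erase, Finset.mem_range]; omega
      rw [this, ← hI]
      simp [sem, State.setReg]
    · rw [sem_ite_of_ne (by simp only [Expr.eval, hj', t1]; omega)]
      have : (Finset.range (j + 1)).erase (σ.reg r_edge) =
          insert j ((Finset.range j).erase (σ.reg r_edge)) := by
        ext x; simp only [Finset.mem_erase, Finset.mem_range, Finset.mem_insert]; omega
      rw [this, Finset.prod_insert (by simp)]
      have := mulDen_sem (σ := τ) (by rw [t2, t3, hj']; exact h j hj)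
      simp only [State.setReg]
      rw [Function.update_of_ne (by omega), this, hI, hj', t2]
      ring

theorem storeWeights_sem {σ : State} (h : ∀ e < σ.reg r_m, σ.arr a_den e < 2 ^ σ.reg r_bits) :
    ∀ e < σ.reg r_m, (storeWeights.sem σ).arr a_w e = σ.arr a_num e *
        ∏ i ∈ (Finset.range (σ.reg r_m)).erase e, σ.arr a_den i ∧
      (storeWeights.sem σ).arr a_w (e + σ.reg r_m) = (storeWeights.sem σ).arr a_w e := by
  refine count_induction (fun j τ => ∀ e < j, τ.arr a_w e = σ.arr a_num e *
        ∏ i ∈ (Finset.range (σ.reg r_m)).erase e, σ.arr a_den i ∧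
      τ.arr a_w (e + σ.reg r_m) = τ.arr a_w e) σ (fun e he => absurd he (by omega)) ?_
  intro j τ hj hI hj' hr ha e he
  have t1 : τ.reg r_m = σ.reg r_m := hr r_m rfl
  have t2 : τ.arr a_den = σ.arr a_den := ha a_den rfl
  have t3 : τ.reg r_bits = σ.reg r_bits := hr r_bits rfl
  have t4 : τ.arr a_num = σ.arr a_num := ha a_num rfl
  have hM := mulDens_sem (σ := τ) (by rw [t1, t2, t3]; exact h)
  rw [t1, t2, t4, hj'] at hM
  have t5 : (mulDens.sem τ).reg r_m = σ.reg r_m := (sem_reg rfl τ).trans t1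
  have t6 : (mulDens.sem τ).reg r_edge = j := (sem_reg rfl τ).trans hj'
  have t7 : (mulDens.sem τ).arr a_w = τ.arr a_w := sem_arr rfl τ
  rw [sem_seq, sem_seq]
  simp only [sem, Expr.eval, State.setReg, State.setArr, Function.update_self, t5, t6, t7, hM]
  by_cases hej : e = j
  · subst hej
    have h1 : e ≠ e + σ.reg r_m := by omega
    simp [Function.update_apply]
  · have h1 : e ≠ j + σ.reg r_m := by omega
    have h2 : e + σ.reg r_m ≠ j := by omega
    simpa [Function.update_apply, h1, h2, hej] using hI e (by omega)

theorem storeBase_sem (σ : State) :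
    ∀ x < σ.reg r_n, (storeBase.sem σ).arr a_base x = x * σ.reg r_m := by
  rw [storeBase, sem_seq]
  set σ₁ := (assign r_acc (.lit 0)).sem σ with hσ₁
  suffices H : (∀ x < σ₁.reg r_n, ((count r_vert r_n
      (store a_base (.reg r_vert) (.reg r_acc) ;;
        assign r_acc (.add (.reg r_acc) (.reg r_m)))).sem σ₁).arr a_base x = x * σ.reg r_m) ∧
      ((count r_vert r_n
      (store a_base (.reg r_vert) (.reg r_acc) ;;
        assign r_acc (.add (.reg r_acc) (.reg r_m)))).sem σ₁).reg r_acc =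
        σ₁.reg r_n * σ.reg r_m from H.1
  refine count_induction (fun j τ => (∀ x < j, τ.arr a_base x = x * σ.reg r_m) ∧
    τ.reg r_acc = j * σ.reg r_m) σ₁ ⟨fun x hx => absurd hx (by omega), ?_⟩ ?_
  · simp [hσ₁, sem, Expr.eval, State.setReg]
  · intro j τ _ hI hj hr _
    have t1 : τ.reg r_m = σ.reg r_m := hr r_m rfl
    refine ⟨fun x hx => ?_, ?_⟩
    · simp only [sem, Expr.eval, State.setReg, State.setArr, Function.update_self, hj, hI.2,
        Function.update_apply]
      split_ifs with hxj
      · rw [hxj]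
      · exact hI.1 x (by omega)
    · simp [sem, Expr.eval, State.setReg, State.setArr, hI.2, t1, add_mul]

theorem setup_sem (σ : State) :
    let τ := setup.sem σ
    τ.reg r_arcs = 2 * σ.reg r_m ∧ τ.reg r_cap = min (σ.reg r_k) (σ.reg r_m + 1) ∧
      τ.reg r_value = min (σ.reg r_k) (σ.reg r_m + 1) + 1 ∧
      τ.reg r_acc = σ.reg r_acc + ∑ e ∈ Finset.range (σ.reg r_m), σ.arr a_den e := by
  intro τ
  set σ₁ := (assign r_value (.add (.reg r_cap) (.lit 1))).sem
    ((assign r_cap (.sub (.reg r_k) (.sub (.reg r_k) (.add (.reg r_m) (.lit 1))))).sem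
      ((assign r_arcs (.add (.reg r_m) (.reg r_m))).sem σ)) with hσ₁
  have hτ : τ = (count r_edge r_m
    (assign r_acc (.add (.reg r_acc) (.arr a_den (.reg r_edge))))).sem σ₁ := rfl
  have e1 : σ₁.reg r_m = σ.reg r_m := rfl
  have hmin : σ.reg r_k - (σ.reg r_k - (σ.reg r_m + 1)) = min (σ.reg r_k) (σ.reg r_m + 1) := by
    omega
  refine ⟨?_, ?_, ?_, ?_⟩
  · rw [hτ, sem_reg rfl]
    simp [hσ₁, sem, Expr.eval, State.setReg, two_mul]
  · rw [hτ, sem_reg rfl]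
    simp [hσ₁, sem, Expr.eval, State.setReg, hmin]
  · rw [hτ, sem_reg rfl]
    simp [hσ₁, sem, Expr.eval, State.setReg, hmin]
  · rw [hτ, ← e1]
    refine count_induction (fun j τ => τ.reg r_acc =
      σ.reg r_acc + ∑ e ∈ Finset.range j, σ.arr a_den e) σ₁ ?_ ?_
    · simp [hσ₁, sem, State.setReg]
    · intro j τ _ hI hj _ ha
      have t1 : τ.arr a_den = σ.arr a_den := ha a_den rfl
      simp [sem, Expr.eval, State.setReg, hI, hj, t1, Finset.sum_range_succ, add_assoc]

end FTP

namespace FTP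
open Prog

/-! ### From instances to networks -/

/-- The state `σ` holds the network of the instance `I`, with weights multiplied by the product of
all denominators. -/
structure Instance.Prepared (I : Instance) (κ : GraphKind) (σ : State) : Prop where
  n : σ.reg r_n = I.n
  m : σ.reg r_m = I.m
  s : σ.reg r_s = I.s
  t : σ.reg r_t = I.t
  arcs : σ.reg r_arcs = 2 * I.m
  value : σ.reg r_value = min I.k (I.m + 1) + 1
  tl : ∀ e : Fin I.m, σ.arr a_tl e = I.tail e
  hd : ∀ e : Fin I.m, σ.arr a_hd e = I.head e
  tl_rev : ∀ e : Fin I.m, σ.arr a_tl (e + I.m) = I.head e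
  hd_rev : ∀ e : Fin I.m, σ.arr a_hd (e + I.m) = I.tail e
  flt : ∀ e : Fin I.m, σ.arr a_flt e ≠ 0 ↔ e ∈ I.faulty
  flt_rev : ∀ e : Fin I.m, σ.arr a_flt (e + I.m) ≠ 0 ↔ e ∈ I.faulty
  cap : ∀ e : Fin I.m, σ.arr a_cap e = if e ∈ I.faulty then 1 else min I.k (I.m + 1)
  cap_rev : ∀ e : Fin I.m, σ.arr a_cap (e + I.m) = match κ with
    | .directed => 0
    | .undirected => if e ∈ I.faulty then 1 else min I.k (I.m + 1)
  w : ∀ e : Fin I.m, σ.arr a_w e =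
    (I.weight e).num * ∏ i ∈ (Finset.range I.m).erase e, I.load.arr a_den i
  w_rev : ∀ e : Fin I.m, σ.arr a_w (e + I.m) = σ.arr a_w e
  base : ∀ x < I.n, σ.arr a_base x = x * I.m

/-- The network held by a state that has been prepared for the instance `I`. -/
def Instance.net (I : Instance) (σ : State) : Net where
  n := I.n
  N := 2 * I.m
  K := min I.k (I.m + 1)
  tl := σ.arr a_tl
  hd := σ.arr a_hd
  cap := σ.arr a_cap
  eid a := if a < I.m then a else a - I.m
  w := σ.arr a_w
  flt := I.faulty.map Fin.valEmbedding

namespace Instance.Prepared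

variable {I : Instance} {κ : GraphKind} {σ : State}

/-- An arc of the network is an edge of the instance or a reversed edge. -/
theorem arc_cases {a : ℕ} (ha : a < 2 * I.m) :
    (∃ e : Fin I.m, a = e) ∨ ∃ e : Fin I.m, a = e + I.m := by
  by_cases h : a < I.m
  · exact .inl ⟨⟨a, h⟩, rfl⟩
  · exact .inr ⟨⟨a - I.m, by omega⟩, by simp; omega⟩

theorem eid_coe (e : Fin I.m) : (I.net σ).eid e = e := if_pos e.2

theorem eid_rev (e : Fin I.m) : (I.net σ).eid (e + I.m) = e := by
  simp [net]

theorem mem_flt (e : Fin I.m) : (e : ℕ) ∈ (I.net σ).flt ↔ e ∈ I.faulty :=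
  Finset.mem_map' Fin.valEmbedding

theorem rep (h : I.Prepared κ σ) : (I.net σ).Rep σ where
  n := h.n
  arcs := h.arcs
  value := h.value
  tl := rfl
  hd := rfl
  cap := rfl
  w a ha := by
    rcases arc_cases ha with ⟨e, rfl⟩ | ⟨e, rfl⟩
    · rw [eid_coe]; rfl
    · rw [eid_rev, h.w_rev]; rfl
  flt a ha := by
    rcases arc_cases ha with ⟨e, rfl⟩ | ⟨e, rfl⟩
    · rw [eid_coe, mem_flt, h.flt]
    · rw [eid_rev, mem_flt, h.flt_rev]
  eid_lt a ha := by
    rw [h.m]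
    rcases arc_cases ha with ⟨e, rfl⟩ | ⟨e, rfl⟩
    · rw [eid_coe]; exact e.2
    · rw [eid_rev]; exact e.2
  eid a := by rw [h.m]; rfl
  arcs_eq := by rw [h.m]; rfl

theorem valid (h : I.Prepared κ σ) (hk : 1 ≤ I.k) : (I.net σ).Valid where
  tl_lt a ha := by
    rcases arc_cases ha with ⟨e, rfl⟩ | ⟨e, rfl⟩
    · exact (h.tl e).trans_lt (I.tail e).2
    · exact (h.tl_rev e).trans_lt (I.head e).2
  hd_lt a ha := by
    rcases arc_cases ha with ⟨e, rfl⟩ | ⟨e, rfl⟩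
    · exact (h.hd e).trans_lt (I.head e).2
    · exact (h.hd_rev e).trans_lt (I.tail e).2
  pair a ha b hb hab := by
    change a = b ∨ σ.arr a_tl a = σ.arr a_hd b ∧ σ.arr a_hd a = σ.arr a_tl b
    rcases arc_cases ha with ⟨e, rfl⟩ | ⟨e, rfl⟩ <;>
      rcases arc_cases hb with ⟨e', rfl⟩ | ⟨e', rfl⟩ <;>
      simp only [eid_coe, eid_rev] at hab <;>
      obtain rfl := Fin.ext hab <;>
      simp [h.tl, h.hd, h.tl_rev, h.hd_rev]
  cap_faulty a ha hf := by
    change σ.arr a_cap a ≤ 1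
    rcases arc_cases ha with ⟨e, rfl⟩ | ⟨e, rfl⟩
    · rw [eid_coe, mem_flt] at hf
      rw [h.cap, if_pos hf]
    · rw [eid_rev, mem_flt] at hf
      rw [h.cap_rev]
      cases κ <;> simp [hf]
  cap_safe a ha hf h0 := by
    change σ.arr a_cap a ≠ 0 at h0
    change σ.arr a_cap a = min I.k (I.m + 1)
    rcases arc_cases ha with ⟨e, rfl⟩ | ⟨e, rfl⟩
    · rw [eid_coe, mem_flt] at hf
      rw [h.cap, if_neg hf]
    · rw [eid_rev, mem_flt] at hf
      rw [h.cap_rev] at h0 ⊢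
      cases κ
      · exact absurd rfl h0
      · exact if_neg hf
  -- Capping at `m + 1` instead of `m` keeps `K` positive even when there are no edges.
  one_le := le_min hk (by omega)

/-- Reversed arcs have capacity `0` in the directed case, so only the undirected case can use them.
All other arcs are enabled because `1 ≤ k`. -/
theorem step_iff (h : I.Prepared κ σ) (hk : 1 ≤ I.k) (X : Finset (Fin I.m)) (u v : Fin I.n) :
    (I.net σ).Step (X.map Fin.valEmbedding) u v ↔ ∃ e ∈ X, I.Joins κ e u v := by
  have hmem : ∀ e : Fin I.m, (e : ℕ) ∈ X.map Fin.valEmbedding ↔ e ∈ X := by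
    intro e; exact Finset.mem_map' Fin.valEmbedding
  have hcap : ∀ e : Fin I.m, (if e ∈ I.faulty then 1 else min I.k (I.m + 1)) ≠ 0 := by
    intro e; split_ifs <;> omega
  constructor
  · rintro ⟨a, ha, h1, h2, h3, h4⟩
    change σ.arr a_cap a ≠ 0 at h2
    change σ.arr a_tl a = u at h3
    change σ.arr a_hd a = v at h4
    rcases arc_cases ha with ⟨e, rfl⟩ | ⟨e, rfl⟩
    · rw [eid_coe, hmem] at h1
      rw [h.tl] at h3
      rw [h.hd] at h4
      refine ⟨e, h1, ?_⟩
      cases κ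
      · exact ⟨Fin.ext h3, Fin.ext h4⟩
      · exact .inl ⟨Fin.ext h3, Fin.ext h4⟩
    · rw [eid_rev, hmem] at h1
      rw [h.tl_rev] at h3
      rw [h.hd_rev] at h4
      rw [h.cap_rev] at h2
      refine ⟨e, h1, ?_⟩
      cases κ
      · exact absurd rfl h2
      · exact .inr ⟨Fin.ext h4, Fin.ext h3⟩
  · rintro ⟨e, he, hj⟩
    have hfwd : I.tail e = u → I.head e = v →
        (I.net σ).Step (X.map Fin.valEmbedding) u v := by
      rintro rfl rfl
      refine ⟨e, ?_, ?_, ?_, h.tl e, h.hd e⟩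
      · change (e : ℕ) < 2 * I.m
        omega
      · rwa [eid_coe, hmem]
      · change σ.arr a_cap e ≠ 0
        rw [h.cap]; exact hcap e
    cases κ with
    | directed => exact hfwd hj.1 hj.2
    | undirected =>
      rcases hj with ⟨h1, h2⟩ | ⟨rfl, rfl⟩
      · exact hfwd h1 h2
      · refine ⟨e + I.m, ?_, ?_, ?_, h.tl_rev e, h.hd_rev e⟩
        · change (e : ℕ) + I.m < 2 * I.m
          omega
        · rwa [eid_rev, hmem]
        · change σ.arr a_cap (e + I.m) ≠ 0
          rw [h.cap_rev]; exact hcap e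

theorem hasPath_iff (h : I.Prepared κ σ) (hk : 1 ≤ I.k) (X : Finset (Fin I.m)) :
    I.HasPath κ X ↔
      Relation.ReflTransGen ((I.net σ).Step (X.map Fin.valEmbedding)) I.s I.t := by
  constructor
  · intro hp
    exact hp.lift Fin.val fun u v huv => (h.step_iff hk X u v).2 huv
  · intro hp
    have key : ∀ y, Relation.ReflTransGen ((I.net σ).Step (X.map Fin.valEmbedding)) I.s y →
        ∃ v : Fin I.n, v = y ∧
          Relation.ReflTransGen (fun u v => ∃ e ∈ X, I.Joins κ e u v) I.s v := by
      intro y hy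
      induction hy with
      | refl => exact ⟨I.s, rfl, .refl⟩
      | tail _ hst ih =>
        obtain ⟨v, rfl, hv⟩ := ih
        have hlt : ∀ y', (I.net σ).Step (X.map Fin.valEmbedding) v y' → y' < I.n := by
          rintro _ ⟨a, ha, -, -, -, rfl⟩
          exact (h.valid hk).hd_lt a ha
        -- Network vertices are plain numbers; since heads of arcs are below `n`, a walk from `s`
        -- stays among the vertices of the instance.
        exact ⟨⟨_, hlt _ hst⟩, rfl, hv.tail ((h.step_iff hk X v ⟨_, hlt _ hst⟩).1 hst)⟩
    obtain ⟨v, hv, hpv⟩ := key _ hp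
    rwa [Fin.ext hv] at hpv

theorem isFeasible_iff (h : I.Prepared κ σ) (hk : 1 ≤ I.k) (X : Finset (Fin I.m)) :
    I.IsFeasible κ X ↔ (I.net σ).Feasible I.s I.t (X.map Fin.valEmbedding) := by
  have hsd : ∀ F : Finset (Fin I.m), X.map Fin.valEmbedding \ F.map Fin.valEmbedding =
      (X \ F).map Fin.valEmbedding := by
    intro F
    ext e
    simp only [Finset.mem_sdiff, Finset.mem_map, Fin.valEmbedding_apply]
    constructor
    · rintro ⟨⟨e, he, rfl⟩, h2⟩
      exact ⟨e, ⟨he, fun h' => h2 ⟨e, h', rfl⟩⟩, rfl⟩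
    · rintro ⟨e, ⟨he, h2⟩, rfl⟩
      refine ⟨⟨e, he, rfl⟩, ?_⟩
      rintro ⟨e', he', h'⟩
      exact h2 (Fin.ext h' ▸ he')
  constructor
  · intro hX F hF hc
    obtain ⟨F, hF', rfl⟩ := Finset.subset_map_iff.1 hF
    rw [hsd, ← h.hasPath_iff hk]
    rw [Finset.card_map] at hc
    exact hX F hF' (hc.trans (min_le_left _ _))
  · intro hX F hF hc
    rw [h.hasPath_iff hk, ← hsd]
    refine hX _ (Finset.map_subset_map.2 hF) ?_
    rw [Finset.card_map]
    -- A failure set has at most `m` edges, so lowering `k` to `min k (m + 1)` excludes none.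
    have := Finset.card_le_univ F
    rw [Fintype.card_fin] at this
    exact le_min hc (by omega)

/-- All costs are scaled by the same positive factor, the product of all denominators, so ratios
between costs are unaffected. -/
theorem weight_eq (h : I.Prepared κ σ) (X : Finset (Fin I.m)) :
    ((I.net σ).weight (X.map Fin.valEmbedding) : ℚ≥0) =
      (∏ i ∈ Finset.range I.m, I.load.arr a_den i : ℕ) * I.cost X := by
  rw [Net.weight, Finset.sum_map, cost, Nat.cast_sum, Finset.mul_sum]
  refine Finset.sum_congr rfl fun e _ => ?_
  change ((σ.arr a_w e : ℕ) : ℚ≥0) = _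
  have hden : I.load.arr a_den e = (I.weight e).den := by simp [load]
  rw [h.w, ← Finset.mul_prod_erase _ _ (Finset.mem_range.2 e.2), hden]
  push_cast
  rw [← NNRat.den_mul_eq_num (I.weight e)]
  ring

theorem den_prod_ne_zero (I : Instance) :
    ((∏ i ∈ Finset.range I.m, I.load.arr a_den i : ℕ) : ℚ≥0) ≠ 0 := by
  rw [Nat.cast_ne_zero, Finset.prod_ne_zero_iff]
  intro i hi
  have hden : I.load.arr a_den i = (I.weight ⟨i, Finset.mem_range.1 hi⟩).den := by
    simp [load, Finset.mem_range.1 hi]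
  rw [hden]
  exact NNRat.den_ne_zero _

/-- The main program, followed by the report, answers correctly. -/
theorem correctAnswer (h : I.Prepared κ σ) (hk : 1 ≤ I.k) (hR : ∀ x, σ.arr a_rank' x = 0)
    (hp : ∀ x, σ.arr a_pot' x = 0) (hsol : ∀ i, σ.arr a_sol i = 0) :
    CorrectAnswer κ I.k I (report.sem (solve.sem σ)) := by
  have H := solve_sem (h.valid hk) h.rep (by rw [h.m]; exact h.base)
    (by rw [h.s]; exact I.s.2) (by rw [h.t]; exact I.t.2) hR hp hsol
  rw [h.s, h.t, h.m] at H
  have ht : (solve.sem σ).reg r_t = I.t := (sem_reg rfl σ).trans h.t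
  have hout : edgeSet I.m ((solve.sem σ).arr a_out) =
      (I.output (report.sem (solve.sem σ))).map Fin.valEmbedding := by
    have e : (report.sem (solve.sem σ)).arr a_out = (solve.sem σ).arr a_out := sem_arr rfl _
    ext i
    simp only [edgeSet, Instance.output, e, Finset.mem_filter, Finset.mem_range, Finset.mem_map,
      Finset.mem_univ, true_and, Fin.valEmbedding_apply]
    constructor
    · rintro ⟨h1, h2⟩; exact ⟨⟨i, h1⟩, h2, rfl⟩
    · rintro ⟨e, h1, rfl⟩; exact ⟨e.2, h1⟩
  rw [hout] at H
  refine ⟨?_, ?_⟩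
  · rintro ⟨T, hT⟩
    have hRt : (solve.sem σ).arr a_rank' I.t ≠ 0 := fun h0 =>
      H.2 h0 _ ((h.isFeasible_iff hk T).1 hT)
    obtain ⟨H1, H2⟩ := H.1 hRt
    refine ⟨?_, (h.isFeasible_iff hk _).2 H1, fun T hT => ?_⟩
    · rw [report, sem_ite_of_ne (by simpa [Expr.eval, ht] using hRt)]
      simp [sem, Expr.eval, State.setReg]
    · have H3 := H2 _ ((h.isFeasible_iff hk T).1 hT)
      have H4 : ((I.net σ).weight
          ((I.output (report.sem (solve.sem σ))).map Fin.valEmbedding) : ℚ≥0)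
          ≤ (I.k : ℚ≥0) * ((I.net σ).weight (T.map Fin.valEmbedding) : ℚ≥0) := by
        exact_mod_cast H3.trans (Nat.mul_le_mul_right _ (min_le_left _ _))
      rw [h.weight_eq, h.weight_eq, mul_left_comm] at H4
      exact le_of_mul_le_mul_left H4 (pos_iff_ne_zero.2 (den_prod_ne_zero I))
  · intro hT
    have hRt : (solve.sem σ).arr a_rank' I.t = 0 := by
      by_contra h0
      exact hT ⟨_, (h.isFeasible_iff hk _).2 (H.1 h0).1⟩
    rw [report, sem_ite_of_eq (by simpa [Expr.eval, ht] using hRt)]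
    simp [sem, Expr.eval, State.setReg]

end Instance.Prepared

/-! ### The complete algorithm and its running time -/

theorem size_sum_le {ι : Type*} (s : Finset ι) (f : ι → ℕ) :
    Nat.size (∑ i ∈ s, f i) ≤ ∑ i ∈ s, Nat.size (f i) := by
  classical
  have hadd : ∀ a b : ℕ, Nat.size (a + b) ≤ Nat.size a + Nat.size b := by
    intro a b
    rcases Nat.eq_zero_or_pos a with rfl | ha
    · simp
    rcases Nat.eq_zero_or_pos b with rfl | hb
    · simp
    rw [Nat.size_le]
    have h1 := Nat.lt_size_self a
    have h2 := Nat.lt_size_self b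
    have h3 : 2 ^ 1 ≤ 2 ^ Nat.size a := Nat.pow_le_pow_right (by omega) (Nat.size_pos.2 ha)
    have h4 : 2 ^ 1 ≤ 2 ^ Nat.size b := Nat.pow_le_pow_right (by omega) (Nat.size_pos.2 hb)
    rw [pow_add]
    nlinarith
  induction s using Finset.induction_on with
  | empty => simp
  | insert i s hi ih =>
    rw [Finset.sum_insert hi, Finset.sum_insert hi]
    exact (hadd _ _).trans (Nat.add_le_add_left ih _)

/-- The complete algorithm. -/
def algorithm (κ : GraphKind) : Cmd :=
  .seq setup.compile (.seq bitLength (.seq (main κ).compile report.compile))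

/-- Apart from the two registers used for the bit length, the state agrees with the result of
`setup`. The bit count need not be exact: it suffices that it bounds the length of every
denominator. -/
theorem prepared (I : Instance) (κ : GraphKind) {σ : State}
    (hr : ∀ x, x ≠ r_acc → x ≠ r_bits → σ.reg x = (setup.sem I.load).reg x)
    (ha : σ.arr = (setup.sem I.load).arr)
    (hL : ∀ e < I.m, I.load.arr a_den e < 2 ^ σ.reg r_bits) :
    I.Prepared κ (storeBase.sem (storeWeights.sem ((storeArcs κ).sem σ))) := by
  obtain ⟨s1, s2, s3, -⟩ := setup_sem I.load
  have arr0 : ∀ a, σ.arr a = I.load.arr a := fun a => by rw [ha]; exact sem_arr rfl _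
  have hm : σ.reg r_m = I.m := (hr r_m (by omega) (by omega)).trans (sem_reg rfl _)
  have hn : σ.reg r_n = I.n := (hr r_n (by omega) (by omega)).trans (sem_reg rfl _)
  have hs : σ.reg r_s = I.s := (hr r_s (by omega) (by omega)).trans (sem_reg rfl _)
  have ht : σ.reg r_t = I.t := (hr r_t (by omega) (by omega)).trans (sem_reg rfl _)
  have hN : σ.reg r_arcs = 2 * I.m := (hr r_arcs (by omega) (by omega)).trans s1
  have hc : σ.reg r_cap = min I.k (I.m + 1) := (hr r_cap (by omega) (by omega)).trans s2
  have hv : σ.reg r_value = min I.k (I.m + 1) + 1 := (hr r_value (by omega) (by omega)).trans s3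
  have HA := storeArcs_sem κ σ
  have kreg : ∀ x, x ≠ r_edge → x ≠ r_tmp → ((storeArcs κ).sem σ).reg x = σ.reg x := by
    intro x h1 h2
    refine sem_reg ?_ _
    cases κ <;> simp [storeArcs, writesReg, h1, h2]
  have karr : ∀ a, a ≠ a_tl → a ≠ a_hd → a ≠ a_flt → a ≠ a_cap →
      ((storeArcs κ).sem σ).arr a = I.load.arr a := by
    intro a h1 h2 h3 h4
    rw [← arr0]
    refine sem_arr ?_ _
    cases κ <;> simp [storeArcs, writesArr, h1, h2, h3, h4]
  simp only [hm, hc, arr0] at HA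
  have k1 := (kreg r_n (by omega) (by omega)).trans hn
  have k2 := (kreg r_m (by omega) (by omega)).trans hm
  have k3 := (kreg r_s (by omega) (by omega)).trans hs
  have k4 := (kreg r_t (by omega) (by omega)).trans ht
  have k5 := (kreg r_arcs (by omega) (by omega)).trans hN
  have k6 := (kreg r_value (by omega) (by omega)).trans hv
  have k7 := kreg r_bits (by omega) (by omega)
  have k8 := karr a_den (by omega) (by omega) (by omega) (by omega)
  have k9 := karr a_num (by omega) (by omega) (by omega) (by omega)
  generalize (storeArcs κ).sem σ = σ₁ at *
  have HW := storeWeights_sem (σ := σ₁) (by rw [k2, k7, k8]; exact hL)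
  rw [k2, k8, k9] at HW
  have HB := storeBase_sem (storeWeights.sem σ₁)
  have n₂ : (storeWeights.sem σ₁).reg r_n = I.n := (sem_reg rfl _).trans k1
  have m₂ : (storeWeights.sem σ₁).reg r_m = I.m := (sem_reg rfl _).trans k2
  rw [n₂, m₂] at HB
  have hreg : ∀ x, storeWeights.writesReg x = false → storeBase.writesReg x = false →
      (storeBase.sem (storeWeights.sem σ₁)).reg x = σ₁.reg x := fun x h1 h2 =>
    (sem_reg h2 _).trans (sem_reg h1 _)
  have harr : ∀ a, storeWeights.writesArr a = false → storeBase.writesArr a = false →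
      (storeBase.sem (storeWeights.sem σ₁)).arr a = σ₁.arr a := fun x h1 h2 =>
    (sem_arr h2 _).trans (sem_arr h1 _)
  have hw : (storeBase.sem (storeWeights.sem σ₁)).arr a_w = (storeWeights.sem σ₁).arr a_w :=
    sem_arr rfl _
  have l0 : ∀ e : Fin I.m, I.load.arr a_tl e = I.tail e := fun e => by simp [Instance.load]
  have l1 : ∀ e : Fin I.m, I.load.arr a_hd e = I.head e := fun e => by simp [Instance.load]
  have l2 : ∀ e : Fin I.m, I.load.arr a_flt e = if e ∈ I.faulty then 1 else 0 := fun e => by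
    simp [Instance.load]
  have l3 : ∀ e : Fin I.m, I.load.arr a_num e = (I.weight e).num := fun e => by
    simp [Instance.load]
  have l4 : ∀ e : Fin I.m, I.load.arr a_flt e ≠ 0 ↔ e ∈ I.faulty := fun e => by
    rw [l2]; simp
  constructor
  · rw [hreg _ rfl rfl, k1]
  · rw [hreg _ rfl rfl, k2]
  · rw [hreg _ rfl rfl, k3]
  · rw [hreg _ rfl rfl, k4]
  · rw [hreg _ rfl rfl, k5]
  · rw [hreg _ rfl rfl, k6]
  · intro e; rw [harr _ rfl rfl, (HA e e.2).1, l0]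
  · intro e; rw [harr _ rfl rfl, (HA e e.2).2.1, l1]
  · intro e; rw [harr _ rfl rfl, (HA e e.2).2.2.2.1, l1]
  · intro e; rw [harr _ rfl rfl, (HA e e.2).2.2.2.2.1, l0]
  · intro e; rw [harr _ rfl rfl, (HA e e.2).2.2.1, l4]
  · intro e; rw [harr _ rfl rfl, (HA e e.2).2.2.2.2.2.1, l4]
  · intro e; rw [harr _ rfl rfl, (HA e e.2).2.2.2.2.2.2.1]; simp only [l4]
  · intro e; rw [harr _ rfl rfl, (HA e e.2).2.2.2.2.2.2.2]
    cases κ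
    exacts [rfl, by simp only [l4]]
  · intro e; rw [hw, (HW e e.2).1, l3]
  · intro e; rw [hw, (HW e e.2).2]
  · exact HB

end FTP

open FTP Prog in
theorem theorem6 (κ : FTP.GraphKind) :
    ∃ (alg : FTP.Cmd) (p : Polynomial ℕ), ∀ I : FTP.Instance, 1 ≤ I.k →
      ∃ (steps : ℕ) (σ : FTP.State),
        FTP.Run alg I.load steps σ ∧ steps ≤ p.eval I.size ∧
          FTP.CorrectAnswer κ (I.k : ℚ≥0) I σ := by
  -- Loop lengths in `setup` are at most the input size, and the bit count costs `9` steps per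
  -- digit. In `main` the loop bounds are `n`, `m`, `2 * m`, `K + 1 ≤ m + 2` and the bit count, all
  -- at most twice the size plus `2`; `report` has no loop.
  refine ⟨algorithm κ, setup.timePoly + (9 * Polynomial.X + 2) +
    ((main κ).timePoly.comp (2 * Polynomial.X + 2) + report.timePoly), fun I hk => ?_⟩
  have hmsize : I.m ≤ I.size := by unfold Instance.size; omega
  have hnsize : I.n ≤ I.size := by unfold Instance.size; omega
  obtain ⟨n₁, run₁, le₁⟩ := exists_run (P := [r_m]) (p := setup) (B := I.size) rfl I.load
    (by simpa [Instance.load] using hmsize)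
  obtain ⟨s1, s2, s3, s4⟩ := setup_sem I.load
  obtain ⟨n₂, σ₂, run₂, le₂, arr₂, bits₂, reg₂⟩ := bitLength_run (setup.sem I.load)
  have hsum : (setup.sem I.load).reg r_acc =
      ∑ e ∈ Finset.range I.m, I.load.arr a_den e := by
    rw [s4]; simp [Instance.load]
  have hbits0 : (setup.sem I.load).reg r_bits = 0 := sem_reg rfl _
  rw [hbits0, zero_add, hsum] at bits₂
  rw [hsum] at le₂
  have hsz : Nat.size (∑ e ∈ Finset.range I.m, I.load.arr a_den e) ≤ I.size := by
    refine (size_sum_le _ _).trans ?_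
    rw [← Fin.sum_univ_eq_sum_range (fun e => Nat.size (I.load.arr a_den e))]
    have : ∑ e : Fin I.m, Nat.size (I.load.arr a_den e) ≤
        ∑ e, (Nat.size (I.weight e).num + Nat.size (I.weight e).den) := by
      refine Finset.sum_le_sum fun e _ => ?_
      have : I.load.arr a_den e = (I.weight e).den := by simp [Instance.load]
      rw [this]; omega
    unfold Instance.size
    omega
  have hL : ∀ e < I.m, I.load.arr a_den e < 2 ^ σ₂.reg r_bits := by
    intro e he
    rw [bits₂]
    -- Each denominator is at most the sum of all of them, whose bit length was computed; one common
    -- number of multiplication rounds thus serves every denominator.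
    refine lt_of_le_of_lt ?_ (Nat.lt_size_self _)
    exact Finset.single_le_sum (f := fun e => I.load.arr a_den e) (fun _ _ => Nat.zero_le _)
      (Finset.mem_range.2 he)
  have hprep := prepared I κ reg₂ arr₂ hL
  have hP : ∀ r ∈ [r_n, r_m, r_arcs, r_value, r_bits], σ₂.reg r ≤ 2 * I.size + 2 := by
    have h0 : σ₂.reg r_n = I.n := (reg₂ r_n (by omega) (by omega)).trans (sem_reg rfl _)
    have h1 : σ₂.reg r_m = I.m := (reg₂ r_m (by omega) (by omega)).trans (sem_reg rfl _)
    have h2 : σ₂.reg r_arcs = 2 * I.m := (reg₂ r_arcs (by omega) (by omega)).trans s1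
    have h3 : σ₂.reg r_value = min I.k (I.m + 1) + 1 :=
      (reg₂ r_value (by omega) (by omega)).trans s3
    simp only [List.mem_cons, List.not_mem_nil, or_false, forall_eq_or_imp, forall_eq, h0, h1, h2,
      h3, bits₂]
    omega
  obtain ⟨n₃, run₃, le₃⟩ := exists_run (P := [r_n, r_m, r_arcs, r_value, r_bits]) (p := main κ)
    (B := 2 * I.size + 2) (by cases κ <;> rfl) σ₂ hP
  obtain ⟨n₄, run₄, le₄⟩ := exists_run (P := []) (p := report) (B := I.size) rfl
    ((main κ).sem σ₂) (by simp)
  refine ⟨_, _, .seq run₁ (.seq run₂ (.seq run₃ run₄)), ?_, ?_⟩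
  · simp only [Polynomial.eval_add, Polynomial.eval_mul, Polynomial.eval_comp, Polynomial.eval_X,
      Polynomial.eval_ofNat]
    omega
  · have harr : ∀ a, (storeArcs κ).writesArr a = false → storeWeights.writesArr a = false →
        storeBase.writesArr a = false →
        (storeBase.sem (storeWeights.sem ((storeArcs κ).sem σ₂))).arr a = I.load.arr a := by
      intro a h1 h2 h3
      rw [sem_arr h3, sem_arr h2, sem_arr h1, arr₂]
      exact sem_arr rfl _
    refine hprep.correctAnswer hk (fun x => ?_) (fun x => ?_) (fun x => ?_)
    · rw [harr a_rank' (by cases κ <;> rfl) rfl rfl]; simp [Instance.load]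
    · rw [harr a_pot' (by cases κ <;> rfl) rfl rfl]; simp [Instance.load]
    · rw [harr a_sol (by cases κ <;> rfl) rfl rfl]; simp [Instance.load]
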